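/- Let $n\ge 2$ and identify $S^n$ with $\mathbb{R}^n\cup\{\infty\}$. A map $f:S^n\to S^n$ is called $K$-quasiregular ($K\ge 1$) if it is continuous and, after composing with an orientation-preserving Möbius map exchanging $0$ and $\infty$ in source and/or target where necessary, it lies in $W^{1,n}_{loc}$ and satisfies $|f'(x)|^n\le K J_f(x)$ and $J_f(x)\le K\inf_{|h|=1}|f'(x)h|^n$ almost everywhere; here $J_f=\det f'$ and $|f'(x)|$ is the operator norm. It is $K$-uqr if every iterate $f^m$, $m\ge1$, is $K$-quasiregular, and uqr if it is $K$-uqr for some $K$. "Möbius map" means orientation-preserving Möbius map. For a family $T$ of self-maps of $S^n$, $\langle T\rangle$ is the semigroup generated by $T$ under composition. A quasiregular semigroup is a family of non-injective self-maps of $S^n$, closed under composition, whose elements are all $K$-quasiregular for one common $K$. Let $f:S^n\to S^n$ be $K$-uqr for some $K>1$ and not $1$-quasiregular. Suppose that there is a point $x_0\in S^n$ at which $f$ is differentiable and $f'(x_0)$ is not of the form $\lambda\mathcal{O}$ with $\lambda>0$ and $\mathcal{O}$ an orthogonal linear map (when $x_0=\infty$ or $f(x_0)=\infty$ the derivative is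 taken after the above change of coordinates). Then there is a Möbius map $A$ such that $A\circ f$ is not uqr. Consequently, for this $A$, there is no $K'$ for which all elements of $\langle f,A\rangle$ are $K'$-quasiregular; in particular $\langle f,A\rangle$ is not a quasiregular semigroup. -/

import Mathlib

open MeasureTheory Set
open scoped ContDiff

namespace QRSemigroup

/-- `ℝⁿ` with its Euclidean norm. -/
abbrev Euc (n : ℕ) : Type := EuclideanSpace ℝ (Fin n)

/-- The sphere `Sⁿ`, identified with `ℝⁿ ∪ {∞}` (the one-point compactification of `ℝⁿ`). -/
abbrev Sph (n : ℕ) : Type := OnePoint (Euc n)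

/-! ### Quasiregular mappings in open subsets of `ℝⁿ` -/

/-- `Df` is the weak (distributional) derivative of `f : U → ℝⁿ` in the open set `U`:
`∫ (∂ᵥφ) f = - ∫ φ (Df · v)` for all test functions `φ ∈ C_c^∞(U)` and all directions `v`. -/
structure IsWeakDerivOn {n : ℕ} (U : Set (Euc n)) (f : Euc n → Euc n)
    (Df : Euc n → (Euc n →L[ℝ] Euc n)) : Prop where
  locInt : LocallyIntegrableOn f U
  locInt_deriv : LocallyIntegrableOn Df U
  integral_eq : ∀ φ : Euc n → ℝ, ContDiff ℝ ∞ φ → HasCompactSupport φ → tsupport φ ⊆ U →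
    ∀ v : Euc n, ∫ x, (fderiv ℝ φ x v) • f x = - ∫ x, φ x • (Df x v)

/-- `f ∈ W^{1,n}_loc(U; ℝⁿ)` with weak derivative `Df`: both are in `Lⁿ` on compact subsets. -/
structure HasSobolevDerivOn {n : ℕ} (U : Set (Euc n)) (f : Euc n → Euc n)
    (Df : Euc n → (Euc n →L[ℝ] Euc n)) : Prop where
  weak : IsWeakDerivOn U f Df
  memLp : ∀ C : Set (Euc n), IsCompact C → C ⊆ U → MemLp f (n : ENNReal) (volume.restrict C)
  memLp_deriv : ∀ C : Set (Euc n), IsCompact C → C ⊆ U →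
    MemLp Df (n : ENNReal) (volume.restrict C)

/-- `f` is `K`-quasiregular in the open set `U ⊆ ℝⁿ`: it is continuous, lies in `W^{1,n}_loc(U)`,
and almost everywhere in `U` both `|f'(x)|ⁿ ≤ K J_f(x)` (outer dilatation at most `K`)
and `J_f(x) ≤ K |f'(x)h|ⁿ` for every unit vector `h` (inner dilatation at most `K`).
Here `|f'(x)|` is the operator norm. -/
def IsQuasiregularOn {n : ℕ} (K : ℝ) (U : Set (Euc n)) (f : Euc n → Euc n) : Prop :=
  1 ≤ K ∧ ContinuousOn f U ∧
    ∃ Df : Euc n → (Euc n →L[ℝ] Euc n), HasSobolevDerivOn U f Df ∧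
      ∀ᵐ x ∂(volume.restrict U),
        ‖Df x‖ ^ n ≤ K * (Df x).det ∧
        ∀ h : Euc n, ‖h‖ = 1 → (Df x).det ≤ K * ‖Df x h‖ ^ n

/-! ### The sphere, Möbius maps, and quasiregular mappings of the sphere -/

/-- The reflection of `ℝⁿ` which changes the sign of the first coordinate. -/
noncomputable def reflectFirst {n : ℕ} (x : Euc n) : Euc n :=
  WithLp.toLp 2 fun i => if (i : ℕ) = 0 then - x i else x i

open Classical in
/-- The orientation-preserving Möbius involution `x ↦ R x / |x|²`, with `R` the reflection in the
first coordinate; it exchanges `0` and `∞`. -/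
noncomputable def inv {n : ℕ} (p : Sph n) : Sph n :=
  OnePoint.elim p (((0 : Euc n) : Sph n))
    (fun x => if x = 0 then OnePoint.infty
      else (((‖x‖ ^ 2)⁻¹ • reflectFirst x : Euc n) : Sph n))

/-- The (orientation-preserving) Möbius maps of `Sⁿ = ℝⁿ ∪ {∞}`: the group generated by the
orientation-preserving similarities `x ↦ c O x + b` (`c > 0`, `O` a rotation), fixing `∞`,
and the involution `inv`. -/
inductive IsMobius {n : ℕ} : (Sph n → Sph n) → Prop
  | similarity (c : ℝ) (hc : 0 < c) (O : Euc n ≃ₗᵢ[ℝ] Euc n)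
      (hO : LinearMap.det (O.toLinearEquiv : Euc n →ₗ[ℝ] Euc n) = 1) (b : Euc n) :
      IsMobius (OnePoint.map fun x => c • O x + b)
  | inversion : IsMobius inv
  | comp (A B : Sph n → Sph n) (hA : IsMobius A) (hB : IsMobius B) : IsMobius (A ∘ B)

/-- The point of `ℝⁿ` underlying a point of `Sⁿ` (with the unused value `0` at `∞`). -/
noncomputable def toEuc {n : ℕ} (p : Sph n) : Euc n := OnePoint.elim p 0 id

/-- The points of `ℝⁿ` at which `g : Sⁿ → Sⁿ` takes a finite value. -/
def finiteDomain {n : ℕ} (g : Sph n → Sph n) : Set (Euc n) :=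
  {x | g (x : Sph n) ≠ OnePoint.infty}

/-- `g : Sⁿ → Sⁿ` as a map to `ℝⁿ`, to be used on `finiteDomain g` only. -/
noncomputable def finitePart {n : ℕ} (g : Sph n → Sph n) (x : Euc n) : Euc n :=
  toEuc (g (x : Sph n))

/-- `f : Sⁿ → Sⁿ` is `K`-quasiregular: it is continuous, and its representatives in the two charts
(the identity, and `inv` which moves `∞` to `0`) in source and target are `K`-quasiregular on the
open subsets of `ℝⁿ` on which they are finite. -/
def IsQuasiregular {n : ℕ} (K : ℝ) (f : Sph n → Sph n) : Prop :=
  Continuous f ∧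
    ∀ α ∈ ({id, inv} : Set (Sph n → Sph n)), ∀ β ∈ ({id, inv} : Set (Sph n → Sph n)),
      IsQuasiregularOn K (finiteDomain (β ∘ f ∘ α)) (finitePart (β ∘ f ∘ α))

/-- `f` is uniformly `K`-quasiregular (`K`-uqr): all iterates are `K`-quasiregular. -/
def IsUniformlyQuasiregular {n : ℕ} (K : ℝ) (f : Sph n → Sph n) : Prop :=
  ∀ m : ℕ, 1 ≤ m → IsQuasiregular K f^[m]

/-- `f` is uqr. -/
def IsUqr {n : ℕ} (f : Sph n → Sph n) : Prop := ∃ K : ℝ, IsUniformlyQuasiregular K f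

/-! ### The derivative at a point of the sphere -/

open Classical in
/-- The chart used at the point `p`: the identity if `p` is finite, and `inv` if `p = ∞`. -/
noncomputable def chartAt {n : ℕ} (p : Sph n) : Sph n → Sph n :=
  if p = OnePoint.infty then inv else id

/-- The representative of `f` in the charts at `x₀` and `f x₀`. -/
noncomputable def localRep {n : ℕ} (f : Sph n → Sph n) (x₀ : Sph n) : Euc n → Euc n :=
  finitePart (chartAt (f x₀) ∘ f ∘ chartAt x₀)

/-- The coordinate of `x₀` in the chart at `x₀`. -/
noncomputable def coordAt {n : ℕ} (x₀ : Sph n) : Euc n := toEuc (chartAt x₀ x₀)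

/-- `f'(x₀) = L`, the derivative (in the usual sense) being taken in the charts at `x₀` and
`f x₀`; for finite `x₀` and `f x₀` these are the identity. -/
def HasDerivAtPoint {n : ℕ} (f : Sph n → Sph n) (L : Euc n →L[ℝ] Euc n) (x₀ : Sph n) : Prop :=
  HasFDerivAt (localRep f x₀) L (coordAt x₀)

/-- The linear map `L` is conformal: `L = c O` with `c > 0` and `O` orthogonal. -/
def IsConformalLinear {n : ℕ} (L : Euc n →L[ℝ] Euc n) : Prop :=
  ∃ c : ℝ, 0 < c ∧ ∃ O : Euc n ≃ₗᵢ[ℝ] Euc n, ∀ v, L v = c • O v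

/-! ### Quasiregular semigroups -/

/-- Membership in the semigroup under composition generated by a family `T`. -/
inductive Generated {X : Type} (T : Set (X → X)) : (X → X) → Prop
  | of (g : X → X) (hg : g ∈ T) : Generated T g
  | comp (g h : X → X) (hg : Generated T g) (hh : Generated T h) : Generated T (g ∘ h)

/-- The semigroup `⟨T⟩` generated by `T` under composition. -/
def generatedSemigroup {X : Type} (T : Set (X → X)) : Set (X → X) := {g | Generated T g}

/-- A quasiregular semigroup: a family of non-injective maps `Sⁿ → Sⁿ`, closed under composition,
all of which are `K`-quasiregular for one `K`. -/
def IsQuasiregularSemigroup {n : ℕ} (G : Set (Sph n → Sph n)) : Prop :=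
  (∃ K : ℝ, ∀ g ∈ G, IsQuasiregular K g) ∧ (∀ g ∈ G, ¬ Function.Injective g) ∧
    ∀ g ∈ G, ∀ h ∈ G, g ∘ h ∈ G

end QRSemigroup

namespace QRSemigroup

/-! ### Determinants of families of linear forms -/

/-! Since `f` is quasiregular but not `1`-quasiregular, there is, in suitable charts, a point `x`
where `f` is differentiable with derivative `L` satisfying `0 < det L < ‖L‖ ^ n`. Choose a unit
vector `v` with `‖L v‖ = ‖L‖` and a rotation `O` with `O (L v) = ‖L‖ • v`. A Möbius map that reads
in the charts as `O` followed by a translation can be arranged to carry the image of `x` back to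
`x`. The composition then fixes `x`, and its derivative `N = O L` there has eigenvalue `‖L‖` along
`v` and determinant `det L`. The `m`-th iterate has derivative `N ^ m`, so its distortion at `x` is
at least `(‖L‖ ^ n / det L) ^ m`, which is unbounded in `m`. This is `exists_isMobius_not_isUqr`,
through `not_isUqr_of_fixedPoint`; the statements on the semigroup follow because it contains all
iterates of `A ∘ f`.

Two analytic facts make this rigorous. Quasiregular maps are differentiable almost everywhere, with
the weak derivative as derivative (`ae_hasFDerivAt`); this produces `x`. Moreover, the dilatation
inequality, assumed only almost everywhere, holds at every point of differentiability
(`IsQuasiregularOn.inner_pow_le`). The latter is indispensable, since the fixed point alone is a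
null set.

Both facts rest on the Jacobian being a null Lagrangian: its integral vanishes for compactly
supported `W^{1,n}` maps (`integral_rowDet_eq_zero`), so derivatives can be moved between a row and
a test function (`integral_mul_rowDet`). Determinants are written in terms of rows so that one
component at a time can be modified.

For differentiability, integration by parts and the Poincaré inequality on a cubical annulus give
geometric decay of the `n`-energy by hole filling (`exists_energy_decay`). Hence the modulus of
continuity is controlled by the energy alone (`exists_average_modulus`). At an `Lⁿ` Lebesgue point
of the gradient the blow-ups have gradients converging to a constant in `Lⁿ`, and the common modulus
upgrades this to uniform convergence of the blow-ups (`hasFDerivAt_of_lebesgue`).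

For the pointwise inequality, the blow-ups at a point of differentiability converge uniformly to the
derivative. A Caccioppoli estimate bounds their energy, so their Jacobians converge weakly
(`abs_integral_mul_rowDet_sub_le`). Convexity of the `n`-th power lets the left side of the
inequality pass to the weak limit as well (`pow_le_of_hasFDerivAt`). -/

/-- The determinant of the matrix whose rows are the linear forms `a i`. -/
noncomputable def rowDet {n : ℕ} (a : Fin n → (Euc n →L[ℝ] ℝ)) : ℝ :=
  Matrix.det (Matrix.of fun i j => a i (EuclideanSpace.single j 1))

/-- The `i`-th row of a linear map. -/
noncomputable def row {n : ℕ} (A : Euc n →L[ℝ] Euc n) (i : Fin n) : Euc n →L[ℝ] ℝ :=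
  (EuclideanSpace.proj i : Euc n →L[ℝ] ℝ).comp A

@[simp] lemma row_apply {n : ℕ} (A : Euc n →L[ℝ] Euc n) (i : Fin n) (v : Euc n) :
    row A i v = A v i := rfl

lemma norm_row_le {n : ℕ} (A : Euc n →L[ℝ] Euc n) (i : Fin n) : ‖row A i‖ ≤ ‖A‖ := by
  refine ContinuousLinearMap.opNorm_le_bound _ (norm_nonneg _) fun v => ?_
  rw [row_apply]
  exact (PiLp.norm_apply_le (A v) i).trans (A.le_opNorm v)

lemma rowDet_row {n : ℕ} (A : Euc n →L[ℝ] Euc n) : rowDet (row A) = A.det := by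
  rw [ContinuousLinearMap.det, ← LinearMap.det_toMatrix (EuclideanSpace.basisFun (Fin n) ℝ).toBasis]
  congr 1

lemma rowDet_update_add {n : ℕ} (a : Fin n → (Euc n →L[ℝ] ℝ)) (i : Fin n) (b c : Euc n →L[ℝ] ℝ) :
    rowDet (Function.update a i (b + c)) =
      rowDet (Function.update a i b) + rowDet (Function.update a i c) := by
  have key : ∀ b : Euc n →L[ℝ] ℝ,
      (Matrix.of fun k j => Function.update a i b k (EuclideanSpace.single j 1)) =
      (Matrix.of fun k j => a k (EuclideanSpace.single j 1)).updateRow i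
        (fun j => b (EuclideanSpace.single j 1)) := by
    intro b
    ext k j
    by_cases h : k = i
    · subst h; simp
    · simp [h]
  simp only [rowDet, key]
  rw [← Matrix.det_updateRow_add]
  rfl

lemma rowDet_update_smul {n : ℕ} (a : Fin n → (Euc n →L[ℝ] ℝ)) (i : Fin n) (s : ℝ)
    (b : Euc n →L[ℝ] ℝ) :
    rowDet (Function.update a i (s • b)) = s * rowDet (Function.update a i b) := by
  have key : ∀ b : Euc n →L[ℝ] ℝ,
      (Matrix.of fun k j => Function.update a i b k (EuclideanSpace.single j 1)) =
      (Matrix.of fun k j => a k (EuclideanSpace.single j 1)).updateRow i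
        (fun j => b (EuclideanSpace.single j 1)) := by
    intro b
    ext k j
    by_cases h : k = i
    · subst h; simp
    · simp [h]
  simp only [rowDet, key]
  rw [← Matrix.det_updateRow_smul]
  rfl

lemma rowDet_update_sub {n : ℕ} (a : Fin n → (Euc n →L[ℝ] ℝ)) (i : Fin n) (b c : Euc n →L[ℝ] ℝ) :
    rowDet (Function.update a i (b - c)) =
      rowDet (Function.update a i b) - rowDet (Function.update a i c) := by
  have := rowDet_update_add a i (b - c) c
  rw [sub_add_cancel] at this
  linarith

lemma continuous_rowDet {n : ℕ} : Continuous (rowDet : (Fin n → (Euc n →L[ℝ] ℝ)) → ℝ) := by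
  unfold rowDet
  apply Continuous.matrix_det
  fun_prop

/-- Hadamard's inequality. -/
lemma abs_rowDet_le {n : ℕ} (a : Fin n → (Euc n →L[ℝ] ℝ)) : |rowDet a| ≤ ∏ i, ‖a i‖ := by
  have : Fact (Module.finrank ℝ (Euc n) = n) := ⟨by simp⟩
  let b := EuclideanSpace.basisFun (Fin n) ℝ
  let o := b.toBasis.orientation
  -- The volume form of an oriented orthonormal basis is its determinant, so the bound for volume
  -- forms applies to the Riesz representatives of the forms.
  have h := o.abs_volumeForm_apply_le fun i => (InnerProductSpace.toDual ℝ (Euc n)).symm (a i)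
  rw [o.volumeForm_robust b rfl] at h
  simp only [LinearIsometryEquiv.norm_map] at h
  convert h using 2
  rw [Module.Basis.det_apply, rowDet, ← Matrix.det_transpose]
  congr 1
  ext i j
  simp only [Matrix.transpose_apply, Matrix.of_apply, Module.Basis.toMatrix_apply]
  have : (b.toBasis.repr ((InnerProductSpace.toDual ℝ (Euc n)).symm (a j))) i =
      inner ℝ ((InnerProductSpace.toDual ℝ (Euc n)).symm (a j)) (EuclideanSpace.single i 1) := by
    rw [EuclideanSpace.inner_single_right]
    simp [b]
  rw [this, InnerProductSpace.toDual_symm_apply]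

/-! ### Linear maps maximizing the determinant -/

lemma exists_norm_eq_opNorm {n : ℕ} (hn : 1 ≤ n) (A : Euc n →L[ℝ] Euc n) :
    ∃ v : Euc n, ‖v‖ = 1 ∧ ‖A v‖ = ‖A‖ := by
  have : Nontrivial (Euc n) := by
    have : Nonempty (Fin n) := ⟨⟨0, hn⟩⟩
    infer_instance
  obtain ⟨v, hv, hmax⟩ := (isCompact_sphere (0 : Euc n) 1).exists_isMaxOn
    (NormedSpace.sphere_nonempty.2 zero_le_one) (f := fun v => ‖A v‖) (by fun_prop)
  have hv1 : ‖v‖ = 1 := by simpa using hv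
  refine ⟨v, hv1, le_antisymm (by simpa [hv1] using A.le_opNorm v) ?_⟩
  refine ContinuousLinearMap.opNorm_le_of_unit_norm (norm_nonneg _) fun w hw => ?_
  exact hmax (by simpa using hw)

/-- A linear map for which `‖A‖ⁿ ≤ det A` has inner dilatation at most `1` as well. -/
lemma det_le_norm_apply_pow {n : ℕ} (hn : 1 ≤ n) (A : Euc n →L[ℝ] Euc n) (hA : ‖A‖ ^ n ≤ A.det)
    (h : Euc n) (hh : ‖h‖ = 1) : A.det ≤ ‖A h‖ ^ n := by
  have : Fact (Module.finrank ℝ (Euc n) = n) := ⟨by simp⟩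
  have : Nonempty (Fin n) := ⟨⟨0, hn⟩⟩
  have hcard : Module.finrank ℝ (Euc n) = Fintype.card (Fin n) := by simp
  let i₀ : Fin n := ⟨0, hn⟩
  -- Extend `h` to an orthonormal basis. Hadamard gives `det A ≤ ‖A h‖ * ‖A‖ ^ (n - 1)`, which
  -- together with `‖A‖ ^ n ≤ det A` forces `‖A h‖ ≥ ‖A‖`.
  have horth : Orthonormal ℝ (Set.domRestrict {i₀} (fun _ : Fin n => h)) := by
    refine ⟨fun i => by rw [Set.domRestrict_apply]; exact hh, fun i j hij => ?_⟩
    exact absurd (Subsingleton.elim i j) hij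
  obtain ⟨b, hb⟩ := horth.exists_orthonormalBasis_extension_of_card_eq hcard
  have hb0 : b i₀ = h := hb i₀ rfl
  have hdet : A.det ≤ ∏ i, ‖A (b i)‖ := by
    have h1 := (b.toBasis.orientation).abs_volumeForm_apply_le fun i => A (b i)
    rw [(b.toBasis.orientation).volumeForm_robust b rfl] at h1
    have h2 : b.toBasis.det (fun i => A (b i)) = A.det := by
      have := b.toBasis.det_comp (A : Euc n →ₗ[ℝ] Euc n) b
      have h3 : b.toBasis.det b = 1 := by
        have := b.toBasis.det_self; rwa [b.coe_toBasis] at this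
      rw [h3, mul_one] at this
      exact this
    rw [h2] at h1
    exact (le_abs_self _).trans h1
  have hprod : ∏ i, ‖A (b i)‖ ≤ ‖A h‖ * ‖A‖ ^ (n - 1) := by
    rw [← Finset.mul_prod_erase _ _ (Finset.mem_univ i₀), hb0]
    gcongr
    calc ∏ i ∈ Finset.univ.erase i₀, ‖A (b i)‖ ≤ ∏ i ∈ Finset.univ.erase i₀, ‖A‖ := by
          refine Finset.prod_le_prod (fun _ _ => norm_nonneg _) fun i _ => ?_
          simpa using A.le_opNorm (b i)
      _ = ‖A‖ ^ (n - 1) := by simp [Finset.card_erase_of_mem]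
  rcases (norm_nonneg A).eq_or_lt with h0 | hpos
  · have : A.det ≤ ‖A h‖ * ‖A‖ ^ (n - 1) := hdet.trans hprod
    have hAh : ‖A h‖ = 0 := by
      have := A.le_opNorm h
      rw [← h0, zero_mul] at this
      exact le_antisymm this (norm_nonneg _)
    rw [hAh, zero_mul] at this
    rw [hAh]
    exact this.trans (by positivity)
  · have h1 : ‖A‖ ^ (n - 1) * ‖A‖ ≤ ‖A‖ ^ (n - 1) * ‖A h‖ := by
      rw [← pow_succ, Nat.sub_add_cancel hn, mul_comm]
      exact hA.trans (hdet.trans hprod)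
    have h2 : ‖A‖ ≤ ‖A h‖ := le_of_mul_le_mul_left h1 (by positivity)
    calc A.det ≤ ‖A h‖ * ‖A‖ ^ (n - 1) := hdet.trans hprod
      _ ≤ ‖A h‖ * ‖A h‖ ^ (n - 1) := by gcongr
      _ = ‖A h‖ ^ n := by rw [← pow_succ', Nat.sub_add_cancel hn]

/-- In dimension at least two, rotations act transitively on spheres. -/
lemma exists_rotation {n : ℕ} (hn : 2 ≤ n) (v w : Euc n) (hvw : ‖v‖ = ‖w‖) :
    ∃ O : Euc n ≃ₗᵢ[ℝ] Euc n,
      LinearMap.det (O.toLinearEquiv : Euc n →ₗ[ℝ] Euc n) = 1 ∧ O v = w := by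
  have hdet : ∀ z : Euc n, z ≠ 0 → LinearMap.det
      ((Submodule.reflection (ℝ ∙ z)ᗮ).toLinearEquiv : Euc n →ₗ[ℝ] Euc n) = -1 := by
    intro z hz
    have := Submodule.det_reflection (𝕜 := ℝ) (ℝ ∙ z)ᗮ
    rw [Submodule.orthogonal_orthogonal, finrank_span_singleton hz, pow_one] at this
    exact this
  by_cases h : v = w
  · exact ⟨LinearIsometryEquiv.refl ℝ _, by simp [LinearMap.det_id], by simp [h]⟩
  -- The reflection in the hyperplane orthogonal to `v - w` takes `v` to `w`, but has determinant
  -- `-1`. A second reflection, along some `z` orthogonal to `w`, restores the orientation and fixes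
  -- `w`; such a `z` exists because the dimension is at least two.
  · obtain ⟨z, hz, hzw⟩ : ∃ z : Euc n, z ≠ 0 ∧ inner ℝ w z = 0 := by
      have hlt : Module.finrank ℝ (ℝ ∙ w) < Module.finrank ℝ (Euc n) := by
        have := finrank_span_le_card (R := ℝ) ({w} : Set (Euc n))
        rw [Set.toFinset_singleton, Finset.card_singleton] at this
        simp only [finrank_euclideanSpace, Fintype.card_fin]; omega
      have hne : (ℝ ∙ w)ᗮ ≠ ⊥ := by
        intro hbot
        rw [Submodule.orthogonal_eq_bot_iff] at hbot
        rw [hbot, finrank_top] at hlt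
        exact lt_irrefl _ hlt
      obtain ⟨z, hz, hz0⟩ := Submodule.exists_mem_ne_zero_of_ne_bot hne
      exact ⟨z, hz0, Submodule.mem_orthogonal_singleton_iff_inner_right.1 hz⟩
    refine ⟨(Submodule.reflection (ℝ ∙ (v - w))ᗮ).trans (Submodule.reflection (ℝ ∙ z)ᗮ), ?_, ?_⟩
    · have : (((Submodule.reflection (ℝ ∙ (v - w))ᗮ).trans
          (Submodule.reflection (ℝ ∙ z)ᗮ)).toLinearEquiv : Euc n →ₗ[ℝ] Euc n) =
          ((Submodule.reflection (ℝ ∙ z)ᗮ).toLinearEquiv : Euc n →ₗ[ℝ] Euc n) ∘ₗ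
          ((Submodule.reflection (ℝ ∙ (v - w))ᗮ).toLinearEquiv : Euc n →ₗ[ℝ] Euc n) := rfl
      rw [this, LinearMap.det_comp, hdet z hz, hdet _ (sub_ne_zero.2 h)]
      norm_num
    · rw [LinearIsometryEquiv.trans_apply, Submodule.reflection_sub hvw,
        Submodule.reflection_eq_self_iff]
      rw [Submodule.mem_orthogonal_singleton_iff_inner_left]
      exact hzw

/-! ### The Jacobian determinant of a smooth compactly supported map has integral zero -/

/-- For large `s` the map `x ↦ s x + W x` is a Lipschitz-small perturbation of a dilation, hence a
bijection of the space, with positive Jacobian. It equals the dilation outside the ball, so it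
carries the ball of radius `R` onto the ball of radius `s R`, and the change of variables formula
computes the integral. -/
lemma setIntegral_det_smul_id_add {n : ℕ} (W : Euc n → Euc n) (hW : ContDiff ℝ 1 W)
    (R : ℝ) (hR : 0 < R) (hsupp : tsupport W ⊆ Metric.closedBall 0 R) :
    ∃ s₀ : ℝ, 0 < s₀ ∧ ∀ s : ℝ, s₀ ≤ s →
      ∫ x in Metric.closedBall 0 R, (s • ContinuousLinearMap.id ℝ (Euc n) + fderiv ℝ W x).det =
        s ^ n * volume.real (Metric.closedBall (0 : Euc n) R) := by
  have hcomp : HasCompactSupport W :=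
    HasCompactSupport.of_support_subset_isCompact (isCompact_closedBall (0 : Euc n) R)
      ((subset_tsupport W).trans hsupp)
  obtain ⟨C, hC⟩ := hW.lipschitzWith_of_hasCompactSupport hcomp one_ne_zero
  have hfd : ∀ x, ‖fderiv ℝ W x‖ ≤ C := fun x => norm_fderiv_le_of_lipschitz ℝ hC
  obtain ⟨δ, hδ, hδd⟩ : ∃ δ > 0, ∀ B : Euc n →L[ℝ] Euc n, ‖B‖ < δ →
      0 < (ContinuousLinearMap.id ℝ (Euc n) + B).det := by
    have hcont : Continuous fun B : Euc n →L[ℝ] Euc n =>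
        (ContinuousLinearMap.id ℝ (Euc n) + B).det :=
      ContinuousLinearMap.continuous_det.comp (by fun_prop)
    have h1 : (0 : ℝ) < (ContinuousLinearMap.id ℝ (Euc n) + 0).det := by
      simp [ContinuousLinearMap.det, LinearMap.det_id]
    have := hcont.continuousAt.eventually (lt_mem_nhds h1)
    obtain ⟨δ, hδ, hsub⟩ := Metric.eventually_nhds_iff.1 this
    exact ⟨δ, hδ, fun B hB => hsub (by simpa using hB)⟩
  -- This threshold dominates both `C + 1`, needed for bijectivity, and `(C + 1) * δ⁻¹`, which makes
  -- `s⁻¹ • fderiv ℝ W x` shorter than `δ` and so the Jacobian positive.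
  refine ⟨(C + 1) * (1 + δ⁻¹), by positivity, fun s hs => ?_⟩
  have hs1 : (C : ℝ) + 1 ≤ s := by
    refine le_trans ?_ hs
    have : 0 ≤ ((C : ℝ) + 1) * δ⁻¹ := by positivity
    linarith
  have hs2 : (C + 1) * δ⁻¹ ≤ s := by
    refine le_trans ?_ hs
    have : (0:ℝ) ≤ (C : ℝ) + 1 := by positivity
    linarith
  have hs0 : 0 < s := lt_of_lt_of_le (by positivity) hs1
  let Φ : Euc n → Euc n := fun x => s • x + W x
  have hΦd : ∀ x, HasFDerivAt Φ (s • ContinuousLinearMap.id ℝ (Euc n) + fderiv ℝ W x) x := by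
    intro x
    exact ((hasFDerivAt_id x).const_smul s).add (hW.differentiable one_ne_zero x).hasFDerivAt
  have hdetpos : ∀ x, 0 < (s • ContinuousLinearMap.id ℝ (Euc n) + fderiv ℝ W x).det := by
    intro x
    have : s • ContinuousLinearMap.id ℝ (Euc n) + fderiv ℝ W x =
        s • (ContinuousLinearMap.id ℝ (Euc n) + s⁻¹ • fderiv ℝ W x) := by
      rw [smul_add, smul_smul, mul_inv_cancel₀ hs0.ne', one_smul]
    rw [this, ContinuousLinearMap.det, ContinuousLinearMap.toLinearMap_smul, LinearMap.det_smul]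
    refine mul_pos (by positivity) (hδd _ ?_)
    rw [norm_smul, norm_inv, Real.norm_of_nonneg hs0.le, inv_mul_lt_iff₀ hs0]
    calc ‖fderiv ℝ W x‖ ≤ C := hfd x
      _ < (C + 1) * δ⁻¹ * δ := by rw [mul_assoc, inv_mul_cancel₀ hδ.ne']; linarith
      _ ≤ s * δ := by gcongr
  let e : Euc n ≃L[ℝ] Euc n := ContinuousLinearEquiv.smulLeft (Units.mk0 s hs0.ne')
  have happ : ApproximatesLinearOn Φ (e : Euc n →L[ℝ] Euc n) univ C := by
    intro x _ y _
    have : Φ x - Φ y - (e : Euc n →L[ℝ] Euc n) (x - y) = W x - W y := by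
      simp only [Φ, e, ContinuousLinearEquiv.coe_coe]
      change s • x + W x - (s • y + W y) - s • (x - y) = _
      rw [smul_sub]; abel
    rw [this]
    simpa [dist_eq_norm] using hC.dist_le_mul x y
  have hc : Subsingleton (Euc n) ∨ C < ‖(e.symm : Euc n →L[ℝ] Euc n)‖₊⁻¹ := by
    rcases subsingleton_or_nontrivial (Euc n) with h | h
    · exact Or.inl h
    · right
      have hle : ‖(e.symm : Euc n →L[ℝ] Euc n)‖ ≤ s⁻¹ := by
        refine ContinuousLinearMap.opNorm_le_bound _ (by positivity) fun v => ?_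
        change ‖s⁻¹ • v‖ ≤ _
        rw [norm_smul, norm_inv, Real.norm_of_nonneg hs0.le]
      have hpos : 0 < ‖(e.symm : Euc n →L[ℝ] Euc n)‖ :=
        e.norm_symm_pos
      rw [← NNReal.coe_lt_coe, NNReal.coe_inv, coe_nnnorm]
      refine lt_of_lt_of_le ?_ (inv_anti₀ hpos hle)
      rw [inv_inv]; linarith
  have hinj : Function.Injective Φ :=
    injOn_univ.1 (happ.injOn hc)
  have hsurj : Function.Surjective Φ := happ.surjective hc
  have hout : ∀ x, x ∉ Metric.closedBall (0 : Euc n) R → Φ x = s • x := by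
    intro x hx
    have : W x = 0 := image_eq_zero_of_notMem_tsupport fun h => hx (hsupp h)
    simp [Φ, this]
  have himg : Φ '' Metric.closedBall 0 R = Metric.closedBall 0 (s * R) := by
    ext y
    constructor
    · rintro ⟨x, hx, rfl⟩
      by_contra hy
      have hx' : s⁻¹ • Φ x ∉ Metric.closedBall (0 : Euc n) R := by
        simp only [Metric.mem_closedBall, dist_zero_right, not_le] at hy ⊢
        rw [norm_smul, norm_inv, Real.norm_of_nonneg hs0.le, lt_inv_mul_iff₀ hs0]
        exact hy
      have h1 := hout _ hx'
      rw [smul_smul, mul_inv_cancel₀ hs0.ne', one_smul] at h1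
      rw [hinj h1] at hx'
      exact hx' hx
    · intro hy
      obtain ⟨x, rfl⟩ := hsurj y
      refine ⟨x, ?_, rfl⟩
      by_contra hx
      rw [hout x hx] at hy
      simp only [Metric.mem_closedBall, dist_zero_right, not_le, norm_smul,
        Real.norm_of_nonneg hs0.le] at hy hx
      exact absurd hy (not_le.2 (by gcongr))
  have hcv := integral_image_eq_integral_abs_det_fderiv_smul volume
    (Metric.isClosed_closedBall (x := (0 : Euc n)) (ε := R)).measurableSet
    (fun x _ => (hΦd x).hasFDerivWithinAt) hinj.injOn (fun _ => (1 : ℝ))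
  rw [himg] at hcv
  simp only [smul_eq_mul, mul_one, abs_of_pos (hdetpos _)] at hcv
  rw [← hcv]
  simp only [integral_const, smul_eq_mul, mul_one, MeasurableSet.univ, measureReal_restrict_apply,
    univ_inter]
  rw [Measure.real, Measure.addHaar_closedBall_mul volume 0 hs0.le hR.le, ENNReal.toReal_mul,
    ENNReal.toReal_ofReal (by positivity)]
  simp [Measure.real]

/-- As a function of `s`, `det (s + A)` is the characteristic polynomial of `-A`, of degree `n`. Its
value at `0` is therefore interpolated from any `n + 1` nodes, in particular from large ones, where
the integral of the determinant is known. -/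
lemma det_eq_sum_lagrange {n : ℕ} (v : Fin (n + 1) → ℝ) (hv : Function.Injective v)
    (A : Euc n →L[ℝ] Euc n) :
    A.det = ∑ j, (v j • ContinuousLinearMap.id ℝ (Euc n) + A).det *
      (Lagrange.basis Finset.univ v j).eval 0 := by
  let p := (-(A : Euc n →ₗ[ℝ] Euc n)).charpoly
  have hev : ∀ s : ℝ, p.eval s = (s • ContinuousLinearMap.id ℝ (Euc n) + A).det := by
    intro s
    simp only [p]
    rw [LinearMap.eval_charpoly]
    congr 1
    ext x
    simp [Algebra.algebraMap_eq_smul_one]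
  have hdeg : p.degree < (Finset.univ : Finset (Fin (n + 1))).card := by
    rw [Polynomial.degree_eq_natDegree (LinearMap.charpoly_monic _).ne_zero,
      LinearMap.charpoly_natDegree]
    simp only [finrank_euclideanSpace, Fintype.card_fin, Finset.card_univ]
    exact_mod_cast Nat.lt_succ_self n
  have h := Lagrange.eq_interpolate (s := Finset.univ) (v := v) hv.injOn hdeg
  have h0 : A.det = p.eval 0 := by
    rw [hev]
    congr 1
    ext x
    simp
  rw [h0]
  conv_lhs => rw [h]
  rw [Lagrange.interpolate_apply, Polynomial.eval_finsetSum]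
  simp [hev]

/-- The Jacobian determinant of a smooth map with compact support has integral zero. -/
lemma integral_det_fderiv_eq_zero {n : ℕ} (hn : 1 ≤ n) (W : Euc n → Euc n) (hW : ContDiff ℝ 1 W)
    (hcomp : HasCompactSupport W) : ∫ x, (fderiv ℝ W x).det = 0 := by
  have : Nonempty (Fin n) := ⟨⟨0, hn⟩⟩
  obtain ⟨R, hR, hsupp⟩ : ∃ R : ℝ, 0 < R ∧ tsupport W ⊆ Metric.closedBall 0 R := by
    obtain ⟨R, hR⟩ := hcomp.isBounded.subset_closedBall 0
    exact ⟨max R 1, by positivity, hR.trans (Metric.closedBall_subset_closedBall (le_max_left _ _))⟩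
  obtain ⟨s₀, hs₀, hint⟩ := setIntegral_det_smul_id_add W hW R hR hsupp
  let v : Fin (n + 1) → ℝ := fun j => s₀ + (j : ℕ)
  have hv : Function.Injective v := by
    intro i j hij
    simp only [v, add_right_inj, Nat.cast_inj] at hij
    exact Fin.ext hij
  -- The same interpolation applied to `X ^ n`, which vanishes at `0`: the weights that recover the
  -- determinant annihilate the volumes `s ^ n * vol`.
  have hsum : ∑ j, v j ^ n * (Lagrange.basis Finset.univ v j).eval 0 = 0 := by
    have hdeg : (Polynomial.X ^ n : Polynomial ℝ).degree <
        (Finset.univ : Finset (Fin (n + 1))).card := by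
      rw [Polynomial.degree_X_pow]
      simp only [Fintype.card_fin, Finset.card_univ]
      exact_mod_cast Nat.lt_succ_self n
    have h := Lagrange.eq_interpolate (s := Finset.univ) (v := v) hv.injOn hdeg
    have h2 := congrArg (Polynomial.eval 0) h
    rw [Lagrange.interpolate_apply, Polynomial.eval_finsetSum] at h2
    simp only [Polynomial.eval_pow, Polynomial.eval_X, Polynomial.eval_mul, Polynomial.eval_C] at h2
    rw [← h2, zero_pow (by omega)]
  have hcontD : Continuous fun x => fderiv ℝ W x := hW.continuous_fderiv one_ne_zero
  have hzero : ∀ x, x ∉ Metric.closedBall (0 : Euc n) R → (fderiv ℝ W x).det = 0 := by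
    intro x hx
    have : fderiv ℝ W x = 0 := by
      by_contra h
      exact hx (hsupp (support_fderiv_subset ℝ h))
    rw [this, ContinuousLinearMap.det]
    have : Nontrivial (Euc n) := inferInstance
    simp only [ContinuousLinearMap.toLinearMap_zero]
    rw [LinearMap.det_zero]
    simp only [finrank_euclideanSpace, Fintype.card_fin]
    exact zero_pow (by omega)
  rw [← setIntegral_eq_integral_of_forall_compl_eq_zero hzero]
  calc ∫ x in Metric.closedBall 0 R, (fderiv ℝ W x).det
      = ∫ x in Metric.closedBall 0 R, ∑ j,
          (v j • ContinuousLinearMap.id ℝ (Euc n) + fderiv ℝ W x).det *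
          (Lagrange.basis Finset.univ v j).eval 0 := by
        congr 1; ext x; exact det_eq_sum_lagrange v hv _
    _ = ∑ j, ∫ x in Metric.closedBall 0 R,
          (v j • ContinuousLinearMap.id ℝ (Euc n) + fderiv ℝ W x).det *
          (Lagrange.basis Finset.univ v j).eval 0 := by
        refine integral_finsetSum _ fun j _ => ?_
        have hc : Continuous fun x => (v j • ContinuousLinearMap.id ℝ (Euc n) +
            fderiv ℝ W x).det * (Lagrange.basis Finset.univ v j).eval 0 :=
          (ContinuousLinearMap.continuous_det.comp (by fun_prop)).mul continuous_const
        exact hc.continuousOn.integrableOn_compact (isCompact_closedBall _ _)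
    _ = ∑ j, v j ^ n * volume.real (Metric.closedBall (0 : Euc n) R) *
          (Lagrange.basis Finset.univ v j).eval 0 := by
        refine Finset.sum_congr rfl fun j _ => ?_
        rw [integral_mul_const, hint (v j) (by simp [v])]
    _ = volume.real (Metric.closedBall (0 : Euc n) R) *
          ∑ j, v j ^ n * (Lagrange.basis Finset.univ v j).eval 0 := by
        rw [Finset.mul_sum]; refine Finset.sum_congr rfl fun j _ => by ring
    _ = 0 := by rw [hsum, mul_zero]

/-- The integral of the Jacobian of smooth compactly supported functions vanishes. -/
lemma integral_rowDet_fderiv_eq_zero {n : ℕ} (hn : 1 ≤ n) (w : Fin n → Euc n → ℝ)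
    (hw : ∀ i, ContDiff ℝ ∞ (w i)) (hc : ∀ i, HasCompactSupport (w i)) :
    ∫ x, rowDet (fun i => fderiv ℝ (w i) x) = 0 := by
  let W : Euc n → Euc n := fun x => WithLp.toLp 2 fun i => w i x
  have hWd : ContDiff ℝ 1 W := by
    rw [contDiff_euclidean]
    exact fun i => (hw i).of_le (by exact_mod_cast le_top)
  have hWc : HasCompactSupport W := by
    refine HasCompactSupport.of_support_subset_isCompact
      (isCompact_iUnion fun i => (hc i).isCompact) ?_
    intro x hx
    by_contra h
    simp only [mem_iUnion, not_exists] at h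
    apply hx
    ext i
    simpa [W] using image_eq_zero_of_notMem_tsupport (h i)
  rw [← integral_det_fderiv_eq_zero hn W hWd hWc]
  congr 1
  ext x
  rw [← rowDet_row]
  congr 1
  ext i v
  have h1 : HasFDerivAt W (fderiv ℝ W x) x := (hWd.differentiable one_ne_zero x).hasFDerivAt
  have h2 : HasFDerivAt (w i) (row (fderiv ℝ W x) i) x :=
    ((EuclideanSpace.proj i : Euc n →L[ℝ] ℝ).hasFDerivAt).comp x h1
  rw [h2.fderiv]

/-! ### Jensen's inequality for powers of lower integrals -/

lemma lintegral_pow_le_of_isProbabilityMeasure {α : Type*} [MeasurableSpace α] (ν : Measure α)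
    [IsProbabilityMeasure ν] {n : ℕ} (hn : 1 ≤ n) {f : α → ENNReal} (hf : AEMeasurable f ν) :
    (∫⁻ x, f x ∂ν) ^ n ≤ ∫⁻ x, f x ^ n ∂ν := by
  have hn' : (1 : ℝ) ≤ n := by exact_mod_cast hn
  have h := eLpNorm'_le_eLpNorm'_of_exponent_le (p := 1) (q := n) one_pos hn' ν
    (f := f) hf.aestronglyMeasurable
  simp only [eLpNorm', enorm_eq_self, ENNReal.rpow_one, div_one, ENNReal.rpow_natCast] at h
  calc (∫⁻ x, f x ∂ν) ^ n ≤ ((∫⁻ x, f x ^ n ∂ν) ^ (1 / (n : ℝ))) ^ n := by gcongr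
    _ = ∫⁻ x, f x ^ n ∂ν := by
      rw [← ENNReal.rpow_natCast, ← ENNReal.rpow_mul, one_div,
        inv_mul_cancel₀ (by positivity), ENNReal.rpow_one]

lemma eLpNorm_natCast_pow {α F : Type*} [MeasurableSpace α] [NormedAddCommGroup F] (μ : Measure α)
    {n : ℕ} (hn : 1 ≤ n) (f : α → F) : eLpNorm f (n : ENNReal) μ ^ n = ∫⁻ x, ‖f x‖ₑ ^ n ∂μ := by
  have hn0 : (n : ENNReal) ≠ 0 := by exact_mod_cast (by omega : n ≠ 0)
  rw [eLpNorm_eq_lintegral_rpow_enorm_toReal hn0 (ENNReal.natCast_ne_top n)]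
  simp only [ENNReal.toReal_natCast, ENNReal.rpow_natCast]
  rw [← ENNReal.rpow_natCast, ← ENNReal.rpow_mul, one_div, inv_mul_cancel₀, ENNReal.rpow_one]
  exact_mod_cast (by omega : n ≠ 0)

/-! ### Mollification in `Lⁿ` -/

section Mollify

variable {n : ℕ} {F : Type*} [NormedAddCommGroup F] [NormedSpace ℝ F]

open scoped Convolution
open ContinuousLinearMap

/-- The mollifier is a probability density, so Jensen bounds the `n`-th power of the convolution
pointwise by the convolution of the `n`-th power. Tonelli and translation invariance then finish. -/
lemma eLpNorm_normed_convolution_le (hn : 1 ≤ n) (φ : ContDiffBump (0 : Euc n)) {h : Euc n → F}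
    (hh : MemLp h n volume) :
    eLpNorm (φ.normed volume ⋆[lsmul ℝ ℝ, volume] h) n volume ≤ eLpNorm h n volume := by
  let η := φ.normed volume
  have hηc : Continuous η := φ.continuous_normed
  let ν : Measure (Euc n) := volume.withDensity fun t => ENNReal.ofReal (η t)
  have hν : IsProbabilityMeasure ν := by
    constructor
    rw [withDensity_apply _ MeasurableSet.univ, Measure.restrict_univ,
      ← ofReal_integral_eq_lintegral_ofReal φ.integrable_normed
        (Filter.Eventually.of_forall φ.nonneg_normed), φ.integral_normed, ENNReal.ofReal_one]
  have hνac : ν ≪ volume := withDensity_absolutelyContinuous _ _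
  have hmeas : Measurable fun t => ENNReal.ofReal (η t) := hηc.measurable.ennreal_ofReal
  have hn' : n ≠ 0 := by omega
  have hsub : AEStronglyMeasurable (fun p : Euc n × Euc n => h (p.1 - p.2))
      ((volume : Measure (Euc n)).prod volume) :=
    hh.1.comp_quasiMeasurePreserving (quasiMeasurePreserving_sub_of_right_invariant _ _)
  have hpt : ∀ᵐ x : Euc n, ‖(η ⋆[lsmul ℝ ℝ, volume] h) x‖ₑ ^ n ≤
      ∫⁻ t, ENNReal.ofReal (η t) * ‖h (x - t)‖ₑ ^ n := by
    refine Filter.Eventually.of_forall fun x => ?_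
    have hmx : AEStronglyMeasurable (fun t => h (x - t)) volume :=
      hh.1.comp_quasiMeasurePreserving
        (quasiMeasurePreserving_sub_left_of_right_invariant volume x)
    calc ‖(η ⋆[lsmul ℝ ℝ, volume] h) x‖ₑ ^ n
        ≤ (∫⁻ t, ‖η t • h (x - t)‖ₑ) ^ n := by
          gcongr; exact enorm_integral_le_lintegral_enorm _
      _ = (∫⁻ t, ENNReal.ofReal (η t) * ‖h (x - t)‖ₑ) ^ n := by
          congr 2; ext t
          rw [enorm_smul, Real.enorm_of_nonneg (φ.nonneg_normed t)]
      _ = (∫⁻ t, ‖h (x - t)‖ₑ ∂ν) ^ n := by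
          rw [lintegral_withDensity_eq_lintegral_mul₀ hmeas.aemeasurable hmx.enorm]
          rfl
      _ ≤ ∫⁻ t, ‖h (x - t)‖ₑ ^ n ∂ν :=
          lintegral_pow_le_of_isProbabilityMeasure ν hn (hmx.enorm.mono_ac hνac)
      _ = ∫⁻ t, ENNReal.ofReal (η t) * ‖h (x - t)‖ₑ ^ n := by
          rw [lintegral_withDensity_eq_lintegral_mul₀ hmeas.aemeasurable (hmx.enorm.pow_const n)]
          rfl
  rw [← ENNReal.pow_le_pow_left_iff hn', eLpNorm_natCast_pow _ hn, eLpNorm_natCast_pow _ hn]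
  calc ∫⁻ x, ‖(η ⋆[lsmul ℝ ℝ, volume] h) x‖ₑ ^ n
      ≤ ∫⁻ x, ∫⁻ t, ENNReal.ofReal (η t) * ‖h (x - t)‖ₑ ^ n := lintegral_mono_ae hpt
    _ = ∫⁻ t, ∫⁻ x, ENNReal.ofReal (η t) * ‖h (x - t)‖ₑ ^ n := by
        apply lintegral_lintegral_swap
        refine AEMeasurable.mul ?_ (hsub.enorm.pow_const n)
        exact (hmeas.comp measurable_snd).aemeasurable
    _ = ∫⁻ t, ENNReal.ofReal (η t) * ∫⁻ x, ‖h x‖ₑ ^ n := by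
        congr 1; ext t
        rw [lintegral_const_mul' _ _ ENNReal.ofReal_ne_top]
        congr 1
        exact lintegral_sub_right_eq_self (fun x => ‖h x‖ₑ ^ n) t
    _ = ∫⁻ x, ‖h x‖ₑ ^ n := by
        rw [lintegral_mul_const _ hmeas, ← ofReal_integral_eq_lintegral_ofReal φ.integrable_normed
        (Filter.Eventually.of_forall φ.nonneg_normed), φ.integral_normed, ENNReal.ofReal_one,
        one_mul]

/-- For small radii the mollification of a uniformly continuous function is uniformly close. -/
lemma exists_dist_normed_convolution_le [CompleteSpace F] {h : Euc n → F} (hc : Continuous h)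
    (hs : HasCompactSupport h) {ε : ℝ} (hε : 0 < ε) :
    ∃ δ > 0, ∀ φ : ContDiffBump (0 : Euc n), φ.rOut ≤ δ → ∀ x,
      dist ((φ.normed volume ⋆[lsmul ℝ ℝ, volume] h) x) (h x) ≤ ε := by
  have huc := hc.uniformContinuous_of_tendsto_cocompact hs.is_zero_at_infty
  obtain ⟨δ, hδ, hd⟩ := Metric.uniformContinuous_iff.1 huc ε hε
  refine ⟨δ, hδ, fun φ hφ x => ?_⟩
  refine φ.dist_normed_convolution_le hc.aestronglyMeasurable fun y hy => ?_
  exact (hd (lt_of_lt_of_le hy hφ)).le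

lemma support_normed_convolution_subset (φ : ContDiffBump (0 : Euc n)) (h : Euc n → F) :
    Function.support (φ.normed volume ⋆[lsmul ℝ ℝ, volume] h) ⊆
      Metric.cthickening φ.rOut (tsupport h) := by
  intro x hx
  obtain ⟨a, ha, b, hb, rfl⟩ := support_convolution_subset (lsmul ℝ ℝ) hx
  rw [φ.support_normed_eq] at ha
  refine Metric.mem_cthickening_of_dist_le _ b _ _ (subset_tsupport h hb) ?_
  rw [dist_eq_norm, add_sub_cancel_right]
  simpa using (Metric.mem_ball.1 ha).le

/-- Approximate `h` in `Lⁿ` by a continuous compactly supported `h₁`. Mollification does not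
increase the distance between them, and for `h₁` it converges uniformly, with supports in a fixed
compact set. -/
lemma exists_eLpNorm_normed_convolution_sub_le [CompleteSpace F] (hn : 1 ≤ n)
    {h : Euc n → F} (hh : MemLp h n volume)
    {ε : ℝ} (hε : 0 < ε) :
    ∃ δ > 0, ∀ φ : ContDiffBump (0 : Euc n), φ.rOut ≤ δ →
      eLpNorm ((φ.normed volume ⋆[lsmul ℝ ℝ, volume] h) - h) n volume ≤ ENNReal.ofReal ε := by
  have hn1 : (1 : ENNReal) ≤ n := by exact_mod_cast hn
  have hntop : (n : ENNReal) ≠ ⊤ := ENNReal.natCast_ne_top n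
  obtain ⟨h₁, h₁s, h₁d, h₁c, h₁m⟩ := hh.exists_hasCompactSupport_eLpNorm_sub_le hntop
    (ε := ENNReal.ofReal (ε / 3)) (by simpa using hε)
  let T := Metric.cthickening 1 (tsupport h₁)
  have hT : IsCompact T := h₁s.isCompact.cthickening
  -- The uniform error that costs at most `ε / 3` in `Lⁿ` norm over the thickened support `T`.
  obtain ⟨ε', hε', hε'2⟩ : ∃ ε' > 0, ENNReal.ofReal ε' * volume T ^ (1 / (n : ENNReal).toReal) ≤
      ENNReal.ofReal (ε / 3) := by
    have hfin : volume T ^ (1 / (n : ENNReal).toReal) ≠ ⊤ :=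
      ENNReal.rpow_ne_top_of_nonneg (by positivity) hT.measure_lt_top.ne
    lift volume T ^ (1 / (n : ENNReal).toReal) to NNReal using hfin with r
    refine ⟨ε / 3 / (r + 1), by positivity, ?_⟩
    rw [← ENNReal.ofReal_coe_nnreal, ← ENNReal.ofReal_mul (by positivity)]
    apply ENNReal.ofReal_le_ofReal
    rw [div_mul_eq_mul_div, div_le_iff₀ (by positivity)]
    have : (0:ℝ) ≤ r := r.2
    nlinarith
  obtain ⟨δ, hδ, hd⟩ := exists_dist_normed_convolution_le h₁c h₁s hε'
  refine ⟨min δ 1, by positivity, fun φ hφ => ?_⟩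
  have hloc : LocallyIntegrable h volume := hh.locallyIntegrable hn1
  have hloc₁ : LocallyIntegrable h₁ volume := h₁c.locallyIntegrable
  have hex : ∀ {k : Euc n → F}, LocallyIntegrable k volume →
      ConvolutionExists (φ.normed volume) k (lsmul ℝ ℝ) volume := fun hk =>
    HasCompactSupport.convolutionExists_left _ φ.hasCompactSupport_normed
      φ.continuous_normed hk
  have hsplit : (φ.normed volume ⋆[lsmul ℝ ℝ, volume] h) - h =
      (φ.normed volume ⋆[lsmul ℝ ℝ, volume] (h - h₁)) +
      ((φ.normed volume ⋆[lsmul ℝ ℝ, volume] h₁) - h₁) - (h - h₁) := by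
    have : h = (h - h₁) + h₁ := by simp
    conv_lhs => rw [this, ConvolutionExists.distrib_add (hex (hloc.sub hloc₁)) (hex hloc₁)]
    abel
  have hm1 : AEStronglyMeasurable (φ.normed volume ⋆[lsmul ℝ ℝ, volume] (h - h₁)) volume :=
    (HasCompactSupport.continuous_convolution_left _ φ.hasCompactSupport_normed
      φ.continuous_normed (hloc.sub hloc₁)).aestronglyMeasurable
  have hm2 : AEStronglyMeasurable (φ.normed volume ⋆[lsmul ℝ ℝ, volume] h₁) volume :=
    (HasCompactSupport.continuous_convolution_left _ φ.hasCompactSupport_normed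
      φ.continuous_normed hloc₁).aestronglyMeasurable
  have hsub : MemLp (h - h₁) n volume := hh.sub h₁m
  have e1 : eLpNorm (φ.normed volume ⋆[lsmul ℝ ℝ, volume] (h - h₁)) n volume ≤
      ENNReal.ofReal (ε / 3) := (eLpNorm_normed_convolution_le hn φ hsub).trans h₁d
  have e2 : eLpNorm ((φ.normed volume ⋆[lsmul ℝ ℝ, volume] h₁) - h₁) n volume ≤
      ENNReal.ofReal (ε / 3) := by
    refine (eLpNorm_sub_le_of_dist_bdd volume hntop hT.measurableSet hε'.le
      (fun x => hd φ (hφ.trans (min_le_left _ _)) x) ?_ ?_).trans hε'2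
    · exact (support_normed_convolution_subset φ h₁).trans
        (Metric.cthickening_mono (hφ.trans (min_le_right _ _)) _)
    · exact (subset_tsupport h₁).trans (Metric.self_subset_cthickening _)
  rw [hsplit]
  calc eLpNorm _ n volume ≤ eLpNorm ((φ.normed volume ⋆[lsmul ℝ ℝ, volume] (h - h₁)) +
      ((φ.normed volume ⋆[lsmul ℝ ℝ, volume] h₁) - h₁)) n volume + eLpNorm (h - h₁) n volume :=
        eLpNorm_sub_le (hm1.add (hm2.sub h₁c.aestronglyMeasurable)) hsub.1 hn1
    _ ≤ eLpNorm (φ.normed volume ⋆[lsmul ℝ ℝ, volume] (h - h₁)) n volume +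
      eLpNorm ((φ.normed volume ⋆[lsmul ℝ ℝ, volume] h₁) - h₁) n volume +
      eLpNorm (h - h₁) n volume := by
        gcongr
        exact eLpNorm_add_le hm1 (hm2.sub h₁c.aestronglyMeasurable) hn1
    _ ≤ ENNReal.ofReal (ε / 3) + ENNReal.ofReal (ε / 3) + ENNReal.ofReal (ε / 3) := by gcongr
    _ = ENNReal.ofReal ε := by
        rw [← ENNReal.ofReal_add (by positivity) (by positivity),
          ← ENNReal.ofReal_add (by positivity) (by positivity)]
        congr 1; ring

end Mollify

/-! ### Continuous functions with weak gradient in `Lⁿ_loc` -/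

/-- `u : ℝⁿ → ℝ` is continuous and has the weak gradient `g ∈ Lⁿ_loc`. -/
structure WeakGrad {n : ℕ} (u : Euc n → ℝ) (g : Euc n → (Euc n →L[ℝ] ℝ)) : Prop where
  cont : Continuous u
  memLp : ∀ C : Set (Euc n), IsCompact C → MemLp g (n : ENNReal) (volume.restrict C)
  integral_eq : ∀ φ : Euc n → ℝ, ContDiff ℝ ∞ φ → HasCompactSupport φ → ∀ v : Euc n,
    ∫ x, fderiv ℝ φ x v * u x = - ∫ x, φ x * g x v

variable {n : ℕ}

lemma WeakGrad.locallyIntegrable (hn : 1 ≤ n) {u : Euc n → ℝ} {g : Euc n → (Euc n →L[ℝ] ℝ)}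
    (h : WeakGrad u g) : LocallyIntegrable g volume := by
  rw [locallyIntegrable_iff]
  intro C hC
  have : IsFiniteMeasure (volume.restrict C) := ⟨by simpa using hC.measure_lt_top⟩
  exact (h.memLp C hC).integrable (by exact_mod_cast hn)

lemma WeakGrad.aestronglyMeasurable (hn : 1 ≤ n) {u : Euc n → ℝ} {g : Euc n → (Euc n →L[ℝ] ℝ)}
    (h : WeakGrad u g) : AEStronglyMeasurable g volume :=
  (h.locallyIntegrable hn).aestronglyMeasurable

lemma integrable_mul_apply {g : Euc n → (Euc n →L[ℝ] ℝ)} (hg : LocallyIntegrable g volume)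
    {φ : Euc n → ℝ} (hφ : Continuous φ) (hc : HasCompactSupport φ) (v : Euc n) :
    Integrable (fun x => φ x * g x v) volume := by
  have := hg.integrable_smul_left_of_hasCompactSupport hφ hc
  exact this.apply_continuousLinearMap v

lemma integrable_fderiv_mul {u : Euc n → ℝ} (hu : Continuous u)
    {φ : Euc n → ℝ} (hφ : ContDiff ℝ 1 φ) (hc : HasCompactSupport φ) (v : Euc n) :
    Integrable (fun x => fderiv ℝ φ x v * u x) volume := by
  refine Continuous.integrable_of_hasCompactSupport ?_ ?_
  · exact ((hφ.continuous_fderiv one_ne_zero).clm_apply continuous_const).mul hu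
  · exact (hc.fderiv_apply ℝ v).mul_right

lemma WeakGrad.of_contDiff {w : Euc n → ℝ} (hw : ContDiff ℝ 1 w) : WeakGrad w (fderiv ℝ w) where
  cont := hw.continuous
  memLp C hC := by
    have hc := hw.continuous_fderiv one_ne_zero
    have : IsFiniteMeasure (volume.restrict C) := ⟨by simpa using hC.measure_lt_top⟩
    obtain ⟨M, hM⟩ := hC.exists_bound_of_continuousOn hc.continuousOn
    exact MemLp.of_bound hc.aestronglyMeasurable M
      ((ae_restrict_iff' hC.measurableSet).2 (Filter.Eventually.of_forall hM))
  integral_eq φ hφ hc v := by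
    have hφ1 : ContDiff ℝ 1 φ := hφ.of_le (by exact_mod_cast le_top)
    have h := integral_mul_fderiv_eq_neg_fderiv_mul_of_integrable (μ := volume)
      (f := w) (g := φ) (v := v) ?_ ?_ ?_
      (fun x _ => hw.differentiable one_ne_zero x) (fun x _ => hφ1.differentiable one_ne_zero x)
    · simpa only [mul_comm] using h
    · refine Continuous.integrable_of_hasCompactSupport ?_ hc.mul_left
      exact ((hw.continuous_fderiv one_ne_zero).clm_apply continuous_const).mul hφ1.continuous
    · simpa only [mul_comm] using integrable_fderiv_mul hw.continuous hφ1 hc v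
    · exact (hw.continuous.mul hφ1.continuous).integrable_of_hasCompactSupport hc.mul_left

lemma WeakGrad.sub (hn : 1 ≤ n) {u u' : Euc n → ℝ} {g g' : Euc n → (Euc n →L[ℝ] ℝ)}
    (h : WeakGrad u g) (h' : WeakGrad u' g') :
    WeakGrad (fun x => u x - u' x) (fun x => g x - g' x) where
  cont := h.cont.sub h'.cont
  memLp C hC := (h.memLp C hC).sub (h'.memLp C hC)
  integral_eq φ hφ hc v := by
    have hφ1 : ContDiff ℝ 1 φ := hφ.of_le (by exact_mod_cast le_top)
    simp only [mul_sub, sub_apply]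
    rw [integral_sub (integrable_fderiv_mul h.cont hφ1 hc v)
      (integrable_fderiv_mul h'.cont hφ1 hc v),
      integral_sub (integrable_mul_apply (h.locallyIntegrable hn) hφ.continuous hc v)
      (integrable_mul_apply (h'.locallyIntegrable hn) hφ.continuous hc v),
      h.integral_eq φ hφ hc v, h'.integral_eq φ hφ hc v]
    ring

lemma WeakGrad.sub_const {u : Euc n → ℝ} {g : Euc n → (Euc n →L[ℝ] ℝ)} (hn : 1 ≤ n)
    (h : WeakGrad u g) (c : ℝ) : WeakGrad (fun x => u x - c) g := by
  have := h.sub hn (WeakGrad.of_contDiff (n := n) (w := fun _ => c) contDiff_const)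
  simpa using this

lemma WeakGrad.linear (M : Euc n →L[ℝ] ℝ) : WeakGrad (fun x => M x) (fun _ => M) := by
  have h : fderiv ℝ (fun x => M x) = fun _ => M := funext fun _ => M.fderiv
  have := WeakGrad.of_contDiff (n := n) (w := fun x => M x) M.contDiff
  rwa [h] at this

lemma WeakGrad.mul (hn : 1 ≤ n) {u : Euc n → ℝ} {g : Euc n → (Euc n →L[ℝ] ℝ)}
    (h : WeakGrad u g) {χ : Euc n → ℝ} (hχ : ContDiff ℝ ∞ χ) :
    WeakGrad (fun x => χ x * u x) (fun x => χ x • g x + u x • fderiv ℝ χ x) where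
  cont := hχ.continuous.mul h.cont
  memLp C hC := by
    have hχ' : Continuous (fderiv ℝ χ) := hχ.continuous_fderiv (by simp)
    have : IsFiniteMeasure (volume.restrict C) := ⟨by simpa using hC.measure_lt_top⟩
    obtain ⟨M, hM⟩ := hC.exists_bound_of_continuousOn hχ.continuous.continuousOn
    obtain ⟨M', hM'⟩ := hC.exists_bound_of_continuousOn (h.cont.smul hχ').continuousOn
    refine MemLp.add (f := fun x => χ x • g x) (g := fun x => u x • fderiv ℝ χ x) ?_ ?_
    · refine MemLp.of_le_mul (c := M) (h.memLp C hC)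
        (hχ.continuous.aestronglyMeasurable.smul (h.memLp C hC).1) ?_
      refine (ae_restrict_iff' hC.measurableSet).2 (Filter.Eventually.of_forall fun x hx => ?_)
      rw [norm_smul]
      exact mul_le_mul_of_nonneg_right (hM x hx) (norm_nonneg _)
    · exact MemLp.of_bound (h.cont.smul hχ').aestronglyMeasurable M'
        ((ae_restrict_iff' hC.measurableSet).2 (Filter.Eventually.of_forall hM'))
  integral_eq φ hφ hc v := by
    have hφ1 : ContDiff ℝ 1 φ := hφ.of_le (by exact_mod_cast le_top)
    have hχ1 : ContDiff ℝ 1 χ := hχ.of_le (by exact_mod_cast le_top)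
    have hfd : ∀ x, fderiv ℝ (fun y => φ y * χ y) x v =
        φ x * fderiv ℝ χ x v + χ x * fderiv ℝ φ x v := by
      intro x
      rw [fderiv_fun_mul (hφ1.differentiable one_ne_zero x) (hχ1.differentiable one_ne_zero x)]
      simp
    -- Since `φ χ` is an admissible test function for `u`, expanding its derivative transfers `χ`
    -- from the test function to `u`.
    have key := h.integral_eq (fun y => φ y * χ y) (hφ.mul hχ) hc.mul_right v
    simp only [hfd] at key
    have i1 : Integrable (fun x => φ x * fderiv ℝ χ x v * u x) volume := by
      refine Continuous.integrable_of_hasCompactSupport ?_ ?_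
      · exact (hφ.continuous.mul ((hχ1.continuous_fderiv one_ne_zero).clm_apply
          continuous_const)).mul h.cont
      · exact hc.mul_right.mul_right
    have i2 : Integrable (fun x => fderiv ℝ φ x v * (χ x * u x)) volume :=
      integrable_fderiv_mul (hχ.continuous.mul h.cont) hφ1 hc v
    have i3 : Integrable (fun x => φ x * χ x * g x v) volume :=
      integrable_mul_apply (h.locallyIntegrable hn) (hφ.continuous.mul hχ.continuous)
        hc.mul_right v
    have e1 : (fun x => (φ x * fderiv ℝ χ x v + χ x * fderiv ℝ φ x v) * u x) =
        fun x => φ x * fderiv ℝ χ x v * u x + fderiv ℝ φ x v * (χ x * u x) := by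
      ext x; ring
    have e2 : (fun x => φ x * (χ x • g x + u x • fderiv ℝ χ x) v) =
        fun x => φ x * χ x * g x v + φ x * fderiv ℝ χ x v * u x := by
      ext x; simp; ring
    rw [e1, integral_add i1 i2] at key
    rw [e2, integral_add i3 i1]
    linarith

/-! ### Weak gradients under translations and dilations. -/

lemma integral_comp_add_smul {G : Type*} [NormedAddCommGroup G] [NormedSpace ℝ G]
    (f : Euc n → G) (y : Euc n) {ρ : ℝ} (hρ : 0 < ρ) :
    ∫ z, f (y + ρ • z) = (ρ ^ n)⁻¹ • ∫ x, f x := by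
  rw [Measure.integral_comp_smul volume (fun z => f (y + z)) ρ,
    integral_add_left_eq_self f y]
  simp [abs_of_pos hρ]

lemma measurableEmbedding_add_smul (y : Euc n) {ρ : ℝ} (hρ : 0 < ρ) :
    MeasurableEmbedding (fun z : Euc n => y + ρ • z) :=
  (((Homeomorph.smulOfNeZero ρ hρ.ne').trans (Homeomorph.addLeft y)).measurableEmbedding)

lemma map_add_smul_volume (y : Euc n) {ρ : ℝ} (hρ : 0 < ρ) :
    Measure.map (fun z : Euc n => y + ρ • z) volume =
      ENNReal.ofReal ((ρ ^ n)⁻¹) • (volume : Measure (Euc n)) := by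
  have : (fun z : Euc n => y + ρ • z) = (fun z => y + z) ∘ (fun z => ρ • z) := rfl
  rw [this, ← Measure.map_map (measurable_const_add y) (measurable_const_smul ρ),
    Measure.map_addHaar_smul volume hρ.ne', Measure.map_smul, map_add_left_eq_self]
  simp [abs_of_pos hρ]

lemma WeakGrad.comp_add_smul {u : Euc n → ℝ} {g : Euc n → (Euc n →L[ℝ] ℝ)}
    (h : WeakGrad u g) (y : Euc n) {ρ : ℝ} (hρ : 0 < ρ) :
    WeakGrad (fun z => u (y + ρ • z)) (fun z => ρ • g (y + ρ • z)) where
  cont := h.cont.comp (by fun_prop)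
  memLp C hC := by
    refine MemLp.const_smul ?_ ρ
    have hE := measurableEmbedding_add_smul y hρ
    have hC' : IsCompact ((fun z : Euc n => y + ρ • z) '' C) := hC.image (by fun_prop)
    have h1 := h.memLp _ hC'
    have h2 : Measure.map (fun z : Euc n => y + ρ • z) (volume.restrict C) =
        ENNReal.ofReal ((ρ ^ n)⁻¹) •
          (volume.restrict ((fun z : Euc n => y + ρ • z) '' C)) := by
      have := hE.restrict_map volume ((fun z : Euc n => y + ρ • z) '' C)
      rw [preimage_image_eq _ hE.injective] at this
      rw [← this, map_add_smul_volume y hρ, Measure.restrict_smul]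
    have h3 : MemLp g n (Measure.map (fun z : Euc n => y + ρ • z) (volume.restrict C)) := by
      rw [h2]; exact h1.smul_measure ENNReal.ofReal_ne_top
    exact (hE.memLp_map_measure_iff).1 h3
  integral_eq φ hφ hc v := by
    let ψ : Euc n → ℝ := fun x => φ (ρ⁻¹ • (x - y))
    have hψ : ContDiff ℝ ∞ ψ := hφ.comp (by fun_prop)
    have hψc : HasCompactSupport ψ := by
      have := hc.comp_homeomorph
        ((Homeomorph.subRight y).trans (Homeomorph.smulOfNeZero ρ⁻¹ (inv_ne_zero hρ.ne')))
      exact this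
    have hcomp : ∀ z, ψ (y + ρ • z) = φ z := by
      intro z; simp [ψ, smul_smul, inv_mul_cancel₀ hρ.ne']
    have hfd : ∀ z, fderiv ℝ φ z v = ρ * fderiv ℝ ψ (y + ρ • z) v := by
      intro z
      have h1 : HasFDerivAt (fun z : Euc n => y + ρ • z)
          (ρ • ContinuousLinearMap.id ℝ (Euc n)) z :=
        ((hasFDerivAt_id z).const_smul ρ).const_add y
      have h2 := ((hψ.differentiable (by simp) (y + ρ • z)).hasFDerivAt).comp z h1
      have h3 : (ψ ∘ fun z : Euc n => y + ρ • z) = φ := funext hcomp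
      rw [h3] at h2
      rw [h2.fderiv]
      simp
    have key := h.integral_eq ψ hψ hψc v
    have e1 : (fun z => fderiv ℝ φ z v * u (y + ρ • z)) =
        fun z => ρ * (fun x => fderiv ℝ ψ x v * u x) (y + ρ • z) := by
      ext z; rw [hfd]; ring
    have e2 : (fun z => φ z * (ρ • g (y + ρ • z)) v) =
        fun z => ρ * (fun x => ψ x * g x v) (y + ρ • z) := by
      ext z; simp only [hcomp, smul_apply, smul_eq_mul]; ring
    rw [e1, e2, integral_const_mul, integral_const_mul,
      integral_comp_add_smul (fun x => fderiv ℝ ψ x v * u x) y hρ,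
      integral_comp_add_smul (fun x => ψ x * g x v) y hρ, key]
    simp

lemma WeakGrad.memLp_of_hasCompactSupport {u : Euc n → ℝ} {g : Euc n → (Euc n →L[ℝ] ℝ)}
    (h : WeakGrad u g) (hg : HasCompactSupport g) : MemLp g n volume := by
  have h1 := h.memLp _ hg.isCompact
  have h2 := (memLp_indicator_iff_restrict (μ := volume) (f := g) (p := n)
    (isClosed_tsupport g).measurableSet).2 h1
  rwa [indicator_eq_self.2 (subset_tsupport g)] at h2

/-! ### Mollification commutes with weak gradients. -/

lemma contDiff_comp_sub_left {η : Euc n → ℝ} (hη : ContDiff ℝ ∞ η) (x : Euc n) :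
    ContDiff ℝ ∞ fun y => η (x - y) :=
  hη.comp (contDiff_const.sub contDiff_id)

lemma hasCompactSupport_comp_sub_left {η : Euc n → ℝ} (hη : HasCompactSupport η) (x : Euc n) :
    HasCompactSupport fun y => η (x - y) := by
  have := hη.comp_homeomorph (Homeomorph.subLeft x)
  exact this

lemma fderiv_comp_sub_left {η : Euc n → ℝ} (hη : ContDiff ℝ 1 η) (x y v : Euc n) :
    fderiv ℝ (fun y => η (x - y)) y v = - fderiv ℝ η (x - y) v := by
  have h1 : HasFDerivAt (fun y : Euc n => x - y) (-ContinuousLinearMap.id ℝ (Euc n)) y :=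
    (hasFDerivAt_id y).const_sub x
  have h2 := ((hη.differentiable one_ne_zero (x - y)).hasFDerivAt).comp y h1
  change fderiv ℝ (η ∘ fun y => x - y) y v = _
  rw [h2.fderiv]
  simp

open scoped Convolution in
lemma fderiv_convolution_apply {u η : Euc n → ℝ} (hu : Continuous u) (hη : ContDiff ℝ 1 η)
    (hηc : HasCompactSupport η) (x v : Euc n) :
    fderiv ℝ (η ⋆[ContinuousLinearMap.lsmul ℝ ℝ, volume] u) x v =
      ∫ y, fderiv ℝ η (x - y) v * u y := by
  have hu : LocallyIntegrable u volume := hu.locallyIntegrable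
  have hd := HasCompactSupport.hasFDerivAt_convolution_left (μ := volume)
    (ContinuousLinearMap.lsmul ℝ ℝ) hηc hη hu x
  have hex1 := (HasCompactSupport.convolutionExists_left (μ := volume)
    ((ContinuousLinearMap.lsmul ℝ ℝ).precompL (Euc n)) (hηc.fderiv ℝ)
      (hη.continuous_fderiv one_ne_zero) hu) x
  rw [hd.fderiv, convolution_def, ContinuousLinearMap.integral_apply hex1.integrable,
    ← integral_sub_left_eq_self (fun y => fderiv ℝ η (x - y) v * u y) volume x]
  congr 1
  ext t
  rw [ContinuousLinearMap.precompL_apply, sub_sub_cancel]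
  simp

open scoped Convolution in
lemma convolution_clm_apply {g : Euc n → (Euc n →L[ℝ] ℝ)} {η : Euc n → ℝ}
    (hg : LocallyIntegrable g volume) (hη : Continuous η)
    (hηc : HasCompactSupport η) (x v : Euc n) :
    (η ⋆[ContinuousLinearMap.lsmul ℝ ℝ, volume] g) x v = ∫ y, η (x - y) * g y v := by
  have hex2 := (HasCompactSupport.convolutionExists_left (μ := volume)
    (ContinuousLinearMap.lsmul ℝ ℝ) hηc hη hg) x
  rw [convolution_def, ContinuousLinearMap.integral_apply hex2.integrable,
    ← integral_sub_left_eq_self (fun y => η (x - y) * g y v) volume x]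
  congr 1
  ext t
  rw [sub_sub_cancel]
  simp

open scoped Convolution in
-- For fixed `x` the function `y ↦ η (x - y)` is a test function. The sign produced by
-- differentiating in `y` cancels the sign in the definition of the weak gradient.
lemma WeakGrad.fderiv_convolution (hn : 1 ≤ n) {u : Euc n → ℝ}
    {g : Euc n → (Euc n →L[ℝ] ℝ)} (h : WeakGrad u g) {η : Euc n → ℝ} (hη : ContDiff ℝ ∞ η)
    (hηc : HasCompactSupport η) (x : Euc n) :
    fderiv ℝ (η ⋆[ContinuousLinearMap.lsmul ℝ ℝ, volume] u) x =
      (η ⋆[ContinuousLinearMap.lsmul ℝ ℝ, volume] g) x := by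
  have hη1 : ContDiff ℝ 1 η := hη.of_le (by exact_mod_cast le_top)
  refine ContinuousLinearMap.ext fun v => ?_
  have key := h.integral_eq _ (contDiff_comp_sub_left hη x)
    (hasCompactSupport_comp_sub_left hηc x) v
  rw [fderiv_convolution_apply h.cont hη1 hηc,
    convolution_clm_apply (h.locallyIntegrable hn) hη1.continuous hηc]
  simp only [fderiv_comp_sub_left hη1, neg_mul, integral_neg, neg_inj] at key
  exact key

open scoped Convolution in
open ContinuousLinearMap in
/-- Smooth approximation of compactly supported functions, uniformly and in `W^{1,n}`. -/
lemma WeakGrad.exists_contDiff_approx (hn : 1 ≤ n) {u : Euc n → ℝ}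
    {g : Euc n → (Euc n →L[ℝ] ℝ)} (h : WeakGrad u g) (hu : HasCompactSupport u)
    (hg : HasCompactSupport g) {ε : ℝ} (hε : 0 < ε) :
    ∃ w : Euc n → ℝ, ContDiff ℝ ∞ w ∧ HasCompactSupport w ∧ (∀ x, |w x - u x| ≤ ε) ∧
      eLpNorm (fun x => fderiv ℝ w x - g x) n volume ≤ ENNReal.ofReal ε := by
  obtain ⟨δ₁, hδ₁, h₁⟩ := exists_dist_normed_convolution_le h.cont hu hε
  obtain ⟨δ₂, hδ₂, h₂⟩ := exists_eLpNorm_normed_convolution_sub_le hn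
    (h.memLp_of_hasCompactSupport hg) hε
  have hδ : 0 < min δ₁ δ₂ := by positivity
  let φ : ContDiffBump (0 : Euc n) := ⟨min δ₁ δ₂ / 2, min δ₁ δ₂, by positivity, by linarith⟩
  refine ⟨φ.normed volume ⋆[lsmul ℝ ℝ, volume] u, ?_, ?_, ?_, ?_⟩
  · exact HasCompactSupport.contDiff_convolution_left _ φ.hasCompactSupport_normed
      φ.contDiff_normed h.cont.locallyIntegrable
  · exact HasCompactSupport.convolution _ φ.hasCompactSupport_normed hu
  · intro x
    simpa [Real.dist_eq] using h₁ φ (min_le_left _ _) x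
  · simp only [h.fderiv_convolution hn φ.contDiff_normed φ.hasCompactSupport_normed]
    exact h₂ φ (min_le_right _ _)

/-! ### The integral of the Jacobian determinant in `W^{1,n}` -/

lemma aestronglyMeasurable_rowDet {μ : Measure (Euc n)} {a : Fin n → Euc n → (Euc n →L[ℝ] ℝ)}
    (ha : ∀ i, AEStronglyMeasurable (a i) μ) :
    AEStronglyMeasurable (fun x => rowDet fun i => a i x) μ := by
  have : AEStronglyMeasurable (fun x i => a i x) μ := by
    have := (aemeasurable_pi_lambda (μ := μ) (fun x i => a i x) fun i => (ha i).aemeasurable)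
    exact this.aestronglyMeasurable
  exact continuous_rowDet.comp_aestronglyMeasurable this

/-- Hadamard's inequality followed by Hölder's inequality with `n` factors, each of exponent `n`.
This is why `W^{1,n}` is the natural class for Jacobians. -/
lemma lintegral_rowDet_le (hn : 1 ≤ n) {μ : Measure (Euc n)}
    {a : Fin n → Euc n → (Euc n →L[ℝ] ℝ)} (ha : ∀ i, AEStronglyMeasurable (a i) μ) :
    ∫⁻ x, ‖rowDet fun i => a i x‖ₑ ∂μ ≤ ∏ i, eLpNorm (a i) n μ := by
  have hn0 : (n : ℝ) ≠ 0 := by exact_mod_cast (by omega : n ≠ 0)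
  calc ∫⁻ x, ‖rowDet fun i => a i x‖ₑ ∂μ ≤ ∫⁻ x, ∏ i, (‖a i x‖ₑ ^ n) ^ (1 / (n : ℝ)) ∂μ := by
        refine lintegral_mono fun x => ?_
        have h1 : ‖rowDet fun i => a i x‖ₑ ≤ ∏ i, ‖a i x‖ₑ := by
          have h := ENNReal.ofReal_le_ofReal (abs_rowDet_le fun i => a i x)
          rw [ENNReal.ofReal_prod_of_nonneg fun _ _ => norm_nonneg _] at h
          simpa only [Real.enorm_eq_ofReal_abs, ofReal_norm] using h
        refine h1.trans_eq (Finset.prod_congr rfl fun i _ => ?_)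
        rw [← ENNReal.rpow_natCast, ← ENNReal.rpow_mul, mul_one_div_cancel hn0, ENNReal.rpow_one]
    _ ≤ ∏ i, (∫⁻ x, ‖a i x‖ₑ ^ n ∂μ) ^ (1 / (n : ℝ)) :=
        ENNReal.lintegral_prod_norm_pow_le _ (fun i _ => (ha i).enorm.pow_const n)
          (by simp [hn0]) fun _ _ => by positivity
    _ = ∏ i, eLpNorm (a i) n μ := by
        refine Finset.prod_congr rfl fun i _ => ?_
        rw [← eLpNorm_natCast_pow μ hn, ← ENNReal.rpow_natCast, ← ENNReal.rpow_mul,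
          mul_one_div_cancel hn0, ENNReal.rpow_one]

lemma integrable_rowDet (hn : 1 ≤ n) {μ : Measure (Euc n)}
    {a : Fin n → Euc n → (Euc n →L[ℝ] ℝ)} (ha : ∀ i, MemLp (a i) n μ) :
    Integrable (fun x => rowDet fun i => a i x) μ :=
  ⟨aestronglyMeasurable_rowDet fun i => (ha i).1,
    (lintegral_rowDet_le hn fun i => (ha i).1).trans_lt
      (ENNReal.prod_lt_top fun i _ => (ha i).2)⟩

lemma abs_integral_rowDet_le (hn : 1 ≤ n) {μ : Measure (Euc n)}
    {a : Fin n → Euc n → (Euc n →L[ℝ] ℝ)} (ha : ∀ i, MemLp (a i) n μ) :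
    |∫ x, rowDet (fun i => a i x) ∂μ| ≤ ∏ i, (eLpNorm (a i) n μ).toReal := by
  rw [← ENNReal.toReal_prod, ← Real.norm_eq_abs]
  refine (norm_integral_le_lintegral_norm _).trans ?_
  refine ENNReal.toReal_mono (ENNReal.prod_lt_top fun i _ => (ha i).2).ne ?_
  simp only [ofReal_norm]
  exact lintegral_rowDet_le hn fun i => (ha i).1

lemma rowDet_update_comp (g : Fin n → Euc n → (Euc n →L[ℝ] ℝ)) (i : Fin n)
    (b : Euc n → (Euc n →L[ℝ] ℝ)) (x : Euc n) :
    (fun j => Function.update g i b j x) = Function.update (fun j => g j x) i (b x) := by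
  ext j : 1
  by_cases h : j = i
  · subst h; simp
  · simp [h]

/-- The Jacobian of continuous compactly supported functions in `W^{1,n}` has integral zero. -/
lemma integral_rowDet_eq_zero (hn : 1 ≤ n) (u : Fin n → Euc n → ℝ)
    (g : Fin n → Euc n → (Euc n →L[ℝ] ℝ)) (h : ∀ i, WeakGrad (u i) (g i))
    (hu : ∀ i, HasCompactSupport (u i)) (hg : ∀ i, HasCompactSupport (g i)) :
    ∫ x, rowDet (fun i => g i x) = 0 := by
  -- Induction on the set `S` of indices whose components are not yet assumed smooth. Smoothing a
  -- single component changes the determinant linearly in that row, with the remaining rows kept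
  -- fixed.
  suffices H : ∀ S : Finset (Fin n), ∀ (u : Fin n → Euc n → ℝ)
      (g : Fin n → Euc n → (Euc n →L[ℝ] ℝ)), (∀ i, WeakGrad (u i) (g i)) →
      (∀ i, HasCompactSupport (u i)) → (∀ i, HasCompactSupport (g i)) →
      (∀ i ∉ S, ContDiff ℝ ∞ (u i) ∧ g i = fderiv ℝ (u i)) →
      ∫ x, rowDet (fun i => g i x) = 0 from
    H Finset.univ u g h hu hg fun i hi => absurd (Finset.mem_univ i) hi
  intro S
  induction S using Finset.induction_on with
  | empty =>
    intro u g _ hu _ hS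
    have := integral_rowDet_fderiv_eq_zero hn u (fun i => (hS i (by simp)).1) hu
    simpa only [fun i => (hS i (by simp)).2] using this
  | insert i S _ ih =>
    intro u g h hu hg hS
    have hm : ∀ j, MemLp (g j) n volume := fun j => (h j).memLp_of_hasCompactSupport (hg j)
    -- The factor multiplying `ε` involves only the other rows, so it stays fixed as `ε` tends to
    -- zero.
    have hsmall : ∀ ε : ℝ, 0 < ε → |∫ x, rowDet (fun i => g i x)| ≤
        ε * ∏ j ∈ Finset.univ.erase i, (eLpNorm (g j) n volume).toReal := by
      intro ε hε
      obtain ⟨w, hw, hwc, -, hwg⟩ := (h i).exists_contDiff_approx hn (hu i) (hg i) hε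
      have hw1 : ContDiff ℝ 1 w := hw.of_le (by exact_mod_cast le_top)
      have hwm : MemLp (fderiv ℝ w) n volume :=
        (WeakGrad.of_contDiff hw1).memLp_of_hasCompactSupport (hwc.fderiv ℝ)
      have hdm : MemLp (fun x => g i x - fderiv ℝ w x) n volume := (hm i).sub hwm
      have h0 : ∫ x, rowDet (fun j => Function.update g i (fderiv ℝ w) j x) = 0 := by
        refine ih (Function.update u i w) _ (fun j => ?_) (fun j => ?_) (fun j => ?_) fun j hj => ?_
        all_goals by_cases hji : j = i
        · subst hji; simpa using WeakGrad.of_contDiff hw1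
        · simpa [hji] using h j
        · subst hji; simpa using hwc
        · simpa [hji] using hu j
        · subst hji; simpa using hwc.fderiv ℝ
        · simpa [hji] using hg j
        · subst hji; simpa using hw
        · simpa [hji] using hS j (by simp [hji, hj])
      have hmu : ∀ b : Euc n → (Euc n →L[ℝ] ℝ), MemLp b n volume →
          ∀ j, MemLp (Function.update g i b j) n volume := by
        intro b hb j
        by_cases hji : j = i
        · subst hji; simpa using hb
        · simpa [hji] using hm j
      have hsplit : ∫ x, rowDet (fun j => g j x) =
          ∫ x, rowDet (fun j => Function.update g i (fun x => g i x - fderiv ℝ w x) j x) := by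
        rw [← sub_zero (∫ x, rowDet (fun j => g j x)), ← h0,
          ← integral_sub (integrable_rowDet hn hm) (integrable_rowDet hn (hmu _ hwm))]
        congr 1; ext x
        rw [rowDet_update_comp, rowDet_update_comp, rowDet_update_sub]
        simp
      have hcomm : eLpNorm (fun x => g i x - fderiv ℝ w x) n volume =
          eLpNorm (fun x => fderiv ℝ w x - g i x) n volume := by
        refine eLpNorm_congr_norm_ae (Filter.Eventually.of_forall fun x => norm_sub_rev _ _)
      rw [hsplit]
      refine (abs_integral_rowDet_le hn (hmu _ hdm)).trans ?_
      rw [← Finset.mul_prod_erase _ _ (Finset.mem_univ i)]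
      refine mul_le_mul ?_ (le_of_eq ?_) (Finset.prod_nonneg fun _ _ => by positivity) hε.le
      · rw [Function.update_self, hcomm, ← ENNReal.toReal_ofReal hε.le]
        exact ENNReal.toReal_mono ENNReal.ofReal_ne_top hwg
      · refine Finset.prod_congr rfl fun j hj => ?_
        rw [Function.update_of_ne (Finset.ne_of_mem_erase hj)]
    have hle : |∫ x, rowDet (fun i => g i x)| ≤ 0 := by
      set P := ∏ j ∈ Finset.univ.erase i, (eLpNorm (g j) n volume).toReal
      have hP : 0 ≤ P := Finset.prod_nonneg fun _ _ => by positivity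
      refine le_of_forall_pos_le_add fun δ hδ => ?_
      have := hsmall (δ / (P + 1)) (by positivity)
      refine this.trans ?_
      rw [zero_add, div_mul_eq_mul_div, div_le_iff₀ (by positivity)]
      nlinarith
    exact abs_eq_zero.1 (le_antisymm hle (abs_nonneg _))

lemma exists_cutoff {C : Set (Euc n)} (hC : IsCompact C) :
    ∃ χ : Euc n → ℝ, ContDiff ℝ ∞ χ ∧ HasCompactSupport χ ∧
      ∀ x ∈ C, χ x = 1 ∧ fderiv ℝ χ x = 0 := by
  obtain ⟨R, hR⟩ := hC.isBounded.subset_closedBall 0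
  let f : ContDiffBump (0 : Euc n) := ⟨|R| + 1, |R| + 2, by positivity, by linarith⟩
  refine ⟨f, f.contDiff, f.hasCompactSupport, fun x hx => ?_⟩
  have hlt : x ∈ Metric.ball (0 : Euc n) (|R| + 1) := by
    have := Metric.mem_closedBall.1 (hR hx)
    exact Metric.mem_ball.2 (by linarith [le_abs_self R])
  refine ⟨f.one_of_mem_closedBall (Metric.ball_subset_closedBall hlt), ?_⟩
  have : (f : Euc n → ℝ) =ᶠ[nhds x] fun _ => 1 :=
    Filter.eventually_of_mem (Metric.isOpen_ball.mem_nhds hlt) fun y hy =>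
      f.one_of_mem_closedBall (Metric.ball_subset_closedBall hy)
  rw [this.fderiv_eq]
  simp

lemma memLp_restrict_of_continuous {F : Type*} [NormedAddCommGroup F]
    [SecondCountableTopologyEither (Euc n) F] {b : Euc n → F} (hb : Continuous b)
    {C : Set (Euc n)} (hC : IsCompact C) : MemLp b n (volume.restrict C) := by
  have : IsFiniteMeasure (volume.restrict C) := ⟨by simpa using hC.measure_lt_top⟩
  obtain ⟨M, hM⟩ := hC.exists_bound_of_continuousOn hb.continuousOn
  exact MemLp.of_bound hb.aestronglyMeasurable M
    ((ae_restrict_iff' hC.measurableSet).2 (Filter.Eventually.of_forall hM))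

lemma integrable_mul_rowDet (hn : 1 ≤ n) {φ : Euc n → ℝ} (hφ : Continuous φ)
    {C : Set (Euc n)} (hC : IsCompact C) {a : Fin n → Euc n → (Euc n →L[ℝ] ℝ)}
    (ha : ∀ i, MemLp (a i) n (volume.restrict C))
    (h0 : ∀ x ∉ C, φ x * rowDet (fun i => a i x) = 0) :
    Integrable (fun x => φ x * rowDet (fun i => a i x)) volume := by
  have h1 : IntegrableOn (fun x => φ x * rowDet (fun i => a i x)) C :=
    IntegrableOn.continuousOn_mul hφ.continuousOn (integrable_rowDet hn ha) hC
  exact (integrableOn_iff_integrable_of_support_subset (fun x hx => by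
    by_contra h; exact hx (h0 x h))).1 h1

lemma rowDet_eq_zero_of_row {a : Fin n → (Euc n →L[ℝ] ℝ)} {i : Fin n} (h : a i = 0) :
    rowDet a = 0 := by
  have := rowDet_update_smul a i 0 (a i)
  rw [zero_mul, zero_smul, ← h, Function.update_eq_self] at this
  exact this

lemma hasCompactSupport_mul_gradient {χ u : Euc n → ℝ} {g : Euc n → (Euc n →L[ℝ] ℝ)}
    (hχ : HasCompactSupport χ) :
    HasCompactSupport fun x => χ x • g x + u x • fderiv ℝ χ x := by
  refine HasCompactSupport.of_support_subset_isCompact hχ.isCompact fun x hx => ?_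
  by_contra h
  have h1 : χ x = 0 := image_eq_zero_of_notMem_tsupport h
  have h2 : fderiv ℝ χ x = 0 := by
    by_contra h'
    exact h (support_fderiv_subset ℝ h')
  exact hx (by simp [h1, h2])

/-- Integration by parts for Jacobian determinants of `W^{1,n}` functions, together with the
integrability of both sides. -/
lemma integral_mul_rowDet (hn : 1 ≤ n) (u : Fin n → Euc n → ℝ)
    (g : Fin n → Euc n → (Euc n →L[ℝ] ℝ)) (h : ∀ i, WeakGrad (u i) (g i))
    {φ : Euc n → ℝ} (hφ : ContDiff ℝ ∞ φ) (hc : HasCompactSupport φ) (i : Fin n) :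
    Integrable (fun x => φ x * rowDet (fun j => g j x)) volume ∧
    Integrable (fun x => u i x * rowDet (Function.update (fun j => g j x) i (fderiv ℝ φ x))) volume ∧
    ∫ x, φ x * rowDet (fun j => g j x) =
      - ∫ x, u i x * rowDet (Function.update (fun j => g j x) i (fderiv ℝ φ x)) := by
  have hφ' : Continuous (fderiv ℝ φ) := hφ.continuous_fderiv (by simp)
  obtain ⟨χ, hχ, hχc, hχ1⟩ := exists_cutoff hc.isCompact
  have hzero : ∀ x ∉ tsupport φ, φ x = 0 ∧ fderiv ℝ φ x = 0 := by
    intro x hx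
    refine ⟨image_eq_zero_of_notMem_tsupport hx, ?_⟩
    by_contra h
    exact hx (support_fderiv_subset ℝ h)
  have hI1 : Integrable (fun x => φ x * rowDet (fun j => g j x)) volume :=
    integrable_mul_rowDet hn hφ.continuous hc.isCompact (fun j => (h j).memLp _ hc.isCompact)
      fun x hx => by rw [(hzero x hx).1, zero_mul]
  have hI2 : Integrable (fun x => u i x *
      rowDet (Function.update (fun j => g j x) i (fderiv ℝ φ x))) volume := by
    simp only [← rowDet_update_comp]
    refine integrable_mul_rowDet hn (h i).cont hc.isCompact (fun j => ?_) fun x hx => ?_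
    · by_cases hji : j = i
      · subst hji; simpa using memLp_restrict_of_continuous hφ' hc.isCompact
      · simpa [hji] using (h j).memLp _ hc.isCompact
    · rw [rowDet_eq_zero_of_row (i := i), mul_zero]
      simpa using (hzero x hx).2
  refine ⟨hI1, hI2, ?_⟩
  -- The `i`-th component is cut off by `φ`, the others by a function equal to `1` on the support of
  -- `φ`. On that support only row `i` feels the derivative of its cutoff; off it, row `i` vanishes.
  -- The zero integral of the resulting Jacobian is exactly the integration by parts formula.
  let θ : Fin n → Euc n → ℝ := fun j => if j = i then φ else χ
  have hθ : ∀ j, ContDiff ℝ ∞ (θ j) := by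
    intro j; by_cases hji : j = i <;> simp [θ, hji, hφ, hχ]
  have hθc : ∀ j, HasCompactSupport (θ j) := by
    intro j; by_cases hji : j = i <;> simp [θ, hji, hc, hχc]
  have h0 := integral_rowDet_eq_zero hn (fun j x => θ j x * u j x)
    (fun j x => θ j x • g j x + u j x • fderiv ℝ (θ j) x) (fun j => (h j).mul hn (hθ j))
    (fun j => (hθc j).mul_right) fun j => hasCompactSupport_mul_gradient (hθc j)
  have hpt : ∀ x, rowDet (fun j => θ j x • g j x + u j x • fderiv ℝ (θ j) x) =
      φ x * rowDet (fun j => g j x) +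
        u i x * rowDet (Function.update (fun j => g j x) i (fderiv ℝ φ x)) := by
    intro x
    by_cases hx : x ∈ tsupport φ
    · have : (fun j => θ j x • g j x + u j x • fderiv ℝ (θ j) x) =
          Function.update (fun j => g j x) i (φ x • g i x + u i x • fderiv ℝ φ x) := by
        ext j : 1
        by_cases hji : j = i
        · subst hji; simp [θ]
        · simp [θ, hji, hχ1 x hx]
      rw [this, rowDet_update_add, rowDet_update_smul, rowDet_update_smul,
        Function.update_eq_self i (fun j => g j x)]
    · rw [(hzero x hx).1, (hzero x hx).2,
        rowDet_eq_zero_of_row (i := i) (a := Function.update (fun j => g j x) i 0) (by simp),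
        rowDet_eq_zero_of_row (i := i)]
      · simp
      · simp [θ, hzero x hx]
  simp only [hpt] at h0
  rw [integral_add hI1 hI2] at h0
  linarith

/-! ### Poincaré inequalities -/

/-- The double integral `∫_S ∫_T |u(x) - u(y)|ⁿ`. -/
noncomputable def meanOsc (u : Euc n → ℝ) (S T : Set (Euc n)) : ENNReal :=
  ∫⁻ x in S, ∫⁻ y in T, ‖u x - u y‖ₑ ^ n

lemma lintegral_comp_add_smul (f : Euc n → ENNReal) (y : Euc n) {ρ : ℝ} (hρ : 0 < ρ) :
    ∫⁻ z, f (y + ρ • z) = ENNReal.ofReal ((ρ ^ n)⁻¹) * ∫⁻ x, f x := by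
  rw [← (measurableEmbedding_add_smul y hρ).lintegral_map, map_add_smul_volume y hρ,
    lintegral_smul_measure, smul_eq_mul]

lemma enorm_sub_pow_le_lintegral (hn : 1 ≤ n) {w : Euc n → ℝ} (hw : ContDiff ℝ 1 w)
    (x y : Euc n) : ‖w x - w y‖ₑ ^ n ≤
      ‖y - x‖ₑ ^ n * ∫⁻ t in Ioc (0 : ℝ) 1, ‖fderiv ℝ w (x + t • (y - x))‖ₑ ^ n := by
  have hc := hw.continuous_fderiv one_ne_zero
  have hcont : Continuous fun t : ℝ => fderiv ℝ w (x + t • (y - x)) := hc.comp (by fun_prop)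
  have hd : ∀ t : ℝ, HasDerivAt (fun t : ℝ => w (x + t • (y - x)))
      (fderiv ℝ w (x + t • (y - x)) (y - x)) t := by
    intro t
    have h1 : HasDerivAt (fun t : ℝ => x + t • (y - x)) (y - x) t := by
      simpa using ((hasDerivAt_id t).smul_const (y - x)).const_add x
    exact ((hw.differentiable one_ne_zero _).hasFDerivAt).comp_hasDerivAt t h1
  have hftc := intervalIntegral.integral_eq_sub_of_hasDerivAt (a := 0) (b := 1)
    (fun t _ => hd t) ((hcont.clm_apply continuous_const).intervalIntegrable 0 1)
  have hν : IsProbabilityMeasure (volume.restrict (Ioc (0 : ℝ) 1)) := ⟨by simp⟩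
  have h1 : ‖w x - w y‖ₑ ≤ ‖y - x‖ₑ * ∫⁻ t in Ioc (0 : ℝ) 1, ‖fderiv ℝ w (x + t • (y - x))‖ₑ := by
    have h2 : w y - w x = ∫ t in Ioc (0 : ℝ) 1, fderiv ℝ w (x + t • (y - x)) (y - x) := by
      rw [← intervalIntegral.integral_of_le zero_le_one, hftc]
      simp
    rw [enorm_sub_rev, h2, ← lintegral_const_mul' _ _ enorm_ne_top]
    refine (enorm_integral_le_lintegral_enorm _).trans (lintegral_mono fun t => ?_)
    rw [mul_comm]
    exact ContinuousLinearMap.le_opENorm _ _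
  calc ‖w x - w y‖ₑ ^ n ≤
      (‖y - x‖ₑ * ∫⁻ t in Ioc (0 : ℝ) 1, ‖fderiv ℝ w (x + t • (y - x))‖ₑ) ^ n := by gcongr
    _ ≤ _ := by
      rw [mul_pow]
      gcongr
      exact lintegral_pow_le_of_isProbabilityMeasure _ hn hcont.enorm.measurable.aemeasurable

/-- The substitution `y ↦ x + t (y - x)` for `t ≥ 1/2` in a convex set. -/
lemma setLIntegral_comp_segment_le {H : Set (Euc n)} (hH : Convex ℝ H) (hm : MeasurableSet H)
    (G : Euc n → ENNReal) {x : Euc n} (hx : x ∈ H) {t : ℝ} (ht : 1 / 2 ≤ t) (ht1 : t ≤ 1) :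
    ∫⁻ y in H, G (x + t • (y - x)) ≤ 2 ^ n * ∫⁻ z in H, G z := by
  have ht0 : 0 < t := by linarith
  calc ∫⁻ y in H, G (x + t • (y - x)) = ∫⁻ y, H.indicator (fun y => G (x + t • (y - x))) y :=
        (lintegral_indicator hm _).symm
    _ ≤ ∫⁻ y, (H.indicator G) ((x - t • x) + t • y) := by
        refine lintegral_mono fun y => ?_
        by_cases hy : y ∈ H
        · have h1 : x + t • (y - x) ∈ H := hH.add_smul_sub_mem hx hy ⟨ht0.le, ht1⟩
          have h2 : (x - t • x) + t • y = x + t • (y - x) := by rw [smul_sub]; abel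
          simp only [h2]
          rw [indicator_of_mem hy, indicator_of_mem h1]
        · simp [hy]
    _ = ENNReal.ofReal ((t ^ n)⁻¹) * ∫⁻ z in H, G z := by
        rw [lintegral_comp_add_smul _ _ ht0, lintegral_indicator hm]
    _ ≤ 2 ^ n * ∫⁻ z in H, G z := by
        gcongr
        have h3 : (t ^ n)⁻¹ ≤ 2 ^ n := by
          rw [← inv_pow]
          gcongr
          rw [inv_le_comm₀ ht0 two_pos]; linarith
        refine (ENNReal.ofReal_le_ofReal h3).trans_eq ?_
        rw [ENNReal.ofReal_pow two_pos.le]; simp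

/-- The increments are integrated along segments. For `t ≥ 1 / 2` the substitution `y ↦ x + t (y -
x)` costs at most `2 ^ n`; for `t ≤ 1 / 2` the roles of `x` and `y` are exchanged, so the
degeneration at `t = 0` never enters. -/
lemma meanOsc_le_of_contDiff (hn : 1 ≤ n) {H : Set (Euc n)} (hH : Convex ℝ H)
    (hm : MeasurableSet H) {p : Euc n} {R : ℝ} (hR : H ⊆ Metric.closedBall p R) {w : Euc n → ℝ}
    (hw : ContDiff ℝ 1 w) :
    meanOsc w H H ≤ (ENNReal.ofReal (2 * R) ^ n * (volume H * 2 ^ n)) *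
      ∫⁻ x in H, ‖fderiv ℝ w x‖ₑ ^ n := by
  let G : Euc n → ENNReal := fun x => ‖fderiv ℝ w x‖ₑ ^ n
  have hG : Continuous G :=
    (ENNReal.continuous_pow n).comp (hw.continuous_fderiv one_ne_zero).enorm
  have hGm : Measurable fun p : (Euc n × Euc n) × ℝ => G (p.1.1 + p.2 • (p.1.2 - p.1.1)) :=
    (hG.comp (by fun_prop)).measurable
  have hdist : ∀ x ∈ H, ∀ y ∈ H, ‖y - x‖ₑ ≤ ENNReal.ofReal (2 * R) := by
    intro x hx y hy
    rw [← ofReal_norm]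
    apply ENNReal.ofReal_le_ofReal
    have h1 := hR hx
    have h2 := hR hy
    rw [Metric.mem_closedBall] at h1 h2
    rw [← dist_eq_norm]
    linarith [dist_triangle_right y x p]
  have hstep : ∀ t ∈ Ioc (0 : ℝ) 1,
      ∫⁻ x in H, ∫⁻ y in H, G (x + t • (y - x)) ≤ volume H * 2 ^ n * ∫⁻ z in H, G z := by
    intro t ht
    have hswap : ∫⁻ x in H, ∫⁻ y in H, G (x + t • (y - x)) =
        ∫⁻ y in H, ∫⁻ x in H, G (x + t • (y - x)) := by
      apply lintegral_lintegral_swap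
      exact (hG.comp (f := fun p : Euc n × Euc n => p.1 + t • (p.2 - p.1))
        (by fun_prop)).measurable.aemeasurable
    have hconst : ∫⁻ _ in H, (2 ^ n * ∫⁻ z in H, G z) = volume H * 2 ^ n * ∫⁻ z in H, G z := by
      rw [setLIntegral_const]; ring
    rcases le_total (1 / 2) t with h | h
    · rw [← hconst]
      exact setLIntegral_mono' hm fun x hx => setLIntegral_comp_segment_le hH hm G hx h ht.2
    · rw [hswap, ← hconst]
      refine setLIntegral_mono' hm fun y hy => ?_
      have := setLIntegral_comp_segment_le hH hm G hy (t := 1 - t) (by linarith) (by linarith [ht.1])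
      refine le_trans (le_of_eq ?_) this
      congr 1; ext x; congr 1
      rw [smul_sub, smul_sub, sub_smul, sub_smul, one_smul, one_smul]; abel
  calc meanOsc w H H ≤ ∫⁻ x in H, ∫⁻ y in H, ENNReal.ofReal (2 * R) ^ n *
        ∫⁻ t in Ioc (0 : ℝ) 1, G (x + t • (y - x)) := by
        refine setLIntegral_mono' hm fun x hx => setLIntegral_mono' hm fun y hy => ?_
        refine (enorm_sub_pow_le_lintegral hn hw x y).trans ?_
        gcongr
        exact hdist x hx y hy
    _ = ENNReal.ofReal (2 * R) ^ n *
        ∫⁻ x in H, ∫⁻ y in H, ∫⁻ t in Ioc (0 : ℝ) 1, G (x + t • (y - x)) := by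
        rw [← lintegral_const_mul' _ _ (ENNReal.pow_ne_top ENNReal.ofReal_ne_top)]
        congr 1; ext x
        rw [← lintegral_const_mul' _ _ (ENNReal.pow_ne_top ENNReal.ofReal_ne_top)]
    _ = ENNReal.ofReal (2 * R) ^ n *
        ∫⁻ t in Ioc (0 : ℝ) 1, ∫⁻ x in H, ∫⁻ y in H, G (x + t • (y - x)) := by
        congr 1
        rw [← lintegral_prod (f := fun p : Euc n × Euc n =>
          ∫⁻ t in Ioc (0 : ℝ) 1, G (p.1 + t • (p.2 - p.1)))]
        · rw [lintegral_lintegral_swap]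
          · congr 1; ext t
            rw [lintegral_prod]
            exact (hG.comp (f := fun p : Euc n × Euc n => p.1 + t • (p.2 - p.1))
              (by fun_prop)).measurable.aemeasurable
          · exact hGm.aemeasurable
        · exact (Measurable.lintegral_prod_right' hGm).aemeasurable
    _ ≤ ENNReal.ofReal (2 * R) ^ n *
        ∫⁻ t in Ioc (0 : ℝ) 1, volume H * 2 ^ n * ∫⁻ z in H, G z := by
        exact mul_le_mul' le_rfl (setLIntegral_mono' measurableSet_Ioc hstep)
    _ = _ := by
        rw [setLIntegral_const]
        simp [G, mul_assoc]

/-- The Poincaré inequality on bounded convex sets, in `W^{1,n}`. -/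
lemma WeakGrad.meanOsc_le (hn : 1 ≤ n) {H : Set (Euc n)} (hH : Convex ℝ H)
    (hm : MeasurableSet H) {p : Euc n} {R : ℝ} (hR : H ⊆ Metric.closedBall p R) {u : Euc n → ℝ}
    {g : Euc n → (Euc n →L[ℝ] ℝ)} (h : WeakGrad u g) :
    meanOsc u H H ≤ (ENNReal.ofReal (2 * R) ^ n * (volume H * 2 ^ n)) *
      ∫⁻ x in H, ‖g x‖ₑ ^ n := by
  have hn1 : (1 : ENNReal) ≤ n := by exact_mod_cast hn
  have hfin : volume H ≠ ⊤ :=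
    ((measure_mono hR).trans_lt (isCompact_closedBall p R).measure_lt_top).ne
  set C : ENNReal := ENNReal.ofReal (2 * R) ^ n * (volume H * 2 ^ n)
  have hC : C ≠ ⊤ := by
    refine ENNReal.mul_ne_top (ENNReal.pow_ne_top ENNReal.ofReal_ne_top) (ENNReal.mul_ne_top hfin (by simp))
  -- The truncation makes mollification available and changes neither `u` nor its gradient on `H`.
  obtain ⟨χ, hχ, hχc, hχ1⟩ := exists_cutoff (isCompact_closedBall p R)
  have hv := h.mul hn hχ
  have hgm := hv.aestronglyMeasurable hn
  choose w hw hwc hwu hwg using fun k : ℕ =>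
    hv.exists_contDiff_approx hn hχc.mul_right (hasCompactSupport_mul_gradient hχc)
      (ε := 1 / ((k : ℝ) + 1)) (by positivity)
  have hw1 : ∀ k, ContDiff ℝ 1 (w k) := fun k => (hw k).of_le (by exact_mod_cast le_top)
  have hlim : ∀ x ∈ H, Filter.Tendsto (fun k => w k x) Filter.atTop (nhds (u x)) := by
    intro x hx
    rw [tendsto_iff_norm_sub_tendsto_zero]
    refine squeeze_zero (fun _ => norm_nonneg _) (fun k => ?_) tendsto_one_div_add_atTop_nhds_zero_nat
    have := hwu k x
    rwa [(hχ1 x (hR hx)).1, one_mul] at this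
  have hbound : ∀ k, meanOsc (w k) H H ≤
      C * (eLpNorm g n (volume.restrict H) + ENNReal.ofReal (1 / ((k : ℝ) + 1))) ^ n := by
    intro k
    refine (meanOsc_le_of_contDiff hn hH hm hR (hw1 k)).trans ?_
    gcongr
    rw [← eLpNorm_natCast_pow _ hn]
    gcongr
    have hae : (fun x => χ x • g x + u x • fderiv ℝ χ x) =ᵐ[volume.restrict H] g := by
      refine (ae_restrict_iff' hm).2 (Filter.Eventually.of_forall fun x hx => ?_)
      simp [hχ1 x (hR hx)]
    have hsplit : fderiv ℝ (w k) = (fun x => χ x • g x + u x • fderiv ℝ χ x) +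
        fun x => fderiv ℝ (w k) x - (χ x • g x + u x • fderiv ℝ χ x) := by
      ext x : 1; simp
    rw [hsplit]
    refine (eLpNorm_add_le hgm.restrict
      ((((hw1 k).continuous_fderiv one_ne_zero).aestronglyMeasurable.sub hgm).restrict) hn1).trans ?_
    rw [eLpNorm_congr_ae hae]
    gcongr
    exact (eLpNorm_mono_measure _ Measure.restrict_le_self).trans (hwg k)
  have htend : Filter.Tendsto (fun k : ℕ =>
      C * (eLpNorm g n (volume.restrict H) + ENNReal.ofReal (1 / ((k : ℝ) + 1))) ^ n)
      Filter.atTop (nhds (C * eLpNorm g n (volume.restrict H) ^ n)) := by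
    refine ENNReal.Tendsto.const_mul ?_ (Or.inr hC)
    refine ((ENNReal.continuous_pow n).tendsto _).comp ?_
    have h0 : Filter.Tendsto (fun k : ℕ => ENNReal.ofReal (1 / ((k : ℝ) + 1)))
        Filter.atTop (nhds 0) := by
      rw [← ENNReal.ofReal_zero]
      exact ENNReal.tendsto_ofReal tendsto_one_div_add_atTop_nhds_zero_nat
    simpa using tendsto_const_nhds.add h0
  have hmeas : ∀ (v : Euc n → ℝ), Continuous v →
      Measurable fun p : Euc n × Euc n => ‖v p.1 - v p.2‖ₑ ^ n := by
    intro v hv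
    exact ((ENNReal.continuous_pow n).comp
      ((hv.comp continuous_fst).sub (hv.comp continuous_snd)).enorm).measurable
  have hprod : ∀ (v : Euc n → ℝ), Continuous v → meanOsc v H H =
      ∫⁻ p, ‖v p.1 - v p.2‖ₑ ^ n ∂((volume.restrict H).prod (volume.restrict H)) := by
    intro v hv
    rw [lintegral_prod _ (hmeas v hv).aemeasurable]
    rfl
  -- The smooth inequality passes to the limit by Fatou on the product space, since the
  -- approximations converge pointwise on `H`.
  rw [← eLpNorm_natCast_pow _ hn, hprod u h.cont]
  calc ∫⁻ p, ‖u p.1 - u p.2‖ₑ ^ n ∂((volume.restrict H).prod (volume.restrict H))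
      ≤ ∫⁻ p, Filter.liminf (fun k => ‖w k p.1 - w k p.2‖ₑ ^ n) Filter.atTop
          ∂((volume.restrict H).prod (volume.restrict H)) := by
        refine lintegral_mono_ae ?_
        rw [Measure.prod_restrict]
        refine (ae_restrict_iff' (hm.prod hm)).2 (Filter.Eventually.of_forall fun p hp => ?_)
        have := ((ENNReal.continuous_pow n).tendsto _).comp
          (((hlim p.1 hp.1).sub (hlim p.2 hp.2)).enorm)
        exact this.liminf_eq.ge
    _ ≤ Filter.liminf (fun k => ∫⁻ p, ‖w k p.1 - w k p.2‖ₑ ^ n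
          ∂((volume.restrict H).prod (volume.restrict H))) Filter.atTop :=
        lintegral_liminf_le fun k => hmeas _ (hw1 k).continuous
    _ ≤ Filter.liminf (fun k : ℕ => C * (eLpNorm g n (volume.restrict H) +
          ENNReal.ofReal (1 / ((k : ℝ) + 1))) ^ n) Filter.atTop := by
        refine Filter.liminf_le_liminf (Filter.Eventually.of_forall fun k => ?_)
        rw [← hprod _ (hw1 k).continuous]
        exact hbound k
    _ = C * eLpNorm g n (volume.restrict H) ^ n := htend.liminf_eq

/-- The open cube with centre `y` and half side `r`. -/
def cube (y : Euc n) (r : ℝ) : Set (Euc n) := {z | ∀ i, |z i - y i| < r}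

lemma isOpen_cube (y : Euc n) (r : ℝ) : IsOpen (cube y r) := by
  have : cube y r = ⋂ i, {z : Euc n | |z i - y i| < r} := by
    ext z; simp [cube]
  rw [this]
  refine isOpen_iInter_of_finite fun i => isOpen_lt ?_ continuous_const
  fun_prop

lemma convex_cube (y : Euc n) (r : ℝ) : Convex ℝ (cube y r) := by
  have : cube y r = ⋂ i, {z : Euc n | z i < y i + r} ∩ {z : Euc n | y i - r < z i} := by
    ext z
    simp only [cube, mem_ofPred_eq, mem_iInter, mem_inter_iff, abs_lt]
    refine forall_congr' fun i => ⟨fun h => ⟨by linarith, by linarith⟩,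
      fun h => ⟨by linarith, by linarith⟩⟩
  rw [this]
  refine convex_iInter fun i => ?_
  exact (convex_halfSpace_lt (f := fun z : Euc n => z i)
    (EuclideanSpace.proj i : Euc n →L[ℝ] ℝ).isLinear _).inter
    (convex_halfSpace_gt (f := fun z : Euc n => z i)
    (EuclideanSpace.proj i : Euc n →L[ℝ] ℝ).isLinear _)

lemma cube_subset_closedBall (y : Euc n) (r : ℝ) :
    cube y r ⊆ Metric.closedBall y (√n * r) := by
  intro z hz
  rw [Metric.mem_closedBall, dist_eq_norm, EuclideanSpace.norm_eq]
  -- For `r ≤ 0` the cube can contain a point only if there are no coordinates at all, that is, `n =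
  -- 0`.
  rcases le_total r 0 with hr | hr
  · have hempty : IsEmpty (Fin n) :=
      ⟨fun i => absurd (hz i) (not_lt.2 (hr.trans (abs_nonneg _)))⟩
    have : n = 0 := by
      have := Fintype.card_eq_zero (α := Fin n)
      rwa [Fintype.card_fin] at this
    subst this
    simp
  · calc √(∑ i, ‖(z - y) i‖ ^ 2) ≤ √(∑ _i : Fin n, r ^ 2) := by
          gcongr with i
          have := (hz i).le
          simpa using this
      _ = √n * r := by
          simp only [Finset.sum_const, Finset.card_univ, Fintype.card_fin, nsmul_eq_mul]
          rw [Real.sqrt_mul (Nat.cast_nonneg n), Real.sqrt_sq hr]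

lemma ball_subset_cube (y : Euc n) (r : ℝ) : Metric.ball y r ⊆ cube y r := by
  intro z hz i
  have h1 := PiLp.norm_apply_le (z - y) i
  have h2 : ‖z - y‖ < r := by simpa [dist_eq_norm] using hz
  simpa using h1.trans_lt h2

lemma volume_cube_ne_top (y : Euc n) (r : ℝ) : volume (cube y r) ≠ ⊤ :=
  ((measure_mono (cube_subset_closedBall y r)).trans_lt
    (isCompact_closedBall y _).measure_lt_top).ne

lemma volume_cube_ne_zero (y : Euc n) {r : ℝ} (hr : 0 < r) : volume (cube y r) ≠ 0 :=
  ((Metric.measure_ball_pos volume y hr).trans_le (measure_mono (ball_subset_cube y r))).ne'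

/-! ### Chaining Poincaré inequalities across overlapping sets. -/

/-- The Poincaré inequality for the mean oscillation over `S × T`, with gradients on `V`. -/
def PoincarePair (S T V : Set (Euc n)) : Prop :=
  ∃ C : ENNReal, C ≠ ⊤ ∧ ∀ (u : Euc n → ℝ) (g : Euc n → (Euc n →L[ℝ] ℝ)), WeakGrad u g →
    meanOsc u S T ≤ C * ∫⁻ x in V, ‖g x‖ₑ ^ n

lemma PoincarePair.mono {S S' T T' V : Set (Euc n)} (h : PoincarePair S T V) (hS : S' ⊆ S)
    (hT : T' ⊆ T) : PoincarePair S' T' V := by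
  obtain ⟨C, hC, hp⟩ := h
  refine ⟨C, hC, fun u g hu => le_trans ?_ (hp u g hu)⟩
  refine (lintegral_mono_set hS).trans (lintegral_mono fun x => lintegral_mono_set hT)

lemma PoincarePair.of_convex (hn : 1 ≤ n) {H V : Set (Euc n)} (hH : Convex ℝ H)
    (hm : MeasurableSet H) {p : Euc n} {R : ℝ} (hR : H ⊆ Metric.closedBall p R) (hV : H ⊆ V) :
    PoincarePair H H V := by
  have hfin : volume H ≠ ⊤ :=
    ((measure_mono hR).trans_lt (isCompact_closedBall p R).measure_lt_top).ne
  refine ⟨ENNReal.ofReal (2 * R) ^ n * (volume H * 2 ^ n), ?_, fun u g hu =>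
    (hu.meanOsc_le hn hH hm hR).trans ?_⟩
  · exact ENNReal.mul_ne_top (ENNReal.pow_ne_top ENNReal.ofReal_ne_top)
      (ENNReal.mul_ne_top hfin (ENNReal.pow_ne_top ENNReal.ofNat_ne_top))
  gcongr

lemma enorm_add_pow_le (a b : ℝ) (n : ℕ) : ‖a + b‖ₑ ^ n ≤ 2 ^ n * (‖a‖ₑ ^ n + ‖b‖ₑ ^ n) := by
  calc ‖a + b‖ₑ ^ n ≤ (2 * max ‖a‖ₑ ‖b‖ₑ) ^ n := by
        gcongr
        refine (enorm_add_le a b).trans ?_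
        rw [two_mul]
        exact add_le_add (le_max_left _ _) (le_max_right _ _)
    _ ≤ 2 ^ n * (‖a‖ₑ ^ n + ‖b‖ₑ ^ n) := by
        rw [mul_pow]
        gcongr
        rcases max_choice ‖a‖ₑ ‖b‖ₑ with h | h <;> rw [h]
        · exact le_self_add
        · exact le_add_self

lemma measurable_enorm_sub_pow {u : Euc n → ℝ} (hu : Continuous u) :
    Measurable fun p : Euc n × Euc n => ‖u p.1 - u p.2‖ₑ ^ n :=
  ((ENNReal.continuous_pow n).comp
    ((hu.comp continuous_fst).sub (hu.comp continuous_snd)).enorm).measurable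

/-- Split `u x - u y` through an intermediate value `u z` and integrate over all `z` in `Z`. -/
lemma meanOsc_trans {u : Euc n → ℝ} (hu : Continuous u) (S Z T : Set (Euc n)) :
    volume Z * meanOsc u S T ≤
      2 ^ n * (volume T * meanOsc u S Z + volume S * meanOsc u Z T) := by
  have hm := measurable_enorm_sub_pow hu
  have hxm : ∀ x, Measurable fun z => ‖u x - u z‖ₑ ^ n := fun x =>
    hm.comp measurable_prodMk_left
  have hpt : ∀ x, volume Z * ∫⁻ y in T, ‖u x - u y‖ₑ ^ n ≤
      2 ^ n * (volume T * (∫⁻ z in Z, ‖u x - u z‖ₑ ^ n) + meanOsc u Z T) := by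
    intro x
    calc volume Z * ∫⁻ y in T, ‖u x - u y‖ₑ ^ n
        = ∫⁻ _ in Z, ∫⁻ y in T, ‖u x - u y‖ₑ ^ n := by rw [setLIntegral_const, mul_comm]
      _ ≤ ∫⁻ z in Z, ∫⁻ y in T, 2 ^ n * (‖u x - u z‖ₑ ^ n + ‖u z - u y‖ₑ ^ n) := by
          refine lintegral_mono fun z => lintegral_mono fun y => ?_
          have := enorm_add_pow_le (u x - u z) (u z - u y) n
          rwa [sub_add_sub_cancel] at this
      _ = 2 ^ n * ∫⁻ z in Z, (volume T * ‖u x - u z‖ₑ ^ n + ∫⁻ y in T, ‖u z - u y‖ₑ ^ n) := by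
          rw [← lintegral_const_mul' _ _ (ENNReal.pow_ne_top ENNReal.ofNat_ne_top)]
          congr 1; ext z
          rw [lintegral_const_mul' _ _ (ENNReal.pow_ne_top ENNReal.ofNat_ne_top),
            lintegral_add_left measurable_const, setLIntegral_const, mul_comm (volume T)]
      _ = _ := by
          rw [lintegral_add_left ((hxm x).const_mul _), lintegral_const_mul _ (hxm x)]
          rfl
  calc volume Z * meanOsc u S T
      ≤ ∫⁻ x in S, volume Z * ∫⁻ y in T, ‖u x - u y‖ₑ ^ n :=
        lintegral_const_mul_le _ _
    _ ≤ ∫⁻ x in S, 2 ^ n * (volume T * (∫⁻ z in Z, ‖u x - u z‖ₑ ^ n) + meanOsc u Z T) :=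
        lintegral_mono fun x => hpt x
    _ = 2 ^ n * (volume T * meanOsc u S Z + volume S * meanOsc u Z T) := by
        have hmz : Measurable fun x => ∫⁻ z in Z, ‖u x - u z‖ₑ ^ n := hm.lintegral_prod_right'
        rw [lintegral_const_mul' _ _ (ENNReal.pow_ne_top ENNReal.ofNat_ne_top),
          lintegral_add_right _ measurable_const, setLIntegral_const,
          lintegral_const_mul _ hmz, mul_comm (meanOsc u Z T)]
        rfl

/-- The intermediate set must have positive measure, because its volume is divided out. In the
application it is an overlap of two slabs, or a whole slab. -/
lemma PoincarePair.trans {S Z T V : Set (Euc n)} (h : PoincarePair S Z V) (h' : PoincarePair Z T V)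
    (hZ : volume Z ≠ 0) (hZ' : volume Z ≠ ⊤) (hS : volume S ≠ ⊤) (hT : volume T ≠ ⊤) :
    PoincarePair S T V := by
  obtain ⟨C, hC, hp⟩ := h
  obtain ⟨C', hC', hp'⟩ := h'
  refine ⟨(volume Z)⁻¹ * (2 ^ n * (volume T * C + volume S * C')), ?_, fun u g hu => ?_⟩
  · refine ENNReal.mul_ne_top (ENNReal.inv_ne_top.2 hZ) (ENNReal.mul_ne_top
      (ENNReal.pow_ne_top ENNReal.ofNat_ne_top) (ENNReal.add_ne_top.2
      ⟨ENNReal.mul_ne_top hT hC, ENNReal.mul_ne_top hS hC'⟩))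
  · rw [mul_assoc, ← ENNReal.mul_le_iff_le_inv hZ hZ']
    refine (meanOsc_trans hu.cont S Z T).trans ?_
    rw [mul_assoc, add_mul, mul_assoc, mul_assoc]
    gcongr
    · exact hp u g hu
    · exact hp' u g hu

lemma PoincarePair.iUnion {ι : Type*} [Fintype ι] {S : ι → Set (Euc n)} {V : Set (Euc n)}
    (h : ∀ i j, PoincarePair (S i) (S j) V) : PoincarePair (⋃ i, S i) (⋃ i, S i) V := by
  choose C hC hp using h
  refine ⟨∑ i, ∑ j, C i j, ?_, fun u g hu => ?_⟩
  · exact ENNReal.sum_ne_top.2 fun i _ => ENNReal.sum_ne_top.2 fun j _ => hC i j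
  · have hm := measurable_enorm_sub_pow hu.cont
    calc meanOsc u (⋃ i, S i) (⋃ i, S i)
        ≤ ∑ i, ∫⁻ x in S i, ∫⁻ y in ⋃ j, S j, ‖u x - u y‖ₑ ^ n := by
          refine (lintegral_iUnion_le _ _).trans_eq (tsum_fintype _)
      _ ≤ ∑ i, ∫⁻ x in S i, ∑ j, ∫⁻ y in S j, ‖u x - u y‖ₑ ^ n := by
          refine Finset.sum_le_sum fun i _ => lintegral_mono fun x => ?_
          exact (lintegral_iUnion_le _ _).trans_eq (tsum_fintype _)
      _ = ∑ i, ∑ j, meanOsc u (S i) (S j) := by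
          refine Finset.sum_congr rfl fun i _ => ?_
          rw [lintegral_finsetSum _ fun j _ => hm.lintegral_prod_right']
          rfl
      _ ≤ ∑ i, ∑ j, C i j * ∫⁻ x in V, ‖g x‖ₑ ^ n :=
          Finset.sum_le_sum fun i _ => Finset.sum_le_sum fun j _ => hp i j u g hu
      _ = _ := by simp only [Finset.sum_mul]

/-- The slab of `cube 0 2` on which `1 ≤ s zᵢ`. -/
def slab (i : Fin n) (s : ℝ) : Set (Euc n) := {z | z ∈ cube 0 2 ∧ 1 ≤ s * z i}

lemma slab_subset_cube (i : Fin n) (s : ℝ) : slab i s ⊆ cube 0 2 := fun _ hz => hz.1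

lemma convex_slab (i : Fin n) (s : ℝ) : Convex ℝ (slab i s) := by
  refine (convex_cube 0 2).inter ?_
  exact convex_halfSpace_ge (f := fun z : Euc n => s * z i)
    (s • (EuclideanSpace.proj i : Euc n →L[ℝ] ℝ)).isLinear _

lemma measurableSet_slab (i : Fin n) (s : ℝ) : MeasurableSet (slab i s) := by
  refine (isOpen_cube (n := n) 0 2).measurableSet.inter ?_
  have hc : Continuous fun z : Euc n => s * z i := by fun_prop
  exact (isClosed_le continuous_const hc).measurableSet

lemma slab_subset_annulus (i : Fin n) {s : ℝ} (hs : |s| = 1) :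
    slab i s ⊆ cube 0 2 \ cube 0 1 := by
  rintro z ⟨hz, h1⟩
  refine ⟨hz, fun h => ?_⟩
  have h2 := h i
  have h3 : s * z i ≤ |z i| := by
    refine (le_abs_self _).trans ?_
    rw [abs_mul, hs, one_mul]
  simp at h2
  linarith

lemma volume_slab_inter_slab_ne_zero {i j : Fin n} (hij : i ≠ j) {s t : ℝ} (hs : |s| = 1)
    (ht : |t| = 1) : volume (slab i s ∩ slab j t) ≠ 0 := by
  have hs2 : s * s = 1 := by rw [← abs_mul_abs_self, hs, one_mul]
  have ht2 : t * t = 1 := by rw [← abs_mul_abs_self, ht, one_mul]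
  let U : Set (Euc n) := cube 0 2 ∩ ({z | 1 < s * z i} ∩ {z | 1 < t * z j})
  have hU : IsOpen U := by
    refine (isOpen_cube 0 2).inter (IsOpen.inter ?_ ?_)
    · exact isOpen_lt continuous_const (by fun_prop)
    · exact isOpen_lt continuous_const (by fun_prop)
  have hne : U.Nonempty := by
    refine ⟨WithLp.toLp 2 fun k => if k = i then 3 / 2 * s else if k = j then 3 / 2 * t else 0,
      fun k => ?_, ?_, ?_⟩
    · simp only [PiLp.zero_apply, sub_zero]
      split_ifs
      · rw [abs_mul, hs]; norm_num
      · rw [abs_mul, ht]; norm_num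
      · norm_num
    · simp only [mem_ofPred_eq, if_true]
      nlinarith
    · simp only [mem_ofPred_eq, hij.symm, if_false, if_true]
      nlinarith
  refine ((hU.measure_pos volume hne).trans_le (measure_mono ?_)).ne'
  rintro z ⟨h1, h2, h3⟩
  exact ⟨⟨h1, le_of_lt h2⟩, ⟨h1, le_of_lt h3⟩⟩

/-- This is the advantage of cubes over balls: the annulus is covered by `2 n` convex pieces lying
inside it, and the convex Poincaré inequality applies to each. -/
lemma annulus_subset_iUnion_slab :
    (cube (0 : Euc n) 2 \ cube 0 1) ⊆ ⋃ p : Fin n × Bool, slab p.1 (if p.2 then 1 else -1) := by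
  rintro z ⟨hz, h1⟩
  simp only [cube, mem_ofPred_eq, not_forall, not_lt, PiLp.zero_apply, sub_zero] at h1
  obtain ⟨i, hi⟩ := h1
  rw [mem_iUnion]
  rcases le_abs.1 hi with h | h
  · exact ⟨(i, true), hz, by simpa using h⟩
  · exact ⟨(i, false), hz, by simpa using h⟩

/-- The Poincaré inequality on a cubical annulus. -/
lemma poincarePair_annulus (hn : 2 ≤ n) :
    PoincarePair (cube (0 : Euc n) 2 \ cube 0 1) (cube 0 2 \ cube 0 1) (cube 0 2 \ cube 0 1) := by
  have hn1 : 1 ≤ n := by omega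
  let V : Set (Euc n) := cube 0 2 \ cube 0 1
  have hself : ∀ (i : Fin n) (s : ℝ), |s| = 1 → PoincarePair (slab i s) (slab i s) V := by
    intro i s hs
    exact PoincarePair.of_convex hn1 (convex_slab i s) (measurableSet_slab i s)
      ((slab_subset_cube i s).trans (cube_subset_closedBall 0 2))
      (slab_subset_annulus i hs)
  have hfin : ∀ (i : Fin n) (s : ℝ), volume (slab i s) ≠ ⊤ := fun i s =>
    ((measure_mono (slab_subset_cube i s)).trans_lt
      (volume_cube_ne_top 0 2).lt_top).ne
  have hne : ∀ (i j : Fin n), i ≠ j → ∀ s t : ℝ, |s| = 1 → |t| = 1 →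
      PoincarePair (slab i s) (slab j t) V := by
    intro i j hij s t hs ht
    refine PoincarePair.trans ((hself i s hs).mono le_rfl inter_subset_left)
      ((hself j t ht).mono inter_subset_right le_rfl)
      (volume_slab_inter_slab_ne_zero hij hs ht) ?_ (hfin i s) (hfin j t)
    exact ((measure_mono inter_subset_left).trans_lt (hfin i s).lt_top).ne
  have hall : ∀ (i j : Fin n) (s t : ℝ), |s| = 1 → |t| = 1 →
      PoincarePair (slab i s) (slab j t) V := by
    intro i j s t hs ht
    by_cases hij : i = j
    · subst hij
      have : Nontrivial (Fin n) := Fin.nontrivial_iff_two_le.2 hn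
      -- Two slabs in the same coordinate direction may be disjoint, but both overlap a slab in
      -- another direction `k`; this is where `n ≥ 2` makes the annulus connected.
      obtain ⟨k, hk⟩ := exists_ne i
      refine PoincarePair.trans (hne i k hk.symm s 1 hs (by simp)) (hne k i hk 1 t (by simp) ht)
        ?_ (hfin k 1) (hfin i s) (hfin i t)
      intro h0
      refine volume_slab_inter_slab_ne_zero hk (s := 1) (t := 1) (by simp) (by simp) ?_
      exact measure_mono_null inter_subset_left h0
    · exact hne i j hij s t hs ht
  exact (PoincarePair.iUnion (S := fun p : Fin n × Bool => slab p.1 (if p.2 then 1 else -1))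
    fun p q => hall _ _ _ _ (by split_ifs <;> simp) (by split_ifs <;> simp)).mono
    annulus_subset_iUnion_slab annulus_subset_iUnion_slab

lemma volume_annulus_ne_zero (hn : 2 ≤ n) : volume (cube (0 : Euc n) 2 \ cube 0 1) ≠ 0 := by
  intro h0
  have : Nontrivial (Fin n) := Fin.nontrivial_iff_two_le.2 hn
  obtain ⟨k, hk⟩ := exists_ne (⟨0, by omega⟩ : Fin n)
  refine volume_slab_inter_slab_ne_zero hk (s := 1) (t := 1) (by simp) (by simp) ?_
  exact measure_mono_null (inter_subset_left.trans (slab_subset_annulus k (by simp))) h0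

/-- The constant `c` is the value of `u` at a point where the inner integral of the mean oscillation
does not exceed its average. -/
lemma exists_annulus_poincare (hn : 2 ≤ n) :
    ∃ C : ENNReal, C ≠ ⊤ ∧ ∀ (u : Euc n → ℝ) (g : Euc n → (Euc n →L[ℝ] ℝ)), WeakGrad u g →
      ∃ c : ℝ, ∫⁻ x in cube 0 2 \ cube 0 1, ‖u x - c‖ₑ ^ n ≤
        C * ∫⁻ x in cube 0 2 \ cube 0 1, ‖g x‖ₑ ^ n := by
  obtain ⟨C, hC, hp⟩ := poincarePair_annulus hn
  set V : Set (Euc n) := cube 0 2 \ cube 0 1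
  have hV0 : volume V ≠ 0 := volume_annulus_ne_zero hn
  have hVt : volume V ≠ ⊤ :=
    ((measure_mono sdiff_subset).trans_lt (volume_cube_ne_top 0 2).lt_top).ne
  refine ⟨(volume V)⁻¹ * C, ENNReal.mul_ne_top (ENNReal.inv_ne_top.2 hV0) hC, fun u g hu => ?_⟩
  obtain ⟨x, -, hx⟩ := exists_le_setLAverage (μ := volume) hV0 hVt
    (f := fun x => ∫⁻ y in V, ‖u x - u y‖ₑ ^ n)
    (measurable_enorm_sub_pow hu.cont).lintegral_prod_right'.aemeasurable
  refine ⟨u x, ?_⟩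
  simp only [enorm_sub_rev _ (u x)]
  refine hx.trans ?_
  rw [setLAverage_eq, ENNReal.div_eq_inv_mul, mul_assoc]
  gcongr
  exact hp u g hu

/-! ### Hole filling for quasiregular families -/

/-- The dilatation condition `|gⱼ|ⁿ ≤ K det g` almost everywhere in `V`. -/
def QRFamily (K : ℝ) (V : Set (Euc n)) (g : Fin n → Euc n → (Euc n →L[ℝ] ℝ)) : Prop :=
  ∀ᵐ x ∂(volume.restrict V), ∀ j, ‖g j x‖ ^ n ≤ K * rowDet fun i => g i x

/-- The `n`-energy of a family of gradients on `V`. -/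
noncomputable def energy (g : Fin n → Euc n → (Euc n →L[ℝ] ℝ)) (V : Set (Euc n)) : ENNReal :=
  ∫⁻ x in V, ∑ j, ‖g j x‖ₑ ^ n

lemma QRFamily.mono {K : ℝ} {V W : Set (Euc n)} {g : Fin n → Euc n → (Euc n →L[ℝ] ℝ)}
    (h : QRFamily K V g) (hW : W ⊆ V) : QRFamily K W g :=
  ae_mono (Measure.restrict_mono hW le_rfl) h

lemma energy_mono (g : Fin n → Euc n → (Euc n →L[ℝ] ℝ)) {V W : Set (Euc n)} (hW : W ⊆ V) :
    energy g W ≤ energy g V := lintegral_mono_set hW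

lemma lintegral_le_energy (g : Fin n → Euc n → (Euc n →L[ℝ] ℝ)) (V : Set (Euc n)) (j : Fin n) :
    ∫⁻ x in V, ‖g j x‖ₑ ^ n ≤ energy g V :=
  lintegral_mono fun x => Finset.single_le_sum (f := fun j => ‖g j x‖ₑ ^ n)
    (fun _ _ => zero_le) (Finset.mem_univ j)

lemma prod_le_sum_pow (hn : 1 ≤ n) {b : Fin n → ℝ} (hb : ∀ j, 0 ≤ b j) :
    ∏ j, b j ≤ ∑ j, b j ^ n := by
  have : Nonempty (Fin n) := ⟨⟨0, hn⟩⟩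
  obtain ⟨i, -, hi⟩ := Finset.exists_max_image Finset.univ b Finset.univ_nonempty
  calc ∏ j, b j ≤ ∏ _j : Fin n, b i := Finset.prod_le_prod (fun j _ => hb j) hi
    _ = b i ^ n := by simp
    _ ≤ ∑ j, b j ^ n := Finset.single_le_sum (f := fun j => b j ^ n)
        (fun j _ => pow_nonneg (hb j) n) (Finset.mem_univ i)

lemma prod_norm_update (a : Fin n → (Euc n →L[ℝ] ℝ)) (i : Fin n) (b : Euc n →L[ℝ] ℝ) :
    ∏ j, ‖Function.update a i b j‖ = ‖b‖ * ∏ j ∈ Finset.univ.erase i, ‖a j‖ := by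
  rw [← Finset.mul_prod_erase _ _ (Finset.mem_univ i), Function.update_self]
  congr 1
  refine Finset.prod_congr rfl fun j hj => ?_
  rw [Function.update_of_ne (Finset.ne_of_mem_erase hj)]

/-- After Hadamard, `|s|` and the `n - 1` remaining norms are `n` factors, whose product is at most
the sum of their `n`-th powers. -/
lemma abs_mul_rowDet_update_le (hn : 1 ≤ n) (a : Fin n → (Euc n →L[ℝ] ℝ)) (i : Fin n)
    (b : Euc n →L[ℝ] ℝ) (s : ℝ) :
    |s * rowDet (Function.update a i b)| ≤ ‖b‖ * (|s| ^ n + ∑ j, ‖a j‖ ^ n) := by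
  rw [abs_mul]
  have h1 := abs_rowDet_le (Function.update a i b)
  rw [prod_norm_update] at h1
  have h2 : |s| * ∏ j ∈ Finset.univ.erase i, ‖a j‖ ≤ |s| ^ n + ∑ j, ‖a j‖ ^ n := by
    have h3 := prod_le_sum_pow hn (b := Function.update (fun j => ‖a j‖) i |s|) (by
      intro j
      by_cases hj : j = i
      · subst hj; simp
      · simp [hj])
    rw [← Finset.mul_prod_erase _ _ (Finset.mem_univ i), Function.update_self,
      ← Finset.add_sum_erase _ _ (Finset.mem_univ i), Function.update_self] at h3
    have e1 : ∏ j ∈ Finset.univ.erase i, Function.update (fun j => ‖a j‖) i |s| j =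
        ∏ j ∈ Finset.univ.erase i, ‖a j‖ := by
      refine Finset.prod_congr rfl fun j hj => ?_
      rw [Function.update_of_ne (Finset.ne_of_mem_erase hj)]
    have e2 : ∑ j ∈ Finset.univ.erase i, Function.update (fun j => ‖a j‖) i |s| j ^ n =
        ∑ j ∈ Finset.univ.erase i, ‖a j‖ ^ n := by
      refine Finset.sum_congr rfl fun j hj => ?_
      rw [Function.update_of_ne (Finset.ne_of_mem_erase hj)]
    rw [e1, e2] at h3
    refine h3.trans ?_
    gcongr
    exact Finset.erase_subset _ _
  calc |s| * |rowDet (Function.update a i b)|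
      ≤ |s| * (‖b‖ * ∏ j ∈ Finset.univ.erase i, ‖a j‖) := by gcongr
    _ = ‖b‖ * (|s| * ∏ j ∈ Finset.univ.erase i, ‖a j‖) := by ring
    _ ≤ _ := by gcongr

/-- A cutoff function for `cube 0 1` in `cube 0 2`. -/
lemma exists_cube_cutoff (n : ℕ) :
    ∃ (φ : Euc n → ℝ) (C : ℝ), ContDiff ℝ ∞ φ ∧ HasCompactSupport φ ∧ (∀ x, 0 ≤ φ x) ∧
      (∀ x, φ x ≤ 1) ∧ 0 ≤ C ∧ (∀ x, ‖fderiv ℝ φ x‖ ≤ C) ∧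
      (∀ x ∈ cube 0 1, φ x = 1 ∧ fderiv ℝ φ x = 0) ∧
      (∀ x ∉ cube 0 2, φ x = 0 ∧ fderiv ℝ φ x = 0) := by
  let b : ContDiffBump (0 : ℝ) := ⟨1, 3 / 2, one_pos, by norm_num⟩
  let φ : Euc n → ℝ := fun z => ∏ i, b (z i)
  have hφ : ContDiff ℝ ∞ φ := by
    refine contDiff_prod fun i _ => b.contDiff.comp ?_
    exact (EuclideanSpace.proj i : Euc n →L[ℝ] ℝ).contDiff
  have hsupp : Function.support φ ⊆ {z | ∀ i, |z i| ≤ 3 / 2} := by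
    intro z hz i
    by_contra h
    refine hz (Finset.prod_eq_zero (Finset.mem_univ i) (b.zero_of_le_dist ?_))
    rw [Real.dist_eq, sub_zero]
    exact (not_le.1 h).le
  have hclosed : IsClosed {z : Euc n | ∀ i, |z i| ≤ 3 / 2} := by
    simp only [ofPred_forall]
    refine isClosed_iInter fun i => isClosed_le ?_ continuous_const
    fun_prop
  have htsupp : tsupport φ ⊆ cube 0 2 := by
    refine (closure_minimal hsupp hclosed).trans fun z hz i => ?_
    have := hz i
    simp only [PiLp.zero_apply, sub_zero]
    linarith
  have hc : HasCompactSupport φ := by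
    refine HasCompactSupport.of_support_subset_isCompact
      (isCompact_closedBall (0 : Euc n) (√n * 2)) ?_
    exact (subset_tsupport φ).trans (htsupp.trans (cube_subset_closedBall 0 2))
  have hone : ∀ x ∈ cube (0 : Euc n) 1, φ x = 1 := by
    intro x hx
    refine Finset.prod_eq_one fun i _ => b.one_of_mem_closedBall ?_
    have := (hx i).le
    simpa [Real.dist_eq] using this
  obtain ⟨C, hC⟩ := (hφ.continuous_fderiv (by simp)).norm.bddAbove_range_of_hasCompactSupport
    (hc.fderiv ℝ).norm
  refine ⟨φ, max C 0, hφ, hc, fun x => Finset.prod_nonneg fun i _ => b.nonneg,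
    fun x => Finset.prod_le_one (fun i _ => b.nonneg) fun i _ => b.le_one, le_max_right _ _,
    fun x => (hC ⟨x, rfl⟩).trans (le_max_left _ _), fun x hx => ⟨hone x hx, ?_⟩,
    fun x hx => ⟨image_eq_zero_of_notMem_tsupport fun h => hx (htsupp h), ?_⟩⟩
  · have : φ =ᶠ[nhds x] fun _ => 1 :=
      Filter.eventually_of_mem ((isOpen_cube 0 1).mem_nhds hx) hone
    rw [this.fderiv_eq]
    simp
  · by_contra h
    exact hx (htsupp (support_fderiv_subset ℝ h))

lemma rowDet_nonneg_of_qr {K : ℝ} (hn : 1 ≤ n) (hK : 0 < K) {a : Fin n → (Euc n →L[ℝ] ℝ)}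
    (h : ∀ j, ‖a j‖ ^ n ≤ K * rowDet a) : 0 ≤ rowDet a := by
  have := (pow_nonneg (norm_nonneg (a ⟨0, hn⟩)) n).trans (h ⟨0, hn⟩)
  exact nonneg_of_mul_nonneg_right this hK

lemma sum_pow_le_of_qr {K : ℝ} {a : Fin n → (Euc n →L[ℝ] ℝ)}
    (h : ∀ j, ‖a j‖ ^ n ≤ K * rowDet a) : ∑ j, ‖a j‖ ^ n ≤ n * K * rowDet a := by
  refine (Finset.sum_le_sum fun j _ => h j).trans_eq ?_
  simp [mul_assoc]

lemma ofReal_sum_pow (a : Fin n → (Euc n →L[ℝ] ℝ)) :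
    ENNReal.ofReal (∑ j, ‖a j‖ ^ n) = ∑ j, ‖a j‖ₑ ^ n := by
  rw [ENNReal.ofReal_sum_of_nonneg fun _ _ => by positivity]
  refine Finset.sum_congr rfl fun j _ => ?_
  rw [ENNReal.ofReal_pow (norm_nonneg _), ofReal_norm]

/-- The Caccioppoli inequality on the unit cube. -/
lemma energy_cube_le (hn : 1 ≤ n) {K : ℝ} (hK : 0 < K) :
    ∃ C : ENNReal, C ≠ ⊤ ∧ ∀ (u : Fin n → Euc n → ℝ) (g : Fin n → Euc n → (Euc n →L[ℝ] ℝ)),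
      (∀ j, WeakGrad (u j) (g j)) → QRFamily K (cube 0 2) g → ∀ (i : Fin n) (c : ℝ),
      energy g (cube 0 1) ≤ C * ∫⁻ x in cube 0 2 \ cube 0 1,
        (‖u i x - c‖ₑ ^ n + ∑ j, ‖g j x‖ₑ ^ n) := by
  obtain ⟨φ, D, hφ, hφc, hφ0, hφ1, hD, hφD, hφin, hφout⟩ := exists_cube_cutoff n
  refine ⟨ENNReal.ofReal (n * K * D), ENNReal.ofReal_ne_top, fun u g h hqr i c => ?_⟩
  -- Subtracting `c` from one component leaves all gradients unchanged, so integration by parts may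
  -- be done with `u i - c`; this prepares the use of the Poincaré inequality.
  have hfam : ∀ j, WeakGrad (Function.update u i (fun x => u i x - c) j) (g j) := by
    intro j
    by_cases hj : j = i
    · subst hj; simpa using (h j).sub_const hn c
    · simpa [hj] using h j
  obtain ⟨hI1, hI2, hIBP⟩ := integral_mul_rowDet hn _ g hfam hφ hφc i
  simp only [Function.update_self] at hI2 hIBP
  have hQ2 : MeasurableSet (cube (0 : Euc n) 2) := (isOpen_cube 0 2).measurableSet
  have hA : MeasurableSet (cube (0 : Euc n) 2 \ cube 0 1) :=
    hQ2.diff (isOpen_cube 0 1).measurableSet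
  have hqr' : ∀ᵐ x, x ∈ cube (0 : Euc n) 2 →
      ∀ j, ‖g j x‖ ^ n ≤ K * rowDet fun i => g i x := (ae_restrict_iff' hQ2).1 hqr
  have hnn : ∀ᵐ x, 0 ≤ φ x * rowDet (fun j => g j x) := by
    filter_upwards [hqr'] with x hx
    by_cases hx2 : x ∈ cube (0 : Euc n) 2
    · exact mul_nonneg (hφ0 x) (rowDet_nonneg_of_qr hn hK (hx hx2))
    · rw [(hφout x hx2).1, zero_mul]
  calc energy g (cube 0 1)
      = ∫⁻ x, (cube 0 1).indicator (fun x => ∑ j, ‖g j x‖ₑ ^ n) x :=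
        (lintegral_indicator (isOpen_cube 0 1).measurableSet _).symm
    _ ≤ ∫⁻ x, ENNReal.ofReal (n * K) * ENNReal.ofReal (φ x * rowDet (fun j => g j x)) := by
        refine lintegral_mono_ae ?_
        filter_upwards [hqr'] with x hx
        by_cases hx1 : x ∈ cube (0 : Euc n) 1
        · have hx2 : x ∈ cube (0 : Euc n) 2 := fun i => (hx1 i).trans one_lt_two
          rw [indicator_of_mem hx1, (hφin x hx1).1, one_mul, ← ENNReal.ofReal_mul (by positivity),
            ← ofReal_sum_pow]
          exact ENNReal.ofReal_le_ofReal (sum_pow_le_of_qr (hx hx2))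
        · rw [indicator_of_notMem hx1]
          exact zero_le
    _ = ENNReal.ofReal (n * K) * ENNReal.ofReal (∫ x, φ x * rowDet (fun j => g j x)) := by
        rw [lintegral_const_mul' _ _ ENNReal.ofReal_ne_top,
          ofReal_integral_eq_lintegral_ofReal hI1 hnn]
    _ ≤ ENNReal.ofReal (n * K) * ∫⁻ x, ‖(u i x - c) *
          rowDet (Function.update (fun j => g j x) i (fderiv ℝ φ x))‖ₑ := by
        gcongr
        rw [hIBP]
        refine (ENNReal.ofReal_le_ofReal (neg_le_abs _)).trans ?_
        rw [← Real.enorm_eq_ofReal_abs]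
        exact enorm_integral_le_lintegral_enorm _
    _ ≤ ENNReal.ofReal (n * K) * ∫⁻ x, (cube 0 2 \ cube 0 1).indicator (fun x =>
          ENNReal.ofReal D * (‖u i x - c‖ₑ ^ n + ∑ j, ‖g j x‖ₑ ^ n)) x := by
        gcongr with x
        by_cases hx : x ∈ cube (0 : Euc n) 2 \ cube 0 1
        · rw [indicator_of_mem hx, ← ofReal_sum_pow, Real.enorm_eq_ofReal_abs,
            Real.enorm_eq_ofReal_abs, ← ENNReal.ofReal_pow (abs_nonneg _),
            ← ENNReal.ofReal_add (by positivity) (by positivity), ← ENNReal.ofReal_mul hD]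
          apply ENNReal.ofReal_le_ofReal
          refine (abs_mul_rowDet_update_le hn _ i _ _).trans ?_
          gcongr
          exact hφD x
        -- The cutoff is constant on the inner cube and zero outside the outer one, so only the
        -- annulus contributes.
        · have : fderiv ℝ φ x = 0 := by
            by_cases hx2 : x ∈ cube (0 : Euc n) 2
            · have hx1 : x ∈ cube (0 : Euc n) 1 := by
                by_contra h1; exact hx ⟨hx2, h1⟩
              exact (hφin x hx1).2
            · exact (hφout x hx2).2
          rw [rowDet_eq_zero_of_row (i := i) (by simpa using this)]
          simp
    _ = _ := by
        rw [lintegral_indicator hA, lintegral_const_mul' _ _ ENNReal.ofReal_ne_top, ← mul_assoc,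
          ← ENNReal.ofReal_mul (by positivity)]

/-- Decay of the energy on the unit cube. -/
lemma exists_energy_decay_unit (hn : 2 ≤ n) {K : ℝ} (hK : 0 < K) :
    ∃ θ : NNReal, θ < 1 ∧ ∀ (u : Fin n → Euc n → ℝ) (g : Fin n → Euc n → (Euc n →L[ℝ] ℝ)),
      (∀ j, WeakGrad (u j) (g j)) → QRFamily K (cube 0 2) g →
      energy g (cube 0 1) ≤ θ * energy g (cube 0 2) := by
  have hn1 : 1 ≤ n := by omega
  obtain ⟨C, hC, hcac⟩ := energy_cube_le hn1 hK (n := n)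
  obtain ⟨P, hP, hpoi⟩ := exists_annulus_poincare hn
  lift C to NNReal using hC
  lift P to NNReal using hP
  -- Hole filling: Caccioppoli and Poincaré bound the inner energy by `M` times the annular energy.
  -- Adding `M` times the inner energy to both sides gives the contraction factor `M / (1 + M) < 1`.
  let M : NNReal := C * (P + 1)
  refine ⟨M / (1 + M), (div_lt_one (by positivity)).2 (by simp), fun u g h hqr => ?_⟩
  let i₀ : Fin n := ⟨0, hn1⟩
  set A : Set (Euc n) := cube 0 2 \ cube 0 1
  have hA : MeasurableSet A :=
    (isOpen_cube 0 2).measurableSet.diff (isOpen_cube 0 1).measurableSet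
  obtain ⟨c, hc⟩ := hpoi (u i₀) (g i₀) (h i₀)
  have hsplit : energy g (cube 0 2) = energy g (cube 0 1) + energy g A := by
    have h12 : cube (0 : Euc n) 1 ⊆ cube 0 2 := fun x hx i => (hx i).trans one_lt_two
    have := lintegral_inter_add_sdiff (μ := volume) (fun x => ∑ j, ‖g j x‖ₑ ^ n) (cube (0 : Euc n) 2)
      (isOpen_cube (0 : Euc n) 1).measurableSet
    rw [inter_eq_self_of_subset_right h12] at this
    exact this.symm
  have hmain : energy g (cube 0 1) ≤ M * energy g A := by
    refine (hcac u g h hqr i₀ c).trans ?_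
    have hmeas : Measurable fun x => ‖u i₀ x - c‖ₑ ^ n :=
      ((ENNReal.continuous_pow n).comp ((h i₀).cont.sub continuous_const).enorm).measurable
    rw [lintegral_add_left hmeas]
    calc (C : ENNReal) * ((∫⁻ x in A, ‖u i₀ x - c‖ₑ ^ n) + ∫⁻ x in A, ∑ j, ‖g j x‖ₑ ^ n)
        ≤ C * (P * energy g A + energy g A) := by
          gcongr
          · exact hc.trans (by gcongr; exact lintegral_le_energy g A i₀)
          · exact le_rfl
      _ = M * energy g A := by
          simp only [M]; push_cast; ring
  rw [ENNReal.coe_div (by positivity), ENNReal.mul_comm_div, ← mul_div_assoc,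
    ENNReal.le_div_iff_mul_le (Or.inl (by simp)) (Or.inl ENNReal.coe_ne_top), hsplit]
  push_cast
  calc energy g (cube 0 1) * (1 + M) = energy g (cube 0 1) + M * energy g (cube 0 1) := by ring
    _ ≤ M * energy g A + M * energy g (cube 0 1) := by gcongr
    _ = M * (energy g (cube 0 1) + energy g A) := by ring

/-! ### Scaling of cubes, energies and dilatation conditions. -/

lemma preimage_cube (y : Euc n) {ρ : ℝ} (hρ : 0 < ρ) (r : ℝ) :
    (fun z : Euc n => y + ρ • z) ⁻¹' cube y (ρ * r) = cube 0 r := by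
  ext z
  refine forall_congr' fun i => ?_
  simp only [PiLp.add_apply, PiLp.smul_apply, add_sub_cancel_left, smul_eq_mul, abs_mul,
    abs_of_pos hρ, PiLp.zero_apply, sub_zero]
  exact mul_lt_mul_iff_right₀ hρ

lemma volume_cube (y : Euc n) {ρ : ℝ} (hρ : 0 < ρ) :
    volume (cube y ρ) = ENNReal.ofReal (ρ ^ n) * volume (cube (0 : Euc n) 1) := by
  have h1 := preimage_cube y hρ 1
  rw [mul_one] at h1
  rw [← h1, ← Measure.map_apply (by fun_prop) (isOpen_cube y ρ).measurableSet,
    map_add_smul_volume y hρ, Measure.smul_apply, smul_eq_mul, ← mul_assoc,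
    ← ENNReal.ofReal_mul (by positivity), mul_inv_cancel₀ (by positivity), ENNReal.ofReal_one,
    one_mul]

lemma rowDet_smul (c : ℝ) (a : Fin n → (Euc n →L[ℝ] ℝ)) :
    rowDet (fun i => c • a i) = c ^ n * rowDet a := by
  have := Matrix.det_smul (Matrix.of fun i j => a i (EuclideanSpace.single j 1)) c
  rw [Fintype.card_fin] at this
  exact this

/-- Scale invariance of the `n`-energy: the factor `ρ ^ n` from the gradients cancels the Jacobian
of the dilation. Hence the decay factor found on the unit cube serves all scales. -/
lemma energy_comp_add_smul (g : Fin n → Euc n → (Euc n →L[ℝ] ℝ)) (y : Euc n) {ρ : ℝ}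
    (hρ : 0 < ρ) (r : ℝ) :
    energy (fun j z => ρ • g j (y + ρ • z)) (cube 0 r) = energy g (cube y (ρ * r)) := by
  have hcube : ∀ z, z ∈ cube (0 : Euc n) r ↔ y + ρ • z ∈ cube y (ρ * r) := by
    intro z; rw [← preimage_cube y hρ r]; rfl
  rw [energy, energy, ← lintegral_indicator (isOpen_cube _ _).measurableSet,
    ← lintegral_indicator (isOpen_cube _ _).measurableSet]
  calc ∫⁻ z, (cube 0 r).indicator (fun z => ∑ j, ‖ρ • g j (y + ρ • z)‖ₑ ^ n) z
      = ∫⁻ z, ENNReal.ofReal (ρ ^ n) *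
          ((cube y (ρ * r)).indicator (fun x => ∑ j, ‖g j x‖ₑ ^ n)) (y + ρ • z) := by
        congr 1; ext z
        by_cases hz : z ∈ cube (0 : Euc n) r
        · rw [indicator_of_mem hz, indicator_of_mem ((hcube z).1 hz), Finset.mul_sum]
          refine Finset.sum_congr rfl fun j _ => ?_
          rw [enorm_smul, mul_pow, Real.enorm_of_nonneg hρ.le, ENNReal.ofReal_pow hρ.le]
        · rw [indicator_of_notMem hz, indicator_of_notMem (fun h => hz ((hcube z).2 h)), mul_zero]
    _ = _ := by
        rw [lintegral_const_mul' _ _ ENNReal.ofReal_ne_top, lintegral_comp_add_smul _ _ hρ,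
          ← mul_assoc, ← ENNReal.ofReal_mul (by positivity), mul_inv_cancel₀ (by positivity),
          ENNReal.ofReal_one, one_mul]

lemma ae_comp_add_smul {p : Euc n → Prop} (hp : ∀ᵐ x, p x) (y : Euc n) {ρ : ℝ} (hρ : 0 < ρ) :
    ∀ᵐ z, p (y + ρ • z) := by
  refine ae_of_ae_map (μ := volume) (f := fun z : Euc n => y + ρ • z) (by fun_prop) ?_
  rw [map_add_smul_volume y hρ]
  exact Measure.ae_smul_measure hp _

lemma QRFamily.comp_add_smul {K : ℝ} {g : Fin n → Euc n → (Euc n →L[ℝ] ℝ)} {y : Euc n} {ρ r : ℝ}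
    (hρ : 0 < ρ) (h : QRFamily K (cube y (ρ * r)) g) :
    QRFamily K (cube 0 r) (fun j z => ρ • g j (y + ρ • z)) := by
  have h1 := (ae_restrict_iff' (isOpen_cube y (ρ * r)).measurableSet).1 h
  refine (ae_restrict_iff' (isOpen_cube 0 r).measurableSet).2 ?_
  filter_upwards [ae_comp_add_smul h1 y hρ] with z hz hzc j
  rw [← preimage_cube y hρ r] at hzc
  rw [rowDet_smul, norm_smul, mul_pow, Real.norm_of_nonneg hρ.le]
  calc ρ ^ n * ‖g j (y + ρ • z)‖ ^ n ≤ ρ ^ n * (K * rowDet fun i => g i (y + ρ • z)) := by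
        gcongr; exact hz hzc j
    _ = _ := by ring

/-- Decay of the energy on all cubes. -/
lemma exists_energy_decay (hn : 2 ≤ n) {K : ℝ} (hK : 0 < K) :
    ∃ θ : NNReal, θ < 1 ∧ ∀ (u : Fin n → Euc n → ℝ) (g : Fin n → Euc n → (Euc n →L[ℝ] ℝ)),
      (∀ j, WeakGrad (u j) (g j)) → ∀ (y : Euc n) (r : ℝ), 0 < r → QRFamily K (cube y r) g →
      ∀ k : ℕ, energy g (cube y (r * (1 / 2) ^ k)) ≤ θ ^ k * energy g (cube y r) := by
  obtain ⟨θ, hθ, hdec⟩ := exists_energy_decay_unit hn hK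
  refine ⟨θ, hθ, fun u g h y r hr hqr k => ?_⟩
  induction k with
  | zero => simp
  | succ k ih =>
    set ρ : ℝ := r * (1 / 2) ^ (k + 1)
    have hρ : 0 < ρ := by positivity
    have hρ2 : ρ * 2 = r * (1 / 2) ^ k := by simp only [ρ, pow_succ]; ring
    have hle : ρ * 2 ≤ r := by
      rw [hρ2]
      exact mul_le_of_le_one_right hr.le (pow_le_one₀ (by norm_num) (by norm_num))
    have hqr' : QRFamily K (cube y (ρ * 2)) g :=
      hqr.mono fun z hz i => (hz i).trans_le hle
    have := hdec _ _ (fun j => (h j).comp_add_smul y hρ) (hqr'.comp_add_smul hρ)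
    rw [energy_comp_add_smul g y hρ, energy_comp_add_smul g y hρ, mul_one, hρ2] at this
    refine this.trans ?_
    rw [pow_succ', mul_assoc]
    gcongr

/-! ### Averages over cubes and the modulus of continuity of quasiregular families -/

lemma integrableOn_cube {u : Euc n → ℝ} (hu : Continuous u) (y : Euc n) (r : ℝ) :
    IntegrableOn u (cube y r) :=
  (hu.continuousOn.integrableOn_compact (isCompact_closedBall y (√n * r))).mono_set
    (cube_subset_closedBall y r)

/-- The difference of two averages is controlled by the mean oscillation. -/
lemma enorm_average_sub_pow_le (hn : 1 ≤ n) {u : Euc n → ℝ} (hu : Continuous u)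
    (y z : Euc n) {r s : ℝ} (hr : 0 < r) (hs : 0 < s) :
    ‖(⨍ x in cube y r, u x) - ⨍ x in cube z s, u x‖ₑ ^ n ≤
      (volume (cube y r))⁻¹ * ((volume (cube z s))⁻¹ * meanOsc u (cube y r) (cube z s)) := by
  set S := cube y r
  set T := cube z s
  have hS0 : volume S ≠ 0 := volume_cube_ne_zero y hr
  have hT0 : volume T ≠ 0 := volume_cube_ne_zero z hs
  have hSt : volume S ≠ ⊤ := volume_cube_ne_top y r
  have hTt : volume T ≠ ⊤ := volume_cube_ne_top z s
  let ν : Measure (Euc n) := (volume S)⁻¹ • volume.restrict S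
  let κ : Measure (Euc n) := (volume T)⁻¹ • volume.restrict T
  have hν : IsProbabilityMeasure ν := ⟨by simp [ν, ENNReal.inv_mul_cancel hS0 hSt]⟩
  have hκ : IsProbabilityMeasure κ := ⟨by simp [κ, ENNReal.inv_mul_cancel hT0 hTt]⟩
  have hiν : Integrable u ν := (integrableOn_cube hu y r).smul_measure (ENNReal.inv_ne_top.2 hS0)
  have hiκ : Integrable u κ := (integrableOn_cube hu z s).smul_measure (ENNReal.inv_ne_top.2 hT0)
  have hi1 : Integrable (fun p : Euc n × Euc n => u p.1) (ν.prod κ) := hiν.comp_fst κ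
  have hi2 : Integrable (fun p : Euc n × Euc n => u p.2) (ν.prod κ) := hiκ.comp_snd ν
  have hm := measurable_enorm_sub_pow hu
  have hm1 : Measurable fun p : Euc n × Euc n => ‖u p.1 - u p.2‖ₑ :=
    ((hu.comp continuous_fst).sub (hu.comp continuous_snd)).enorm.measurable
  have heq : (⨍ x in S, u x) - ⨍ x in T, u x = ∫ p, (u p.1 - u p.2) ∂(ν.prod κ) := by
    rw [integral_sub hi1 hi2, integral_fun_fst, integral_fun_snd]
    simp only [average, Measure.restrict_apply MeasurableSet.univ, univ_inter, probReal_univ,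
      one_smul, ν, κ]
  calc ‖(⨍ x in S, u x) - ⨍ x in T, u x‖ₑ ^ n
      ≤ (∫⁻ p, ‖u p.1 - u p.2‖ₑ ∂(ν.prod κ)) ^ n := by
        rw [heq]; gcongr; exact enorm_integral_le_lintegral_enorm _
    _ ≤ ∫⁻ p, ‖u p.1 - u p.2‖ₑ ^ n ∂(ν.prod κ) :=
        lintegral_pow_le_of_isProbabilityMeasure _ hn hm1.aemeasurable
    _ = ∫⁻ x, ∫⁻ y, ‖u x - u y‖ₑ ^ n ∂κ ∂ν := lintegral_prod _ hm.aemeasurable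
    _ = _ := by
        simp only [ν, κ, lintegral_smul_measure, smul_eq_mul]
        rw [lintegral_const_mul' _ _ (ENNReal.inv_ne_top.2 hT0)]
        rfl

/-- In the Poincaré inequality for the exponent `n`, the powers of `r` cancel against the two
volumes used for normalization, so the constant does not depend on the scale. -/
lemma exists_average_halving (hn : 1 ≤ n) :
    ∃ C : ENNReal, C ≠ ⊤ ∧ ∀ (u : Euc n → ℝ) (g : Euc n → (Euc n →L[ℝ] ℝ)), WeakGrad u g →
      ∀ (y : Euc n) (r : ℝ), 0 < r →
      ‖(⨍ x in cube y r, u x) - ⨍ x in cube y (r / 2), u x‖ₑ ^ n ≤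
        C * ∫⁻ x in cube y r, ‖g x‖ₑ ^ n := by
  have hn' : n ≠ 0 := by omega
  set v : ENNReal := volume (cube (0 : Euc n) 1)
  have hv0 : v ≠ 0 := volume_cube_ne_zero 0 one_pos
  have hvt : v ≠ ⊤ := volume_cube_ne_top 0 1
  refine ⟨v⁻¹ * ENNReal.ofReal ((8 * √n) ^ n), ENNReal.mul_ne_top (ENNReal.inv_ne_top.2 hv0)
    ENNReal.ofReal_ne_top, fun u g h y r hr => ?_⟩
  have hr2 : 0 < r / 2 := by positivity
  have hV0 : volume (cube y r) ≠ 0 := volume_cube_ne_zero y hr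
  have hVt : volume (cube y r) ≠ ⊤ := volume_cube_ne_top y r
  refine (enorm_average_sub_pow_le hn h.cont y y hr hr2).trans ?_
  have hmono : meanOsc u (cube y r) (cube y (r / 2)) ≤ meanOsc u (cube y r) (cube y r) :=
    lintegral_mono fun x => lintegral_mono_set fun z hz i => (hz i).trans (by linarith)
  have hp := h.meanOsc_le hn (convex_cube y r) (isOpen_cube y r).measurableSet
    (cube_subset_closedBall y r)
  calc (volume (cube y r))⁻¹ * ((volume (cube y (r / 2)))⁻¹ *
        meanOsc u (cube y r) (cube y (r / 2)))
      ≤ (volume (cube y r))⁻¹ * ((volume (cube y (r / 2)))⁻¹ *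
        ((ENNReal.ofReal (2 * (√n * r)) ^ n * (volume (cube y r) * 2 ^ n)) *
          ∫⁻ x in cube y r, ‖g x‖ₑ ^ n)) := by
        gcongr
        exact hmono.trans hp
    _ = ((volume (cube y r))⁻¹ * volume (cube y r)) * ((volume (cube y (r / 2)))⁻¹ *
        (ENNReal.ofReal (2 * (√n * r)) ^ n * 2 ^ n)) * ∫⁻ x in cube y r, ‖g x‖ₑ ^ n := by ring
    _ = _ := by
        rw [ENNReal.inv_mul_cancel hV0 hVt, one_mul, volume_cube y hr2,
          ENNReal.mul_inv (Or.inr hvt) (Or.inr hv0), ← ENNReal.ofReal_inv_of_pos (by positivity)]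
        congr 1
        rw [mul_comm (ENNReal.ofReal _) v⁻¹, mul_assoc]
        congr 1
        have h2 : (2 : ENNReal) = ENNReal.ofReal 2 := by simp
        rw [h2, ← ENNReal.ofReal_pow (by positivity), ← ENNReal.ofReal_pow (by positivity),
          ← ENNReal.ofReal_mul (by positivity), ← ENNReal.ofReal_mul (by positivity)]
        congr 1
        rw [← mul_pow, ← inv_pow, ← mul_pow]
        congr 1
        field_simp
        ring

lemma norm_average_cube_sub_le {u : Euc n → ℝ} (hu : Continuous u) {y : Euc n} {r c ε : ℝ}
    (hr : 0 < r) (h : ∀ x ∈ cube y r, |u x - c| ≤ ε) : |(⨍ x in cube y r, u x) - c| ≤ ε := by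
  have := (convex_closedBall c ε).set_average_mem Metric.isClosed_closedBall
    (volume_cube_ne_zero y hr) (volume_cube_ne_top y r)
    ((ae_restrict_iff' (isOpen_cube y r).measurableSet).2 (Filter.Eventually.of_forall
      fun x hx => Metric.mem_closedBall.2 (by rw [Real.dist_eq]; exact h x hx)))
    (integrableOn_cube hu y r)
  rwa [Metric.mem_closedBall, Real.dist_eq] at this

lemma tendsto_average_cube {u : Euc n → ℝ} (hu : Continuous u) (y : Euc n) :
    Filter.Tendsto (fun k : ℕ => ⨍ x in cube y ((1 / 2) ^ k), u x) Filter.atTop (nhds (u y)) := by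
  rw [Metric.tendsto_atTop]
  intro ε hε
  obtain ⟨δ, hδ, hd⟩ := Metric.continuous_iff.1 hu y (ε / 2) (by positivity)
  have hlim : Filter.Tendsto (fun k : ℕ => √n * (1 / 2 : ℝ) ^ k) Filter.atTop (nhds (√n * 0)) :=
    (tendsto_pow_atTop_nhds_zero_of_lt_one (by norm_num) (by norm_num)).const_mul _
  rw [mul_zero] at hlim
  obtain ⟨N, hN⟩ := Filter.eventually_atTop.1 (hlim.eventually (gt_mem_nhds hδ))
  refine ⟨N, fun k hk => ?_⟩
  rw [Real.dist_eq]
  refine lt_of_le_of_lt (norm_average_cube_sub_le hu (by positivity) fun x hx => ?_)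
    (half_lt_self hε)
  have := hd x (lt_of_le_of_lt (cube_subset_closedBall y _ hx) (hN k hk))
  rw [Real.dist_eq] at this
  exact this.le

/-- The averages of a quasiregular family converge geometrically, at a rate depending only on the
energy. -/
lemma exists_average_modulus (hn : 2 ≤ n) {K : ℝ} (hK : 0 < K) :
    ∃ τ B : ℝ, 0 ≤ τ ∧ τ < 1 ∧ 0 ≤ B ∧
      ∀ (u : Fin n → Euc n → ℝ) (g : Fin n → Euc n → (Euc n →L[ℝ] ℝ)),
      (∀ j, WeakGrad (u j) (g j)) → QRFamily K (cube 0 2) g →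
      ∀ M : ℝ, 0 ≤ M → energy g (cube 0 2) ≤ ENNReal.ofReal (M ^ n) →
      ∀ y ∈ cube (0 : Euc n) 1, ∀ (k : ℕ) (j : Fin n),
        |(⨍ x in cube y ((1 / 2) ^ k), u j x) - u j y| ≤ B * M * τ ^ k := by
  have hn1 : 1 ≤ n := by omega
  have hn' : n ≠ 0 := by omega
  obtain ⟨θ, hθ, hdec⟩ := exists_energy_decay hn hK
  obtain ⟨C, hC, hhalf⟩ := exists_average_halving hn1
  lift C to NNReal using hC
  -- The energy controls the `n`-th power of the difference of consecutive averages, so decay of the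
  -- energy at rate `θ` gives decay of these differences at rate `θ ^ (1 / n)`. Summing the
  -- geometric series, whose limit is the point value by continuity, produces the factor `1 / (1 -
  -- τ)`.
  set τ : ℝ := (θ : ℝ) ^ (1 / (n : ℝ))
  set B : ℝ := (C : ℝ) ^ (1 / (n : ℝ))
  have hτ0 : 0 ≤ τ := by positivity
  have hτ1 : τ < 1 := Real.rpow_lt_one θ.2 (by exact_mod_cast hθ) (by positivity)
  have hτn : τ ^ n = θ := by
    simp only [τ, one_div]
    exact Real.rpow_inv_natCast_pow θ.2 hn'
  have hBn : B ^ n = C := by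
    simp only [B, one_div]
    exact Real.rpow_inv_natCast_pow C.2 hn'
  have hB0 : 0 ≤ B := by positivity
  refine ⟨τ, B / (1 - τ), hτ0, hτ1, div_nonneg hB0 (by linarith), fun u g h hqr M hM hE y hy k j => ?_⟩
  have hsub : cube y 1 ⊆ cube (0 : Euc n) 2 := by
    intro z hz i
    have h1 := hz i
    have h2 := hy i
    simp only [PiLp.zero_apply, sub_zero] at h2 ⊢
    calc |z i| = |(z i - y i) + y i| := by ring_nf
      _ ≤ |z i - y i| + |y i| := abs_add_le _ _
      _ < 2 := by linarith
  have hstep : ∀ m : ℕ, dist (⨍ x in cube y ((1 / 2) ^ m), u j x)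
      (⨍ x in cube y ((1 / 2) ^ (m + 1)), u j x) ≤ B * M * τ ^ m := by
    intro m
    have h1 := hhalf (u j) (g j) (h j) y ((1 / 2) ^ m) (by positivity)
    have h2 := hdec u g h y 1 one_pos (hqr.mono hsub) m
    rw [one_mul] at h2
    have h3 : ‖(⨍ x in cube y ((1 / 2) ^ m), u j x) - ⨍ x in cube y ((1 / 2) ^ m / 2), u j x‖ₑ ^ n
        ≤ ENNReal.ofReal ((B * M * τ ^ m) ^ n) := by
      refine h1.trans ?_
      have h4 : ENNReal.ofReal ((B * M * τ ^ m) ^ n) =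
          C * (θ ^ m * ENNReal.ofReal (M ^ n)) := by
        rw [mul_pow, mul_pow, hBn, ← pow_mul, mul_comm m n, pow_mul, hτn,
          ENNReal.ofReal_mul (by positivity), ENNReal.ofReal_mul (by positivity),
          ENNReal.ofReal_pow (by positivity), ENNReal.ofReal_pow (p := (θ : ℝ)) θ.2]
        simp only [ENNReal.ofReal_coe_nnreal]
        ring
      rw [h4]
      gcongr
      exact (lintegral_le_energy g _ j).trans (h2.trans (by
        gcongr
        exact (energy_mono g hsub).trans hE))
    rw [Real.enorm_eq_ofReal_abs, ← ENNReal.ofReal_pow (abs_nonneg _),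
      ENNReal.ofReal_le_ofReal_iff (by positivity), pow_le_pow_iff_left₀ (abs_nonneg _)
      (by positivity) hn'] at h3
    rw [Real.dist_eq, pow_succ, mul_one_div]
    exact h3
  have := dist_le_of_le_geometric_of_tendsto τ (B * M) hτ1 hstep
    (tendsto_average_cube (h j).cont y) k
  rw [Real.dist_eq] at this
  refine this.trans_eq ?_
  ring

/-- A quasiregular family with gradients close to constants is uniformly close to a linear map. -/
lemma exists_uniform_closeness (hn : 2 ≤ n) {K : ℝ} (hK : 0 < K) (M : ℝ) (hM : 0 ≤ M) {ε : ℝ}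
    (hε : 0 < ε) :
    ∃ δ > 0, ∀ (u : Fin n → Euc n → ℝ) (g : Fin n → Euc n → (Euc n →L[ℝ] ℝ)),
      (∀ j, WeakGrad (u j) (g j)) → QRFamily K (cube 0 2) g →
      ∀ L : Fin n → (Euc n →L[ℝ] ℝ), (∀ j, ‖L j‖ ≤ M) → (∀ j, u j 0 = 0) →
      energy (fun j x => g j x - L j) (cube 0 2) ≤ ENNReal.ofReal δ →
      ∀ y ∈ cube (0 : Euc n) 1, ∀ j, |u j y - L j y| ≤ ε := by
  have hn1 : 1 ≤ n := by omega
  have hn' : n ≠ 0 := by omega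
  obtain ⟨τ, B, hτ0, hτ1, hB, hmod⟩ := exists_average_modulus hn hK
  set v : ENNReal := volume (cube (0 : Euc n) 1)
  have hv0 : v ≠ 0 := volume_cube_ne_zero 0 one_pos
  have hvt : v ≠ ⊤ := volume_cube_ne_top 0 1
  -- A total energy bound common to all families whose gradients are within energy `1` of constants
  -- of norm at most `M`; it makes the modulus of continuity uniform.
  obtain ⟨E, hE0, hE⟩ : ∃ E : ℝ, 0 ≤ E ∧ ∀ (g : Fin n → Euc n → (Euc n →L[ℝ] ℝ))
      (L : Fin n → (Euc n →L[ℝ] ℝ)), (∀ j, AEStronglyMeasurable (g j) volume) →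
      (∀ j, ‖L j‖ ≤ M) → energy (fun j x => g j x - L j) (cube 0 2) ≤ 1 →
      energy g (cube 0 2) ≤ ENNReal.ofReal (E ^ n) := by
    set A : ENNReal := 2 ^ n * (1 + n * ENNReal.ofReal M ^ n * volume (cube (0 : Euc n) 2))
    have hA : A ≠ ⊤ := by
      refine ENNReal.mul_ne_top (ENNReal.pow_ne_top ENNReal.ofNat_ne_top)
        (ENNReal.add_ne_top.2 ⟨ENNReal.one_ne_top, ENNReal.mul_ne_top (ENNReal.mul_ne_top
        (ENNReal.natCast_ne_top n) (ENNReal.pow_ne_top ENNReal.ofReal_ne_top))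
        (volume_cube_ne_top 0 2)⟩)
    refine ⟨A.toReal ^ (1 / (n : ℝ)), by positivity, fun g L hgm hL hg => ?_⟩
    rw [one_div, Real.rpow_inv_natCast_pow ENNReal.toReal_nonneg hn', ENNReal.ofReal_toReal hA]
    calc energy g (cube 0 2)
        ≤ ∫⁻ x in cube 0 2, 2 ^ n * (∑ j, ‖g j x - L j‖ₑ ^ n + n * ENNReal.ofReal M ^ n) := by
          refine lintegral_mono fun x => ?_
          change ∑ j, ‖g j x‖ₑ ^ n ≤ _
          have : ∀ j, ‖g j x‖ₑ ^ n ≤ 2 ^ n * (‖g j x - L j‖ₑ ^ n + ENNReal.ofReal M ^ n) := by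
            intro j
            have h1 : ‖g j x‖ₑ ≤ ‖g j x - L j‖ₑ + ENNReal.ofReal M := by
              calc ‖g j x‖ₑ = ‖(g j x - L j) + L j‖ₑ := by rw [sub_add_cancel]
                _ ≤ ‖g j x - L j‖ₑ + ‖L j‖ₑ := by
                  rw [← ofReal_norm, ← ofReal_norm, ← ofReal_norm,
                    ← ENNReal.ofReal_add (norm_nonneg _) (norm_nonneg _)]
                  exact ENNReal.ofReal_le_ofReal (norm_add_le _ _)
                _ ≤ _ := by
                  gcongr
                  rw [← ofReal_norm]
                  exact ENNReal.ofReal_le_ofReal (hL j)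
            calc ‖g j x‖ₑ ^ n ≤ (2 * max ‖g j x - L j‖ₑ (ENNReal.ofReal M)) ^ n := by
                  gcongr
                  refine h1.trans ?_
                  rw [two_mul]
                  exact add_le_add (le_max_left _ _) (le_max_right _ _)
              _ ≤ _ := by
                  rw [mul_pow]
                  gcongr
                  rcases max_choice ‖g j x - L j‖ₑ (ENNReal.ofReal M) with h | h <;> rw [h]
                  · exact le_self_add
                  · exact le_add_self
          refine (Finset.sum_le_sum fun j _ => this j).trans_eq ?_
          rw [← Finset.mul_sum, Finset.sum_add_distrib]
          simp
      _ = 2 ^ n * (energy (fun j x => g j x - L j) (cube 0 2) +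
            n * ENNReal.ofReal M ^ n * volume (cube (0 : Euc n) 2)) := by
          rw [lintegral_const_mul' _ _ (ENNReal.pow_ne_top ENNReal.ofNat_ne_top),
            lintegral_add_right _ measurable_const, setLIntegral_const]
          rfl
      _ ≤ A := by
          simp only [A]
          gcongr
  -- The scale is fixed first, so that averaging `u j` and `L j` at a single point costs at most `ε
  -- / 4`. Doing so at both `y` and `0` costs `ε / 2`.
  obtain ⟨k, hk⟩ : ∃ k : ℕ, B * E * τ ^ k + M * (√n * (1 / 2) ^ k) ≤ ε / 4 := by
    have h1 : Filter.Tendsto (fun k : ℕ => B * E * τ ^ k + M * (√n * (1 / 2 : ℝ) ^ k))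
        Filter.atTop (nhds (B * E * 0 + M * (√n * 0))) :=
      ((tendsto_pow_atTop_nhds_zero_of_lt_one hτ0 hτ1).const_mul _).add
        (((tendsto_pow_atTop_nhds_zero_of_lt_one (by norm_num) (by norm_num)).const_mul _).const_mul _)
    simp only [mul_zero, add_zero] at h1
    exact ((h1.eventually (gt_mem_nhds (show (0 : ℝ) < ε / 4 by positivity))).exists).imp
      fun _ h => h.le
  set r : ℝ := (1 / 2) ^ k
  have hr : 0 < r := by positivity
  have hr1 : r ≤ 1 := pow_le_one₀ (by norm_num) (by norm_num)
  -- Comparison of averages over two small cubes inside the large one. The constant degenerates as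
  -- `r` shrinks, which is harmless because `r` is fixed before `δ`.
  obtain ⟨D, hD, hDc⟩ : ∃ D : ENNReal, D ≠ ⊤ ∧ ∀ (w : Euc n → ℝ) (b : Euc n → (Euc n →L[ℝ] ℝ)),
      WeakGrad w b → ∀ y ∈ cube (0 : Euc n) 1,
      ‖(⨍ x in cube y r, w x) - ⨍ x in cube 0 r, w x‖ₑ ^ n ≤
        D * ∫⁻ x in cube 0 2, ‖b x‖ₑ ^ n := by
    obtain ⟨P, hP, hp⟩ := PoincarePair.of_convex (n := n) hn1 (convex_cube 0 2)
      (isOpen_cube 0 2).measurableSet (cube_subset_closedBall 0 2) le_rfl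
    set V : ENNReal := ENNReal.ofReal (r ^ n) * v
    have hV0 : V ≠ 0 := by
      have := volume_cube_ne_zero (0 : Euc n) hr
      rwa [volume_cube 0 hr] at this
    refine ⟨V⁻¹ * (V⁻¹ * P), ENNReal.mul_ne_top (ENNReal.inv_ne_top.2 hV0)
      (ENNReal.mul_ne_top (ENNReal.inv_ne_top.2 hV0) hP), fun w b hw y hy => ?_⟩
    refine (enorm_average_sub_pow_le hn1 hw.cont y 0 hr hr).trans ?_
    rw [volume_cube y hr, volume_cube 0 hr, mul_assoc, mul_assoc]
    gcongr
    refine le_trans ?_ (hp w b hw)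
    have hs1 : cube y r ⊆ cube (0 : Euc n) 2 := by
      intro z hz i
      have h1 := hz i
      have h2 := hy i
      simp only [PiLp.zero_apply, sub_zero] at h2 ⊢
      calc |z i| = |(z i - y i) + y i| := by ring_nf
        _ ≤ |z i - y i| + |y i| := abs_add_le _ _
        _ < 2 := by linarith
    have hs2 : cube 0 r ⊆ cube (0 : Euc n) 2 := fun z hz i => (hz i).trans (by linarith)
    exact (lintegral_mono_set hs1).trans (lintegral_mono fun x => lintegral_mono_set hs2)
  lift D to NNReal using hD
  -- The entry `1` secures the energy bound `E`; the other keeps the averages of `u j - L j` around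
  -- `y` and around `0` within `ε / 4` of each other. As `u j` and `L j` both vanish at `0`, the
  -- total error is at most `3 ε / 4`.
  refine ⟨min 1 ((ε / 4) ^ n / (D + 1)), by positivity, fun u g h hqr L hL hu0 hg y hy j => ?_⟩
  have hg1 : energy (fun j x => g j x - L j) (cube 0 2) ≤ 1 := by
    refine hg.trans ?_
    rw [← ENNReal.ofReal_one]
    exact ENNReal.ofReal_le_ofReal (min_le_left _ _)
  have hEn := hE g L (fun j => (h j).aestronglyMeasurable hn1) hL hg1
  have hmody := hmod u g h hqr E hE0 hEn y hy k j
  have h0mem : (0 : Euc n) ∈ cube (0 : Euc n) 1 := fun i => by simp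
  have hmod0 := hmod u g h hqr E hE0 hEn 0 h0mem k j
  rw [hu0, sub_zero] at hmod0
  have hw : WeakGrad (fun x => u j x - L j x) (fun x => g j x - L j) :=
    (h j).sub hn1 (WeakGrad.linear (L j))
  have havg := hDc _ _ hw y hy
  have havg2 : |(⨍ x in cube y r, (u j x - L j x)) - ⨍ x in cube 0 r, (u j x - L j x)| ≤ ε / 4 := by
    have h1 : ‖(⨍ x in cube y r, (u j x - L j x)) - ⨍ x in cube 0 r, (u j x - L j x)‖ₑ ^ n ≤
        ENNReal.ofReal ((ε / 4) ^ n) := by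
      refine havg.trans ?_
      calc (D : ENNReal) * ∫⁻ x in cube 0 2, ‖g j x - L j‖ₑ ^ n
          ≤ D * ENNReal.ofReal ((ε / 4) ^ n / (D + 1)) := by
            gcongr
            refine (lintegral_le_energy (fun j x => g j x - L j) _ j).trans (hg.trans ?_)
            exact ENNReal.ofReal_le_ofReal (min_le_right _ _)
        _ ≤ ENNReal.ofReal ((ε / 4) ^ n) := by
            rw [← ENNReal.ofReal_coe_nnreal, ← ENNReal.ofReal_mul (by positivity)]
            apply ENNReal.ofReal_le_ofReal
            rw [mul_div_assoc', div_le_iff₀ (by positivity)]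
            have : 0 ≤ (ε / 4) ^ n := by positivity
            nlinarith
    rwa [Real.enorm_eq_ofReal_abs, ← ENNReal.ofReal_pow (abs_nonneg _),
      ENNReal.ofReal_le_ofReal_iff (by positivity), pow_le_pow_iff_left₀ (abs_nonneg _)
      (by positivity) hn'] at h1
  have hLavg : ∀ p : Euc n, |(⨍ x in cube p r, L j x) - L j p| ≤ M * (√n * r) := by
    intro p
    refine norm_average_cube_sub_le (L j).continuous hr fun x hx => ?_
    rw [← map_sub, ← Real.norm_eq_abs]
    refine ((L j).le_opNorm _).trans ?_
    gcongr
    · exact hL j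
    · rw [← dist_eq_norm]; exact cube_subset_closedBall p r hx
  have hsplit : ∀ p : Euc n, ⨍ x in cube p r, (u j x - L j x) =
      (⨍ x in cube p r, u j x) - ⨍ x in cube p r, L j x := by
    intro p
    simp only [setAverage_eq]
    rw [integral_sub (integrableOn_cube (h j).cont p r) (integrableOn_cube (L j).continuous p r),
      smul_sub]
  rw [hsplit, hsplit] at havg2
  have hLy := hLavg y
  have hL0 := hLavg 0
  rw [map_zero, sub_zero] at hL0
  rw [abs_le] at *
  constructor <;> linarith [hmody.1, hmody.2, hmod0.1, hmod0.2, havg2.1, havg2.2, hLy.1, hLy.2,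
    hL0.1, hL0.2]

/-! ### Lebesgue points of `Lⁿ` functions and differentiability almost everywhere -/

/-- The cube of half side `2` lies in the ball of radius `2 √n`, so the rescaled integral is
controlled by an average over a ball, to which Lebesgue differentiation applies. -/
lemma lintegral_cube_comp_le (hn : 1 ≤ n) {Φ : Euc n → ℝ} (h0 : ∀ y, 0 ≤ Φ y)
    (hΦ : LocallyIntegrable Φ volume) (x : Euc n) {r : ℝ} (hr : 0 < r) :
    ∫⁻ z in cube 0 2, ENNReal.ofReal (Φ (x + r • z)) ≤
      ENNReal.ofReal ((√n * 2) ^ n) * volume (Metric.ball (0 : Euc n) 1) *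
        ENNReal.ofReal (⨍ y in Metric.closedBall x (r * (√n * 2)), Φ y) := by
  have hR : 0 < √(n : ℝ) * 2 := by
    have : (0 : ℝ) < n := by exact_mod_cast hn
    positivity
  set R := √(n : ℝ) * 2
  set B := Metric.closedBall x (r * R)
  have hB : MeasurableSet B := Metric.isClosed_closedBall.measurableSet
  have hvol : volume B = ENNReal.ofReal ((r * R) ^ n) * volume (Metric.ball (0 : Euc n) 1) := by
    simp only [B]
    rw [Measure.addHaar_closedBall _ _ (by positivity)]
    simp
  have hB0 : volume B ≠ 0 := by
    rw [hvol]
    exact mul_ne_zero (by simp; positivity) (Metric.measure_ball_pos _ _ one_pos).ne'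
  have hBt : volume B ≠ ⊤ := (isCompact_closedBall x _).measure_lt_top.ne
  have hint : IntegrableOn Φ B := hΦ.integrableOn_isCompact (isCompact_closedBall x _)
  have havg : ∫⁻ y in B, ENNReal.ofReal (Φ y) = volume B * ENNReal.ofReal (⨍ y in B, Φ y) := by
    rw [← ofReal_integral_eq_lintegral_ofReal hint (Filter.Eventually.of_forall h0),
      setAverage_eq, smul_eq_mul, ENNReal.ofReal_mul (by positivity), measureReal_def,
      ENNReal.ofReal_inv_of_pos (ENNReal.toReal_pos hB0 hBt), ENNReal.ofReal_toReal hBt,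
      ← mul_assoc, ENNReal.mul_inv_cancel hB0 hBt, one_mul]
  calc ∫⁻ z in cube 0 2, ENNReal.ofReal (Φ (x + r • z))
      ≤ ∫⁻ z, B.indicator (fun y => ENNReal.ofReal (Φ y)) (x + r • z) := by
        rw [← lintegral_indicator (isOpen_cube _ _).measurableSet]
        refine lintegral_mono fun z => ?_
        by_cases hz : z ∈ cube (0 : Euc n) 2
        · have hz' : x + r • z ∈ B := by
            have h1 := mem_closedBall_zero_iff.1 (cube_subset_closedBall 0 2 hz)
            simp only [B, Metric.mem_closedBall, dist_eq_norm, add_sub_cancel_left, norm_smul,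
              Real.norm_of_nonneg hr.le]
            gcongr
          rw [indicator_of_mem hz, indicator_of_mem hz']
        · rw [indicator_of_notMem hz]; exact zero_le
    _ = ENNReal.ofReal ((r ^ n)⁻¹) * (volume B * ENNReal.ofReal (⨍ y in B, Φ y)) := by
        rw [lintegral_comp_add_smul _ _ hr, lintegral_indicator hB, havg]
    _ = _ := by
        rw [hvol, mul_pow, ENNReal.ofReal_mul (p := r ^ n) (by positivity)]
        have : ENNReal.ofReal ((r ^ n)⁻¹) * ENNReal.ofReal (r ^ n) = 1 := by
          rw [← ENNReal.ofReal_mul (by positivity), inv_mul_cancel₀ (by positivity),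
            ENNReal.ofReal_one]
        calc _ = (ENNReal.ofReal ((r ^ n)⁻¹) * ENNReal.ofReal (r ^ n)) *
              (ENNReal.ofReal (R ^ n) * volume (Metric.ball (0 : Euc n) 1) *
                ENNReal.ofReal (⨍ y in B, Φ y)) := by ring
          _ = _ := by rw [this, one_mul]

lemma enorm_sub_pow_le_add {F : Type*} [NormedAddCommGroup F] (a b q : F) (n : ℕ) :
    ‖a - b‖ₑ ^ n ≤ 2 ^ n * (ENNReal.ofReal (‖a - q‖ ^ n) + ENNReal.ofReal (‖b - q‖ ^ n)) := by
  have h1 : ‖a - b‖ ≤ 2 * max ‖a - q‖ ‖b - q‖ := by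
    calc ‖a - b‖ = ‖(a - q) - (b - q)‖ := by rw [sub_sub_sub_cancel_right]
      _ ≤ ‖a - q‖ + ‖b - q‖ := norm_sub_le _ _
      _ ≤ _ := by rw [two_mul]; exact add_le_add (le_max_left _ _) (le_max_right _ _)
  have h2 : ‖a - b‖ ^ n ≤ 2 ^ n * (‖a - q‖ ^ n + ‖b - q‖ ^ n) := by
    calc ‖a - b‖ ^ n ≤ (2 * max ‖a - q‖ ‖b - q‖) ^ n := by gcongr
      _ ≤ _ := by
        rw [mul_pow]
        gcongr
        rcases max_choice ‖a - q‖ ‖b - q‖ with h | h <;> rw [h]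
        · exact le_add_of_nonneg_right (by positivity)
        · exact le_add_of_nonneg_left (by positivity)
  rw [← ofReal_norm, ← ENNReal.ofReal_pow (norm_nonneg _),
    ← ENNReal.ofReal_add (by positivity) (by positivity)]
  refine (ENNReal.ofReal_le_ofReal h2).trans_eq ?_
  rw [ENNReal.ofReal_mul (by positivity), ENNReal.ofReal_pow (by norm_num)]
  simp

/-- Lebesgue differentiation is applied to the countably many functions `‖g - q k‖ ^ n`, with `q`
dense, which gives one exceptional null set. At any other point, choosing `q k` close to `g x` makes
the limit arbitrarily small. -/
lemma ae_tendsto_lintegral_cube_sub {F : Type*} [NormedAddCommGroup F]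
    [TopologicalSpace.SeparableSpace F] (hn : 1 ≤ n) {g : Euc n → F}
    (hg : ∀ C : Set (Euc n), IsCompact C → MemLp g (n : ENNReal) (volume.restrict C)) :
    ∀ᵐ x, Filter.Tendsto (fun r : ℝ => ∫⁻ z in cube 0 2, ‖g (x + r • z) - g x‖ₑ ^ n)
      (nhdsWithin 0 (Ioi 0)) (nhds 0) := by
  have hn0 : n ≠ 0 := by omega
  let q : ℕ → F := TopologicalSpace.denseSeq F
  have hloc : ∀ k, LocallyIntegrable (fun y => ‖g y - q k‖ ^ n) (volume : Measure (Euc n)) := by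
    intro k
    rw [locallyIntegrable_iff]
    intro C hC
    have : IsFiniteMeasure (volume.restrict C) := ⟨by simpa using hC.measure_lt_top⟩
    exact ((hg C hC).sub (memLp_const (q k))).integrable_norm_pow hn0
  have hR : 0 < √(n : ℝ) * 2 := by
    have : (0 : ℝ) < n := by exact_mod_cast hn
    positivity
  have hall := ae_all_iff.2 fun k =>
    IsUnifLocDoublingMeasure.ae_tendsto_average (μ := (volume : Measure (Euc n))) (hloc k) 1
  filter_upwards [hall] with x hx
  set c : ENNReal := ENNReal.ofReal ((√n * 2) ^ n) * volume (Metric.ball (0 : Euc n) 1)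
  have hc : c ≠ ⊤ := ENNReal.mul_ne_top ENNReal.ofReal_ne_top measure_ball_lt_top.ne
  set V : ENNReal := volume (cube (0 : Euc n) 2)
  have hV : V ≠ ⊤ := volume_cube_ne_top 0 2
  have hconst : 2 ^ n * (c + V) ≠ ⊤ :=
    ENNReal.mul_ne_top (ENNReal.pow_ne_top ENNReal.ofNat_ne_top) (ENNReal.add_ne_top.2 ⟨hc, hV⟩)
  rw [ENNReal.tendsto_nhds_zero]
  intro η hη
  obtain ⟨k, hk⟩ : ∃ k, 2 ^ n * (c + V) * ENNReal.ofReal (‖g x - q k‖ ^ n) < η := by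
    have hcont : Continuous fun p : F => 2 ^ n * (c + V) * ENNReal.ofReal (‖g x - p‖ ^ n) :=
      (ENNReal.continuous_const_mul hconst).comp
        (ENNReal.continuous_ofReal.comp (by fun_prop))
    have hopen : IsOpen {p : F | 2 ^ n * (c + V) * ENNReal.ofReal (‖g x - p‖ ^ n) < η} :=
      isOpen_lt hcont continuous_const
    exact (TopologicalSpace.denseRange_denseSeq F).exists_mem_open hopen
      ⟨g x, by simpa [hn0] using hη⟩
  have hlim : Filter.Tendsto (fun r : ℝ => ⨍ y in Metric.closedBall x (r * (√n * 2)),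
      ‖g y - q k‖ ^ n) (nhdsWithin 0 (Ioi 0)) (nhds (‖g x - q k‖ ^ n)) := by
    refine hx k (fun _ => x) (fun r => r * (√n * 2)) ?_ ?_
    · refine tendsto_nhdsWithin_iff.2 ⟨?_, ?_⟩
      · have : Filter.Tendsto (fun r : ℝ => r * (√n * 2)) (nhds 0) (nhds (0 * (√n * 2))) :=
          Filter.tendsto_id.mul_const _
        rw [zero_mul] at this
        exact this.mono_left nhdsWithin_le_nhds
      · filter_upwards [self_mem_nhdsWithin] with r hr
        exact mul_pos hr hR
    · filter_upwards [self_mem_nhdsWithin] with r hr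
      exact Metric.mem_closedBall_self (by have : 0 < r := hr; positivity)
  have hlim2 : Filter.Tendsto (fun r : ℝ => 2 ^ n * (c * ENNReal.ofReal
      (⨍ y in Metric.closedBall x (r * (√n * 2)), ‖g y - q k‖ ^ n) +
        V * ENNReal.ofReal (‖g x - q k‖ ^ n))) (nhdsWithin 0 (Ioi 0))
      (nhds (2 ^ n * (c * ENNReal.ofReal (‖g x - q k‖ ^ n) +
        V * ENNReal.ofReal (‖g x - q k‖ ^ n)))) := by
    refine ENNReal.Tendsto.const_mul (Filter.Tendsto.add ?_ tendsto_const_nhds)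
      (Or.inr (ENNReal.pow_ne_top ENNReal.ofNat_ne_top))
    exact ENNReal.Tendsto.const_mul ((ENNReal.continuous_ofReal.tendsto _).comp hlim) (Or.inr hc)
  rw [← add_mul, ← mul_assoc] at hlim2
  filter_upwards [hlim2.eventually (gt_mem_nhds hk), self_mem_nhdsWithin] with r hr hr0
  refine le_trans ?_ hr.le
  calc ∫⁻ z in cube 0 2, ‖g (x + r • z) - g x‖ₑ ^ n
      ≤ ∫⁻ z in cube 0 2, 2 ^ n * (ENNReal.ofReal (‖g (x + r • z) - q k‖ ^ n) +
          ENNReal.ofReal (‖g x - q k‖ ^ n)) :=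
        lintegral_mono fun z => enorm_sub_pow_le_add _ _ _ _
    _ = 2 ^ n * ((∫⁻ z in cube 0 2, ENNReal.ofReal (‖g (x + r • z) - q k‖ ^ n)) +
          V * ENNReal.ofReal (‖g x - q k‖ ^ n)) := by
        rw [lintegral_const_mul' _ _ (ENNReal.pow_ne_top ENNReal.ofNat_ne_top),
          lintegral_add_right _ measurable_const, setLIntegral_const, mul_comm V]
    _ ≤ _ := by
        gcongr
        exact lintegral_cube_comp_le hn (fun y => by positivity) (hloc k) x hr0

lemma WeakGrad.const_mul {u : Euc n → ℝ} {g : Euc n → (Euc n →L[ℝ] ℝ)} (h : WeakGrad u g)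
    (c : ℝ) : WeakGrad (fun x => c * u x) (fun x => c • g x) where
  cont := continuous_const.mul h.cont
  memLp C hC := (h.memLp C hC).const_smul c
  integral_eq φ hφ hc v := by
    have h1 := h.integral_eq φ hφ hc v
    calc ∫ x, fderiv ℝ φ x v * (c * u x) = ∫ x, c * (fderiv ℝ φ x v * u x) := by
          congr 1; ext x; ring
      _ = - ∫ x, c * (φ x * g x v) := by
          rw [integral_const_mul, h1, integral_const_mul]; ring
      _ = _ := by
          congr 2; ext x
          simp only [FunLike.coe_smul, Pi.smul_apply, smul_eq_mul]
          ring

/-- The blow-up `z ↦ (u (x + r z) - u x) / r`. -/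
lemma WeakGrad.blowup (hn : 1 ≤ n) {u : Euc n → ℝ} {g : Euc n → (Euc n →L[ℝ] ℝ)}
    (h : WeakGrad u g) (x : Euc n) {r : ℝ} (hr : 0 < r) :
    WeakGrad (fun z => r⁻¹ * (u (x + r • z) - u x)) (fun z => g (x + r • z)) := by
  have := ((h.comp_add_smul x hr).sub_const hn (u x)).const_mul r⁻¹
  simpa only [smul_smul, inv_mul_cancel₀ hr.ne', one_smul] using this

lemma ae_cube_comp_add_smul {p : Euc n → Prop} {x : Euc n} {ρ r s : ℝ} (hr : 0 < r)
    (hρ : r * s ≤ ρ) (h : ∀ᵐ y ∂(volume.restrict (cube x ρ)), p y) :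
    ∀ᵐ z ∂(volume.restrict (cube (0 : Euc n) s)), p (x + r • z) := by
  have h1 := (ae_restrict_iff' (isOpen_cube x ρ).measurableSet).1 h
  refine (ae_restrict_iff' (isOpen_cube 0 s).measurableSet).2 ?_
  filter_upwards [ae_comp_add_smul h1 x hr] with z hz hzc
  rw [← preimage_cube x hr s] at hzc
  exact hz fun i => (hzc i).trans_le hρ

/-- A quasiregular family is differentiable at the `Lⁿ` Lebesgue points of its gradient. -/
lemma hasFDerivAt_of_lebesgue (hn : 2 ≤ n) {K : ℝ} (hK : 0 < K) {u : Fin n → Euc n → ℝ}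
    {g : Fin n → Euc n → (Euc n →L[ℝ] ℝ)} (h : ∀ j, WeakGrad (u j) (g j)) {x : Euc n} {ρ : ℝ}
    (hρ : 0 < ρ) (hqr : QRFamily K (cube x ρ) g)
    (hleb : ∀ j, Filter.Tendsto (fun r : ℝ => ∫⁻ z in cube 0 2, ‖g j (x + r • z) - g j x‖ₑ ^ n)
      (nhdsWithin 0 (Ioi 0)) (nhds 0)) (j : Fin n) : HasFDerivAt (u j) (g j x) x := by
  have hn1 : 1 ≤ n := by omega
  rw [hasFDerivAt_iff_isLittleO, Asymptotics.isLittleO_iff]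
  intro c hc
  -- Being a Lebesgue point says that the blown-up gradients converge to the constants `g j x` in
  -- energy; uniform closeness of the blow-ups to these linear forms is then differentiability.
  obtain ⟨δ, hδ, hclose⟩ := exists_uniform_closeness hn hK (∑ j, ‖g j x‖)
    (Finset.sum_nonneg fun _ _ => norm_nonneg _) (ε := c / 2) (by positivity)
  have hsum : Filter.Tendsto (fun r : ℝ => energy (fun j z => g j (x + r • z) - g j x) (cube 0 2))
      (nhdsWithin 0 (Ioi 0)) (nhds 0) := by
    have h1 : Filter.Tendsto (fun r : ℝ => ∑ j, ∫⁻ z in cube 0 2, ‖g j (x + r • z) - g j x‖ₑ ^ n)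
        (nhdsWithin 0 (Ioi 0)) (nhds (∑ _j : Fin n, 0)) := tendsto_finsetSum _ fun j _ => hleb j
    rw [Finset.sum_const_zero] at h1
    refine h1.congr' ?_
    filter_upwards [self_mem_nhdsWithin] with r hr
    rw [energy, lintegral_finsetSum']
    intro i _
    have hm : AEStronglyMeasurable (fun z => g i (x + r • z) - g i x) volume :=
      (((h i).blowup hn1 x hr).aestronglyMeasurable hn1).sub aestronglyMeasurable_const
    exact (hm.enorm.pow_const n).restrict
  have hev : ∀ᶠ r in nhdsWithin (0 : ℝ) (Ioi 0),
      energy (fun j z => g j (x + r • z) - g j x) (cube 0 2) ≤ ENNReal.ofReal δ ∧ r * 2 ≤ ρ := by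
    refine Filter.Eventually.and ?_ ?_
    · exact (hsum.eventually (gt_mem_nhds (ENNReal.ofReal_pos.2 hδ))).mono fun _ h => h.le
    · filter_upwards [mem_nhdsWithin_of_mem_nhds (Iio_mem_nhds (show (0 : ℝ) < ρ / 2 by positivity))]
        with r hr
      have : r < ρ / 2 := hr
      linarith
  obtain ⟨r₀, hr₀, hr⟩ := mem_nhdsGT_iff_exists_Ioo_subset.1 hev
  have hr₀' : (0 : ℝ) < r₀ := hr₀
  filter_upwards [Metric.ball_mem_nhds x (show (0 : ℝ) < r₀ / 2 by positivity)] with y hy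
  rw [Metric.mem_ball, dist_eq_norm] at hy
  rcases eq_or_ne y x with rfl | hne
  · simp
  have hpos : 0 < ‖y - x‖ := norm_pos_iff.2 (sub_ne_zero.2 hne)
  -- With this scale the rescaled point `z` has norm `1 / 2`, hence lies in the open unit cube. The
  -- factor `2` is offset by asking for closeness `c / 2`.
  set r := 2 * ‖y - x‖
  have hr0 : 0 < r := by positivity
  obtain ⟨hen, hrρ⟩ := hr (show r ∈ Ioo 0 r₀ from ⟨hr0, by simp only [r]; linarith⟩)
  set z : Euc n := r⁻¹ • (y - x)
  have hxz : x + r • z = y := by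
    simp only [z]; rw [smul_smul, mul_inv_cancel₀ hr0.ne', one_smul, add_sub_cancel]
  have hz : z ∈ cube (0 : Euc n) 1 := by
    refine ball_subset_cube _ _ ?_
    rw [mem_ball_zero_iff, norm_smul, norm_inv, Real.norm_of_nonneg hr0.le]
    simp only [r]
    rw [inv_mul_lt_iff₀ (by positivity)]
    linarith
  have := hclose (fun j z => r⁻¹ * (u j (x + r • z) - u j x)) (fun j z => g j (x + r • z))
    (fun j => (h j).blowup hn1 x hr0) (ae_cube_comp_add_smul hr0 hrρ hqr) (fun j => g j x)
    (fun j => Finset.single_le_sum (f := fun j => ‖g j x‖) (fun _ _ => norm_nonneg _)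
      (Finset.mem_univ j)) (fun j => by simp) hen z hz j
  rw [hxz] at this
  have h2 : u j y - u j x - g j x (y - x) = r * (r⁻¹ * (u j y - u j x) - g j x z) := by
    have : g j x z = r⁻¹ * g j x (y - x) := by simp only [z, map_smul, smul_eq_mul]
    rw [this]; field_simp
  rw [h2, norm_mul, Real.norm_of_nonneg hr0.le, Real.norm_eq_abs]
  calc r * _ ≤ r * (c / 2) := by gcongr
    _ = _ := by simp only [r]; ring

/-! ### Limits of quasiregular families -/

lemma rowDet_update_smul_left (a : Fin n → (Euc n →L[ℝ] ℝ)) (i : Fin n) (t : ℝ)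
    (b : Euc n →L[ℝ] ℝ) :
    rowDet (Function.update (fun j => t • a j) i b) =
      t ^ (n - 1) * rowDet (Function.update a i b) := by
  have key : ∀ a : Fin n → (Euc n →L[ℝ] ℝ),
      (Matrix.of fun k j => Function.update a i b k (EuclideanSpace.single j 1)) =
      (Matrix.of fun k j => a k (EuclideanSpace.single j 1)).updateRow i
        (fun j => b (EuclideanSpace.single j 1)) := by
    intro a
    ext k j
    by_cases h : k = i
    · subst h; simp
    · simp [h]
  simp only [rowDet, key]
  have := Matrix.det_updateRow_smul_left
    (Matrix.of fun k j => a k (EuclideanSpace.single j (1 : ℝ))) i t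
    (fun j => b (EuclideanSpace.single j 1))
  rw [Fintype.card_fin] at this
  exact this

/-- The weighted form of `abs_mul_rowDet_update_le`. -/
lemma abs_mul_rowDet_update_le_of_weight (hn : 1 ≤ n) (a : Fin n → (Euc n →L[ℝ] ℝ)) (i : Fin n)
    (b : Euc n →L[ℝ] ℝ) (s : ℝ) {t : ℝ} (ht : 0 ≤ t) :
    |s * (t ^ (n - 1) * rowDet (Function.update a i b))| ≤
      ‖b‖ * (|s| ^ n + t ^ n * ∑ j, ‖a j‖ ^ n) := by
  rw [← rowDet_update_smul_left]
  refine (abs_mul_rowDet_update_le hn _ i b s).trans_eq ?_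
  rw [Finset.mul_sum]
  congr 2
  refine Finset.sum_congr rfl fun j _ => ?_
  rw [norm_smul, mul_pow, Real.norm_of_nonneg ht]

/-- The Caccioppoli inequality for bounded quasiregular families. -/
lemma exists_energy_le_of_bounded (hn : 1 ≤ n) {K : ℝ} (hK : 0 < K) :
    ∃ C : ℝ, 0 ≤ C ∧ ∀ (u : Fin n → Euc n → ℝ) (g : Fin n → Euc n → (Euc n →L[ℝ] ℝ)),
      (∀ j, WeakGrad (u j) (g j)) → QRFamily K (cube 0 2) g → ∀ (i : Fin n) (A : ℝ),
      (∀ x ∈ cube (0 : Euc n) 2, |u i x| ≤ A) →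
      energy g (cube 0 1) ≤ ENNReal.ofReal (C * A ^ n) := by
  obtain ⟨φ, D, hφ, hφc, hφ0, hφ1, hD, hφD, hφin, hφout⟩ := exists_cube_cutoff n
  have hn0 : (0 : ℝ) < n := by exact_mod_cast hn
  -- The weight in Young's inequality, small enough that the gradient term comes back with
  -- coefficient at most `1 / 2` and can be absorbed into `T`.
  set t : ℝ := (2 * (n * K) * (n * D + 1))⁻¹ with ht
  have ht0 : 0 < t := by positivity
  set V : ℝ := (volume (cube (0 : Euc n) 2)).toReal
  refine ⟨n * K * (2 * ((t ^ (n - 1))⁻¹ * (n * D) * V)), by positivity,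
    fun u g h hqr i A hA => ?_⟩
  have hA0 : 0 ≤ A := (abs_nonneg _).trans (hA 0 fun i => by simp)
  -- Testing with `φ ^ n` leaves `φ ^ (n - 1)` after differentiation, one factor for each remaining
  -- gradient row. The weighted energy on the right is then again controlled by `φ ^ n` times the
  -- Jacobian.
  have hφn : ContDiff ℝ ∞ fun x => φ x ^ n := hφ.pow n
  have hφnc : HasCompactSupport fun x => φ x ^ n :=
    hφc.comp_left (g := fun s : ℝ => s ^ n) (zero_pow (by omega))
  obtain ⟨hI1, hI2, hIBP⟩ := integral_mul_rowDet hn u g h hφn hφnc i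
  have hder : ∀ x, fderiv ℝ (fun x => φ x ^ n) x = (n * φ x ^ (n - 1)) • fderiv ℝ φ x := by
    intro x
    have := ((hφ.differentiable (by simp)).differentiableAt (x := x)).hasFDerivAt.pow n
    rw [this.fderiv]
    simp
  have hQ2 : MeasurableSet (cube (0 : Euc n) 2) := (isOpen_cube 0 2).measurableSet
  have hqr' : ∀ᵐ x, x ∈ cube (0 : Euc n) 2 →
      ∀ j, ‖g j x‖ ^ n ≤ K * rowDet fun i => g i x := (ae_restrict_iff' hQ2).1 hqr
  have hnn : ∀ᵐ x, 0 ≤ φ x ^ n * rowDet (fun j => g j x) := by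
    filter_upwards [hqr'] with x hx
    by_cases hx2 : x ∈ cube (0 : Euc n) 2
    · exact mul_nonneg (pow_nonneg (hφ0 x) _) (rowDet_nonneg_of_qr hn hK (hx hx2))
    · rw [(hφout x hx2).1, zero_pow (by omega), zero_mul]
  set T := ∫ x, φ x ^ n * rowDet (fun j => g j x)
  have hT0 : 0 ≤ T := integral_nonneg_of_ae hnn
  have hind : Integrable ((cube (0 : Euc n) 2).indicator fun _ =>
      (t ^ (n - 1))⁻¹ * (n * D) * A ^ n) volume :=
    (integrable_indicator_iff hQ2).2 (integrableOn_const (volume_cube_ne_top 0 2))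
  have hbound : T ≤ (t ^ (n - 1))⁻¹ * (n * D) * V * A ^ n + T / 2 := by
    calc T ≤ ∫ x, |u i x * rowDet (Function.update (fun j => g j x) i
          (fderiv ℝ (fun x => φ x ^ n) x))| := by
          rw [hIBP]
          refine (neg_le_abs _).trans ?_
          exact abs_integral_le_integral_abs
      _ ≤ ∫ x, ((cube (0 : Euc n) 2).indicator (fun _ => (t ^ (n - 1))⁻¹ * (n * D) * A ^ n) x +
            1 / 2 * (φ x ^ n * rowDet (fun j => g j x))) := by
          refine integral_mono_ae hI2.abs (hind.add (hI1.const_mul _)) ?_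
          filter_upwards [hqr'] with x hx
          by_cases hx2 : x ∈ cube (0 : Euc n) 2
          · simp only [indicator_of_mem hx2]
            rw [hder, rowDet_update_smul]
            have hb := abs_mul_rowDet_update_le_of_weight hn (fun j => g j x) i (fderiv ℝ φ x)
              (u i x) (t := t * φ x) (mul_nonneg ht0.le (hφ0 x))
            have hs := sum_pow_le_of_qr (hx hx2)
            have hdet := rowDet_nonneg_of_qr hn hK (hx hx2)
            have e1 : u i x * (n * φ x ^ (n - 1) *
                rowDet (Function.update (fun j => g j x) i (fderiv ℝ φ x))) =
                ((t ^ (n - 1))⁻¹ * n) * (u i x * ((t * φ x) ^ (n - 1) *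
                rowDet (Function.update (fun j => g j x) i (fderiv ℝ φ x)))) := by
              rw [mul_pow]; field_simp
            rw [e1, abs_mul, abs_of_nonneg (by positivity)]
            have hφx := hφ0 x
            calc _ ≤ ((t ^ (n - 1))⁻¹ * n) * (D * (A ^ n + (t * φ x) ^ n *
                  (n * K * rowDet fun j => g j x))) := by
                  gcongr
                  refine hb.trans ?_
                  gcongr
                  · exact hφD x
                  · exact hA x hx2
              _ = (t ^ (n - 1))⁻¹ * (n * D) * A ^ n + ((t ^ (n - 1))⁻¹ * t ^ n * (n * D * (n * K)))
                  * (φ x ^ n * rowDet fun j => g j x) := by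
                  rw [mul_pow]; ring
              _ ≤ _ := by
                  refine add_le_add le_rfl (mul_le_mul_of_nonneg_right ?_
                    (mul_nonneg (pow_nonneg hφx _) hdet))
                  · have e2 : (t ^ (n - 1))⁻¹ * t ^ n = t := by
                      obtain ⟨m, rfl⟩ : ∃ m, n = m + 1 := ⟨n - 1, by omega⟩
                      rw [Nat.add_sub_cancel, pow_succ]
                      field_simp
                    rw [e2, ht, inv_mul_le_iff₀ (by positivity)]
                    nlinarith [show 0 < n * K by positivity]
          · have hz : fderiv ℝ (fun x => φ x ^ n) x = 0 := by
              rw [hder, (hφout x hx2).2, smul_zero]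
            simp only [indicator_of_notMem hx2]
            rw [rowDet_eq_zero_of_row (i := i) (by simpa using hz), (hφout x hx2).1,
              zero_pow (by omega)]
            simp
      _ = _ := by
          rw [integral_add hind (hI1.const_mul _), integral_const_mul, integral_indicator hQ2,
            setIntegral_const, smul_eq_mul, measureReal_def]
          simp only [T, V]
          ring
  have hT : T ≤ 2 * ((t ^ (n - 1))⁻¹ * (n * D) * V) * A ^ n := by linarith
  calc energy g (cube 0 1)
      = ∫⁻ x, (cube 0 1).indicator (fun x => ∑ j, ‖g j x‖ₑ ^ n) x :=
        (lintegral_indicator (isOpen_cube 0 1).measurableSet _).symm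
    _ ≤ ∫⁻ x, ENNReal.ofReal (n * K) * ENNReal.ofReal (φ x ^ n * rowDet (fun j => g j x)) := by
        refine lintegral_mono_ae ?_
        filter_upwards [hqr'] with x hx
        by_cases hx1 : x ∈ cube (0 : Euc n) 1
        · have hx2 : x ∈ cube (0 : Euc n) 2 := fun i => (hx1 i).trans one_lt_two
          rw [indicator_of_mem hx1, (hφin x hx1).1, one_pow, one_mul,
            ← ENNReal.ofReal_mul (by positivity), ← ofReal_sum_pow]
          exact ENNReal.ofReal_le_ofReal (sum_pow_le_of_qr (hx hx2))
        · rw [indicator_of_notMem hx1]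
          exact zero_le
    _ = ENNReal.ofReal (n * K) * ENNReal.ofReal T := by
        rw [lintegral_const_mul' _ _ ENNReal.ofReal_ne_top,
          ofReal_integral_eq_lintegral_ofReal hI1 hnn]
    _ ≤ _ := by
        rw [← ENNReal.ofReal_mul (by positivity)]
        apply ENNReal.ofReal_le_ofReal
        calc n * K * T ≤ n * K * (2 * ((t ^ (n - 1))⁻¹ * (n * D) * V) * A ^ n) := by gcongr
          _ = _ := by ring

/-- Determinants depend continuously, in the weak sense, on uniform perturbations. -/
lemma abs_integral_mul_rowDet_sub_le (hn : 1 ≤ n) {ψ : Euc n → ℝ} (hψ : ContDiff ℝ ∞ ψ)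
    (hc : HasCompactSupport ψ) {D : ℝ} (hD0 : 0 ≤ D) (hD : ∀ x, ‖fderiv ℝ ψ x‖ ≤ D)
    (hout : ∀ x ∉ cube (0 : Euc n) 1, fderiv ℝ ψ x = 0) (M : Fin n → (Euc n →L[ℝ] ℝ))
    {E ε : ℝ} (hE : 0 ≤ E) (hε : 0 ≤ ε) (u : Fin n → Euc n → ℝ)
    (g : Fin n → Euc n → (Euc n →L[ℝ] ℝ)) (h : ∀ j, WeakGrad (u j) (g j))
    (hu : ∀ x ∈ cube (0 : Euc n) 1, ∀ j, |u j x - M j x| ≤ ε)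
    (hen : energy g (cube 0 1) ≤ ENNReal.ofReal E) :
    |(∫ x, ψ x * rowDet fun j => g j x) - ∫ x, ψ x * rowDet M| ≤
      n * (ε * (D * ((volume (cube (0 : Euc n) 1)).toReal * (1 + ∑ j, ‖M j‖ ^ n) + E))) := by
  classical
  set V : ℝ := (volume (cube (0 : Euc n) 1)).toReal
  set W : ℝ := ε * (D * (V * (1 + ∑ j, ‖M j‖ ^ n) + E))
  have hQ : MeasurableSet (cube (0 : Euc n) 1) := (isOpen_cube 0 1).measurableSet
  -- The rows of `g` are exchanged for those of `M` one at a time; `S` records the rows already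
  -- exchanged, and the errors telescope.
  let w : Finset (Fin n) → Fin n → Euc n → ℝ := fun S => S.piecewise (fun j x => M j x) u
  let a : Finset (Fin n) → Fin n → Euc n → (Euc n →L[ℝ] ℝ) := fun S => S.piecewise (fun j _ => M j) g
  have hwa : ∀ S j, WeakGrad (w S j) (a S j) := by
    intro S j
    by_cases hj : j ∈ S
    · simp only [w, a, Finset.piecewise_eq_of_mem _ _ _ hj]; exact WeakGrad.linear (M j)
    · simp only [w, a, Finset.piecewise_eq_of_notMem _ _ _ hj]; exact h j
  have hae : ∀ S j x, ‖a S j x‖ ^ n ≤ ‖M j‖ ^ n + ‖g j x‖ ^ n := by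
    intro S j x
    by_cases hj : j ∈ S
    · simp only [a, Finset.piecewise_eq_of_mem _ _ _ hj]
      exact le_add_of_nonneg_right (by positivity)
    · simp only [a, Finset.piecewise_eq_of_notMem _ _ _ hj]
      exact le_add_of_nonneg_left (by positivity)
  have hstep : ∀ S i, i ∉ S → |(∫ x, ψ x * rowDet fun j => a S j x) -
      ∫ x, ψ x * rowDet fun j => a (insert i S) j x| ≤ W := by
    intro S i hi
    have hfam : ∀ j, WeakGrad (Function.update (w S) i (fun x => u i x - M i x) j)
        (Function.update (a S) i (fun x => g i x - M i) j) := by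
      intro j
      by_cases hj : j = i
      · subst hj
        simpa using (h j).sub hn (WeakGrad.linear (M j))
      · simpa [hj] using hwa S j
    -- Integrating by parts in row `i` moves the derivative from `u i - M i` to `ψ`, so only the
    -- uniform smallness of the former is needed and its gradient disappears.
    obtain ⟨-, -, hIBP⟩ := integral_mul_rowDet hn _ _ hfam hψ hc i
    have hI1 := (integral_mul_rowDet hn _ _ (hwa S) hψ hc i).1
    have hI2 := (integral_mul_rowDet hn _ _ (hwa (insert i S)) hψ hc i).1
    have hpt : ∀ x, (fun j => Function.update (a S) i (fun x => g i x - M i) j x) =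
        Function.update (fun j => a S j x) i (g i x - M i) := by
      intro x; ext1 j
      by_cases hj : j = i
      · subst hj; simp
      · simp [hj]
    have hdiff : ∀ x, ψ x * rowDet (fun j => a S j x) - ψ x * rowDet (fun j => a (insert i S) j x)
        = ψ x * rowDet (fun j => Function.update (a S) i (fun x => g i x - M i) j x) := by
      intro x
      rw [hpt, rowDet_update_sub, mul_sub]
      congr 3
      · ext1 j
        by_cases hj : j = i
        · subst hj; simp [a, hi]
        · simp [hj]
      · ext1 j
        by_cases hj : j = i
        · subst hj; simp [a]
        · by_cases hS : j ∈ S <;> simp [a, hj, hS]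
    rw [← integral_sub hI1 hI2, integral_congr_ae (Filter.Eventually.of_forall hdiff), hIBP, abs_neg,
      ← ENNReal.ofReal_le_ofReal_iff (by positivity), ← Real.enorm_eq_ofReal_abs]
    refine (enorm_integral_le_lintegral_enorm _).trans ?_
    calc _ ≤ ∫⁻ x, (cube (0 : Euc n) 1).indicator (fun x => ENNReal.ofReal (ε * D) *
          (ENNReal.ofReal (1 + ∑ j, ‖M j‖ ^ n) + ∑ j, ‖g j x‖ₑ ^ n)) x := by
          refine lintegral_mono fun x => ?_
          simp only [Function.update_self]
          rw [hpt, Function.update_idem]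
          by_cases hx : x ∈ cube (0 : Euc n) 1
          · rw [indicator_of_mem hx, Real.enorm_eq_ofReal_abs, ← ofReal_sum_pow,
              ← ENNReal.ofReal_add (by positivity) (by positivity),
              ← ENNReal.ofReal_mul (by positivity)]
            apply ENNReal.ofReal_le_ofReal
            have h1 := abs_mul_rowDet_update_le hn (fun j => a S j x) i (fderiv ℝ ψ x) 1
            rw [one_mul, abs_one, one_pow] at h1
            rw [abs_mul, mul_assoc]
            have h2 : ∑ j, ‖a S j x‖ ^ n ≤ ∑ j, ‖M j‖ ^ n + ∑ j, ‖g j x‖ ^ n := by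
              rw [← Finset.sum_add_distrib]
              exact Finset.sum_le_sum fun j _ => hae S j x
            refine mul_le_mul (hu x hx i) (h1.trans ?_) (abs_nonneg _) hε
            refine mul_le_mul (hD x) ?_ (by positivity) hD0
            linarith
          · rw [indicator_of_notMem hx, rowDet_eq_zero_of_row (i := i) (by simpa using hout x hx)]
            simp
      _ = ENNReal.ofReal (ε * D) * (ENNReal.ofReal (1 + ∑ j, ‖M j‖ ^ n) *
            volume (cube (0 : Euc n) 1) + energy g (cube 0 1)) := by
          rw [lintegral_indicator hQ, lintegral_const_mul' _ _ ENNReal.ofReal_ne_top,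
            lintegral_add_left measurable_const, setLIntegral_const]
          rfl
      _ ≤ ENNReal.ofReal (ε * D) * (ENNReal.ofReal (1 + ∑ j, ‖M j‖ ^ n) *
            ENNReal.ofReal V + ENNReal.ofReal E) := by
          gcongr
          simp only [V]
          rw [ENNReal.ofReal_toReal (volume_cube_ne_top 0 1)]
      _ = _ := by
          rw [← ENNReal.ofReal_mul (by positivity), ← ENNReal.ofReal_add (by positivity) hE,
            ← ENNReal.ofReal_mul (by positivity)]
          congr 1
          simp only [W]
          ring
  have hind : ∀ S : Finset (Fin n), |(∫ x, ψ x * rowDet fun j => g j x) -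
      ∫ x, ψ x * rowDet fun j => a S j x| ≤ S.card * W := by
    intro S
    induction S using Finset.induction_on with
    | empty => simp [a]
    | insert i S hi ih =>
      rw [Finset.card_insert_of_notMem hi]
      push_cast
      calc _ ≤ _ := abs_sub_le _ (∫ x, ψ x * rowDet fun j => a S j x) _
        _ ≤ S.card * W + W := add_le_add ih (hstep S i hi)
        _ = _ := by ring
  have := hind Finset.univ
  simpa [a, W] using this

/-- The tangent line of `t ↦ t ^ n` at `b` lies below `|t| ^ n`; this is Bernoulli's inequality for
`|a| / b`. -/
lemma pow_add_mul_sub_le_abs_pow (hn : 1 ≤ n) (a : ℝ) {b : ℝ} (hb : 0 < b) :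
    b ^ n + n * b ^ (n - 1) * (a - b) ≤ |a| ^ n := by
  have h1 : (1 : ℝ) + n * (|a| / b - 1) ≤ (1 + (|a| / b - 1)) ^ n :=
    one_add_mul_le_pow (by have : 0 ≤ |a| / b := by positivity
                           linarith) n
  have h2 : b ^ n * (1 + (|a| / b - 1)) ^ n = |a| ^ n := by
    rw [← mul_pow]; congr 1; field_simp; ring
  obtain ⟨m, rfl⟩ : ∃ m, n = m + 1 := ⟨n - 1, by omega⟩
  rw [Nat.add_sub_cancel] at *
  calc b ^ (m + 1) + (m + 1 : ℕ) * b ^ m * (a - b)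
      ≤ b ^ (m + 1) + (m + 1 : ℕ) * b ^ m * (|a| - b) := by
        gcongr; exact le_abs_self a
    _ = b ^ (m + 1) * (1 + (m + 1 : ℕ) * (|a| / b - 1)) := by
        field_simp
        ring
    _ ≤ |a| ^ (m + 1) := by
        rw [← h2]; gcongr

/-- A quasiregular family close to a linear map forces the dilatation inequality on the latter. -/
lemma exists_sub_le_of_uniform_close (hn : 1 ≤ n) {K : ℝ} (hK : 0 < K)
    (M : Fin n → (Euc n →L[ℝ] ℝ)) (v e : Euc n) (hv : ‖v‖ = 1) (he : ‖e‖ = 1)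
    (hb : 0 < ∑ j, e j * M j v) :
    ∃ I C : ℝ, 0 < I ∧ ∀ ε : ℝ, 0 < ε → ε ≤ 1 →
      ∀ (u : Fin n → Euc n → ℝ) (g : Fin n → Euc n → (Euc n →L[ℝ] ℝ)),
      (∀ j, WeakGrad (u j) (g j)) → QRFamily K (cube 0 2) g →
      (∀ᵐ x ∂(volume.restrict (cube 0 2)),
        |∑ j, e j * g j x v| ^ n ≤ K * rowDet fun j => g j x) →
      (∀ x ∈ cube (0 : Euc n) 2, ∀ j, |u j x - M j x| ≤ ε) →
      ((∑ j, e j * M j v) ^ n - K * rowDet M) * I ≤ C * ε := by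
  set b := ∑ j, e j * M j v
  have hsub : cube (0 : Euc n) 1 ⊆ cube 0 2 := fun x hx i => (hx i).trans one_lt_two
  let ψ : ContDiffBump (0 : Euc n) := ⟨1 / 4, 1 / 2, by norm_num, by norm_num⟩
  have hψ : ContDiff ℝ ∞ ψ := ψ.contDiff
  have hψc : HasCompactSupport ψ := ψ.hasCompactSupport
  have hsupp : tsupport ψ ⊆ cube (0 : Euc n) 1 := by
    rw [ψ.tsupport_eq]
    exact (Metric.closedBall_subset_ball (by simp only [ψ]; norm_num)).trans (ball_subset_cube 0 1)
  have hout : ∀ x ∉ cube (0 : Euc n) 1, fderiv ℝ ψ x = 0 := fun x hx =>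
    image_eq_zero_of_notMem_tsupport fun h => hx (hsupp (tsupport_fderiv_subset ℝ h))
  obtain ⟨D, hD⟩ := (hψc.fderiv (𝕜 := ℝ)).exists_bound_of_continuous (hψ.continuous_fderiv (by simp))
  have hD0 : 0 ≤ D := (norm_nonneg _).trans (hD 0)
  set I := ∫ x, ψ x
  have hI : 0 < I := ψ.integral_pos
  have hψint : Integrable ψ volume := ψ.integrable
  obtain ⟨C₀, hC₀, hcacc⟩ := exists_energy_le_of_bounded hn hK
  let i₀ : Fin n := ⟨0, hn⟩
  set A : ℝ := ‖M i₀‖ * (√n * 2) + 1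
  set E : ℝ := C₀ * A ^ n
  have hE : 0 ≤ E := by positivity
  set V : ℝ := (volume (cube (0 : Euc n) 1)).toReal
  have hQ : MeasurableSet (cube (0 : Euc n) 1) := (isOpen_cube 0 1).measurableSet
  refine ⟨I, n * b ^ (n - 1) * (n * (D * V)) +
    K * (n * (D * (V * (1 + ∑ j, ‖M j‖ ^ n) + E))), hI, fun ε hε hε1 u g h hqr hle hu => ?_⟩
  have hen : energy g (cube 0 1) ≤ ENNReal.ofReal E := by
    refine hcacc u g h hqr i₀ A fun x hx => ?_
    have h1 := hu x hx i₀
    have h2 : |M i₀ x| ≤ ‖M i₀‖ * (√n * 2) := by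
      refine (M i₀).le_opNorm_of_le ?_
      exact mem_closedBall_zero_iff.1 (cube_subset_closedBall 0 2 hx)
    calc |u i₀ x| = |(u i₀ x - M i₀ x) + M i₀ x| := by rw [sub_add_cancel]
      _ ≤ |u i₀ x - M i₀ x| + |M i₀ x| := abs_add_le _ _
      _ ≤ A := by simp only [A]; linarith
  have hJ := abs_integral_mul_rowDet_sub_le hn hψ hψc hD0 hD hout M hE hε.le u g h
    (fun x hx => hu x (hsub hx)) hen
  rw [integral_mul_const] at hJ
  set J := ∫ x, ψ x * rowDet fun j => g j x
  have hw : ∀ j, WeakGrad (fun x => u j x - M j x) (fun x => g j x - M j) := fun j =>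
    (h j).sub hn (WeakGrad.linear (M j))
  have hwi : ∀ j, Integrable (fun x => ψ x * (g j x - M j) v) volume := fun j =>
    integrable_mul_apply ((hw j).locallyIntegrable hn) hψ.continuous hψc v
  -- Weak convergence of the gradients: the derivative falls on `ψ`, and `u j - M j` is at most `ε`.
  have hR : ∀ j, |∫ x, ψ x * (g j x - M j) v| ≤ D * ε * V := by
    intro j
    have h1 := (hw j).integral_eq ψ hψ hψc v
    rw [eq_comm, neg_eq_iff_eq_neg] at h1
    rw [h1, abs_neg, ← Real.norm_eq_abs]
    have hbound : ∀ x, ‖fderiv ℝ ψ x v * (u j x - M j x)‖ ≤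
        (cube (0 : Euc n) 1).indicator (fun _ => D * ε) x := by
      intro x
      by_cases hx : x ∈ cube (0 : Euc n) 1
      · rw [indicator_of_mem hx, norm_mul]
        refine mul_le_mul ?_ (hu x (hsub hx) j) (norm_nonneg _) hD0
        have := (fderiv ℝ ψ x).le_opNorm v
        rw [hv, mul_one] at this
        exact this.trans (hD x)
      · rw [indicator_of_notMem hx, hout x hx]
        simp
    refine (norm_integral_le_of_norm_le ((integrable_indicator_iff hQ).2
      (integrableOn_const (volume_cube_ne_top 0 1))) (Filter.Eventually.of_forall hbound)).trans_eq ?_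
    rw [integral_indicator hQ, setIntegral_const, smul_eq_mul, measureReal_def]
    ring
  have hej : ∀ j, |e j| ≤ 1 := fun j => by
    have := PiLp.norm_apply_le e j
    rwa [he] at this
  have hsum : |∑ j, e j * ∫ x, ψ x * (g j x - M j) v| ≤ n * (D * ε * V) := by
    calc _ ≤ ∑ j, |e j * ∫ x, ψ x * (g j x - M j) v| := Finset.abs_sum_le_sum_abs _ _
      _ ≤ ∑ _j : Fin n, D * ε * V := by
        refine Finset.sum_le_sum fun j _ => ?_
        rw [abs_mul]
        calc _ ≤ 1 * (D * ε * V) := mul_le_mul (hej j) (hR j) (abs_nonneg _) zero_le_one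
          _ = _ := one_mul _
      _ = _ := by simp
  have hsumint : Integrable (fun x => ∑ j, e j * (ψ x * (g j x - M j) v)) volume :=
    integrable_finsetSum _ fun j _ => (hwi j).const_mul _
  -- Convexity replaces the `n`-th power by its tangent line at `b`, which is linear in the
  -- gradients. The pointwise inequality, integrated against `ψ`, then involves only quantities that
  -- are stable under uniform convergence.
  have hmain : b ^ n * I + n * b ^ (n - 1) * ∑ j, e j * ∫ x, ψ x * (g j x - M j) v ≤ K * J := by
    have e1 : b ^ n * I + n * b ^ (n - 1) * ∑ j, e j * ∫ x, ψ x * (g j x - M j) v =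
        ∫ x, (b ^ n * ψ x + n * b ^ (n - 1) * ∑ j, e j * (ψ x * (g j x - M j) v)) := by
      rw [integral_add (hψint.const_mul _) (hsumint.const_mul _), integral_const_mul,
        integral_const_mul, integral_finsetSum _ fun j _ => (hwi j).const_mul _]
      simp only [integral_const_mul]
      rfl
    rw [e1, ← integral_const_mul]
    refine integral_mono_ae ((hψint.const_mul _).add (hsumint.const_mul _))
      ((integral_mul_rowDet hn u g h hψ hψc i₀).1.const_mul _) ?_
    have hle' := (ae_restrict_iff' (isOpen_cube (0 : Euc n) 2).measurableSet).1 hle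
    filter_upwards [hle'] with x hx
    by_cases hx1 : x ∈ cube (0 : Euc n) 1
    · have h1 := hx (hsub hx1)
      have h2 := pow_add_mul_sub_le_abs_pow hn (∑ j, e j * g j x v) hb
      have h3 : ∑ j, e j * (ψ x * (g j x - M j) v) = ψ x * ((∑ j, e j * g j x v) - b) := by
        simp only [b]
        rw [← Finset.sum_sub_distrib, Finset.mul_sum]
        refine Finset.sum_congr rfl fun j _ => ?_
        have : (g j x - M j) v = g j x v - M j v := rfl
        rw [this]; ring
      rw [h3]
      calc _ = ψ x * (b ^ n + n * b ^ (n - 1) * ((∑ j, e j * g j x v) - b)) := by ring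
        _ ≤ ψ x * (K * rowDet fun j => g j x) :=
          mul_le_mul_of_nonneg_left (h2.trans h1) ψ.nonneg
        _ = _ := by ring
    · have : ψ x = 0 := image_eq_zero_of_notMem_tsupport fun h => hx1 (hsupp h)
      simp [this]
  have hJ' := (abs_le.1 hJ).2
  have hs' := (abs_le.1 hsum).1
  have h4 : n * b ^ (n - 1) * (-(n * (D * ε * V))) ≤
      n * b ^ (n - 1) * ∑ j, e j * ∫ x, ψ x * (g j x - M j) v :=
    mul_le_mul_of_nonneg_left hs' (by positivity)
  have h5 := mul_le_mul_of_nonneg_left hJ' hK.le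
  change K * (J - I * rowDet M) ≤ _ at h5
  linarith

/-- A quasiregular family satisfies its dilatation inequality at every point of differentiability
where the derivative does not vanish in the direction considered. -/
lemma pow_le_of_hasFDerivAt (hn : 1 ≤ n) {K : ℝ} (hK : 0 < K) {u : Fin n → Euc n → ℝ}
    {g : Fin n → Euc n → (Euc n →L[ℝ] ℝ)} (h : ∀ j, WeakGrad (u j) (g j)) {x : Euc n} {ρ : ℝ}
    (hρ : 0 < ρ) (hqr : QRFamily K (cube x ρ) g) {M : Fin n → (Euc n →L[ℝ] ℝ)}
    (hM : ∀ j, HasFDerivAt (u j) (M j) x) {v e : Euc n} (hv : ‖v‖ = 1) (he : ‖e‖ = 1)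
    (hle : ∀ᵐ y ∂(volume.restrict (cube x ρ)),
        |∑ j, e j * g j y v| ^ n ≤ K * rowDet fun j => g j y)
    (hb : 0 < ∑ j, e j * M j v) : (∑ j, e j * M j v) ^ n ≤ K * rowDet M := by
  obtain ⟨I, C, hI, hC⟩ := exists_sub_le_of_uniform_close hn hK M v e hv he hb
  have hR : 0 < √(n : ℝ) * 2 := by
    have : (0 : ℝ) < n := by exact_mod_cast hn
    positivity
  have hclose : ∀ ε : ℝ, 0 < ε → ε ≤ 1 → ((∑ j, e j * M j v) ^ n - K * rowDet M) * I ≤ C * ε := by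
    intro ε hε hε1
    -- Points of the cube of half side `2` have norm at most `2 √n`; this relative accuracy makes
    -- the blow-ups `ε`-close to `M` on it.
    have hev : ∀ᶠ y in nhds x, ∀ j, ‖u j y - u j x - M j (y - x)‖ ≤ ε / (√n * 2) * ‖y - x‖ :=
      Filter.eventually_all.2 fun j =>
        ((hasFDerivAt_iff_isLittleO.1 (hM j)).def (by positivity))
    obtain ⟨s, hs, hball⟩ := Metric.eventually_nhds_iff.1 hev
    obtain ⟨r, hr, hr1, hr2⟩ : ∃ r : ℝ, 0 < r ∧ r * 2 ≤ ρ ∧ r * (√n * 2) < s := by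
      refine ⟨min (ρ / 2) (s / (√n * 2) / 2), by positivity, ?_, ?_⟩
      · have := min_le_left (ρ / 2) (s / (√n * 2) / 2)
        linarith
      · have h1 := min_le_right (ρ / 2) (s / (√n * 2) / 2)
        calc _ ≤ s / (√n * 2) / 2 * (√n * 2) := by gcongr
          _ = s / 2 := by field_simp
          _ < s := by linarith
    refine hC ε hε hε1 _ _ (fun j => (h j).blowup hn x hr) (ae_cube_comp_add_smul hr hr1 hqr)
      (ae_cube_comp_add_smul hr hr1 hle) fun z hz j => ?_
    have hz' := mem_closedBall_zero_iff.1 (cube_subset_closedBall 0 2 hz)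
    have hd : ‖x + r • z - x‖ = r * ‖z‖ := by
      rw [add_sub_cancel_left, norm_smul, Real.norm_of_nonneg hr.le]
    have h1 := hball (y := x + r • z) (by
      rw [dist_eq_norm, hd]
      calc r * ‖z‖ ≤ r * (√n * 2) := by gcongr
        _ < s := hr2) j
    rw [hd, add_sub_cancel_left, map_smul, smul_eq_mul] at h1
    have e1 : r⁻¹ * (u j (x + r • z) - u j x) - M j z =
        r⁻¹ * (u j (x + r • z) - u j x - r * M j z) := by field_simp
    rw [e1, abs_mul, abs_of_nonneg (by positivity), inv_mul_le_iff₀ hr]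
    refine h1.trans ?_
    calc ε / (√n * 2) * (r * ‖z‖) ≤ ε / (√n * 2) * (r * (√n * 2)) := by gcongr
      _ = r * ε := by field_simp
  by_contra! hcon
  have hpos : 0 < ((∑ j, e j * M j v) ^ n - K * rowDet M) * I := mul_pos (by linarith) hI
  set P := ((∑ j, e j * M j v) ^ n - K * rowDet M) * I
  -- For this `ε` the error `C * ε` is at most half of the positive quantity `P` it should dominate.
  have h1 := hclose (min 1 (P / (2 * (|C| + 1)))) (by positivity) (min_le_left _ _)
  have h2 : C * min 1 (P / (2 * (|C| + 1))) ≤ |C| * (P / (2 * (|C| + 1))) :=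
    mul_le_mul (le_abs_self C) (min_le_right _ _) (by positivity) (abs_nonneg _)
  have h3 : |C| * (P / (2 * (|C| + 1))) ≤ P / 2 := by
    rw [mul_div_assoc', div_le_div_iff₀ (by positivity) (by norm_num)]
    nlinarith [abs_nonneg C]
  linarith

/-! ### Pointwise consequences of quasiregularity on open sets -/

lemma memLp_of_restrict {F : Type*} [NormedAddCommGroup F] {f : Euc n → F} {B : Set (Euc n)}
    {p : ENNReal} (hB : MeasurableSet B) (h0 : ∀ y ∉ B, f y = 0)
    (hf : MemLp f p (volume.restrict B)) : MemLp f p volume := by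
  have h1 : B.indicator f = f := indicator_eq_self.2 fun y hy => by
    by_contra h; exact hy (h0 y h)
  rw [← h1, memLp_indicator_iff_restrict hB]
  exact hf

lemma integrable_of_continuousAt_tsupport {F : Type*} [NormedAddCommGroup F] [NormedSpace ℝ F]
    {χ : Euc n → ℝ} {f : Euc n → F} (hχ : Continuous χ) (hc : HasCompactSupport χ)
    (hf : ∀ y ∈ tsupport χ, ContinuousAt f y) : Integrable (fun y => χ y • f y) volume := by
  refine Continuous.integrable_of_hasCompactSupport ?_ hc.smul_right
  exact continuous_of_tsupport fun y hy =>
    hχ.continuousAt.smul (hf y (tsupport_smul_subset_left _ _ hy))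

lemma fderiv_mul_apply {φ χ : Euc n → ℝ} (hφ : ContDiff ℝ ∞ φ) (hχ : ContDiff ℝ ∞ χ)
    (y v : Euc n) : fderiv ℝ (fun y => φ y * χ y) y v =
      φ y * fderiv ℝ χ y v + χ y * fderiv ℝ φ y v := by
  have h2 : DifferentiableAt ℝ φ y := (hφ.differentiable (by simp)).differentiableAt
  have h3 : DifferentiableAt ℝ χ y := (hχ.differentiable (by simp)).differentiableAt
  rw [fderiv_fun_mul h2 h3]
  simp

/-- The product rule for weak derivatives tested against `φ`. -/
lemma integral_fderiv_mul_cutoff {U : Set (Euc n)} {F : Euc n → Euc n}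
    {Df : Euc n → (Euc n →L[ℝ] Euc n)} (hU : IsOpen U) (hcont : ContinuousOn F U)
    (hw : IsWeakDerivOn U F Df) {χ : Euc n → ℝ} (hχ : ContDiff ℝ ∞ χ) (hχc : HasCompactSupport χ)
    (hχU : tsupport χ ⊆ U) {φ : Euc n → ℝ} (hφ : ContDiff ℝ ∞ φ) (hφc : HasCompactSupport φ)
    (v : Euc n) (j : Fin n) :
    ∫ y, fderiv ℝ φ y v * (χ y * F y j) =
      - ∫ y, φ y * (χ y * Df y v j + F y j * fderiv ℝ χ y v) := by
  have hFat : ∀ y ∈ tsupport χ, ContinuousAt F y := fun y hy =>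
    hcont.continuousAt (hU.mem_nhds (hχU hy))
  have hφχ : ContDiff ℝ ∞ fun y => φ y * χ y := hφ.mul hχ
  have hφχc : HasCompactSupport fun y => φ y * χ y := hφc.mul_right
  have hφχs : tsupport (fun y => φ y * χ y) ⊆ tsupport χ := tsupport_mul_subset_right
  have h1 := hw.integral_eq _ hφχ hφχc (hφχs.trans hχU) v
  have hI1 : Integrable (fun y => fderiv ℝ (fun y => φ y * χ y) y v • F y) volume :=
    integrable_of_continuousAt_tsupport
      ((hφχ.continuous_fderiv (by simp)).clm_apply continuous_const) (hφχc.fderiv_apply ℝ v)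
      fun y hy => hFat y (hφχs (tsupport_fderiv_apply_subset ℝ v hy))
  have hI2 : Integrable (fun y => (φ y * χ y) • Df y v) volume := by
    have hDf : IntegrableOn Df (tsupport χ) :=
      hw.locInt_deriv.integrableOn_compact_subset hχU hχc.isCompact
    have h2 : IntegrableOn (fun y => (φ y * χ y) • Df y v) (tsupport χ) :=
      IntegrableOn.continuousOn_smul (hDf.apply_continuousLinearMap v)
        hφχ.continuous.continuousOn hχc.isCompact
    refine (integrableOn_iff_integrable_of_support_subset fun y hy => ?_).1 h2
    by_contra h
    exact hy (by simp [image_eq_zero_of_notMem_tsupport h])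
  have hJ3 : Integrable (fun y => (φ y * fderiv ℝ χ y v) • F y) volume :=
    integrable_of_continuousAt_tsupport
      (hφ.continuous.mul ((hχ.continuous_fderiv (by simp)).clm_apply continuous_const))
      hφc.mul_right fun y hy =>
        hFat y (tsupport_fderiv_apply_subset ℝ v (tsupport_mul_subset_right hy))
  have h4 := congrArg (EuclideanSpace.proj j : Euc n →L[ℝ] ℝ) h1
  rw [map_neg, ← ContinuousLinearMap.integral_comp_comm _ hI1,
    ← ContinuousLinearMap.integral_comp_comm _ hI2] at h4
  have hJ1 := (EuclideanSpace.proj j : Euc n →L[ℝ] ℝ).integrable_comp hI1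
  have hJ2 := (EuclideanSpace.proj j : Euc n →L[ℝ] ℝ).integrable_comp hI2
  replace hJ3 := (EuclideanSpace.proj j : Euc n →L[ℝ] ℝ).integrable_comp hJ3
  have hp : ∀ w : Euc n, (EuclideanSpace.proj j : Euc n →L[ℝ] ℝ) w = w j := fun _ => rfl
  simp only [hp, PiLp.smul_apply, smul_eq_mul] at h4 hJ1 hJ2 hJ3
  calc ∫ y, fderiv ℝ φ y v * (χ y * F y j)
      = ∫ y, (fderiv ℝ (fun y => φ y * χ y) y v * F y j -
          φ y * fderiv ℝ χ y v * F y j) := by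
        congr 1; ext y; rw [fderiv_mul_apply hφ hχ]; ring
    _ = - ∫ y, (φ y * χ y * Df y v j + φ y * fderiv ℝ χ y v * F y j) := by
        rw [integral_sub hJ1 hJ3, integral_add hJ2 hJ3, h4]; ring
    _ = _ := by
        congr 2; ext y; ring

/-- The components of a map in `W^{1,n}_loc(U)` agree near a point with globally defined functions
with weak gradients. -/
lemma exists_weakGrad_extension {U : Set (Euc n)} {F : Euc n → Euc n}
    {Df : Euc n → (Euc n →L[ℝ] Euc n)} (hU : IsOpen U) (hcont : ContinuousOn F U)
    (hs : HasSobolevDerivOn U F Df) {x : Euc n} {ρ : ℝ} (hρ : 0 < ρ)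
    (hball : Metric.closedBall x (2 * ρ) ⊆ U) :
    ∃ (u : Fin n → Euc n → ℝ) (g : Fin n → Euc n → (Euc n →L[ℝ] ℝ)),
      (∀ j, WeakGrad (u j) (g j)) ∧
        ∀ y ∈ Metric.ball x ρ, ∀ j, u j y = F y j ∧ g j y = row (Df y) j := by
  let χ : ContDiffBump x := ⟨ρ, 2 * ρ, hρ, by linarith⟩
  have hχ : ContDiff ℝ ∞ χ := χ.contDiff
  have hχc : HasCompactSupport χ := χ.hasCompactSupport
  have hχd : Continuous (fderiv ℝ χ) := hχ.continuous_fderiv (by simp)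
  set B := Metric.closedBall x (2 * ρ)
  have hB : IsCompact B := isCompact_closedBall _ _
  have hBm : MeasurableSet B := Metric.isClosed_closedBall.measurableSet
  have hsupp : tsupport χ = B := χ.tsupport_eq
  have hχout : ∀ y ∉ B, χ y = 0 ∧ fderiv ℝ χ y = 0 := by
    intro y hy
    rw [← hsupp] at hy
    exact ⟨image_eq_zero_of_notMem_tsupport hy,
      image_eq_zero_of_notMem_tsupport fun h => hy (tsupport_fderiv_subset ℝ h)⟩
  have hFat : ∀ y ∈ B, ContinuousAt F y := fun y hy =>
    hcont.continuousAt (hU.mem_nhds (hball hy))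
  have hFj : ∀ y ∈ B, ∀ j, ContinuousAt (fun y => F y j) y := fun y hy j =>
    (EuclideanSpace.proj j : Euc n →L[ℝ] ℝ).continuous.continuousAt.comp (hFat y hy)
  have hu : ∀ j, Continuous fun y => χ y * F y j := by
    intro j
    -- Nothing is known about `F` outside `U`, so continuity of the product is checked only on the
    -- support of the cutoff, which lies in `U`.
    refine continuous_of_tsupport fun y hy => ?_
    have hy' : y ∈ B := hsupp ▸ tsupport_mul_subset_left hy
    exact hχ.continuous.continuousAt.mul (hFj y hy' j)
  have hv : ∀ j, Continuous fun y => F y j • fderiv ℝ χ y := by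
    intro j
    refine continuous_of_tsupport fun y hy => ?_
    have hy' : y ∈ B := hsupp ▸ tsupport_fderiv_subset ℝ (tsupport_smul_subset_right _ _ hy)
    exact (hFj y hy' j).smul hχd.continuousAt
  have hDfB := hs.memLp_deriv B hB hball
  have hrow : ∀ j, MemLp (fun y => χ y • row (Df y) j) n (volume.restrict B) := by
    intro j
    have hm : AEStronglyMeasurable (fun y => row (Df y) j) (volume.restrict B) :=
      ((ContinuousLinearMap.compL ℝ (Euc n) (Euc n) ℝ
        (EuclideanSpace.proj j : Euc n →L[ℝ] ℝ)).continuous).comp_aestronglyMeasurable hDfB.1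
    refine hDfB.of_le (hχ.continuous.aestronglyMeasurable.smul hm)
      (Filter.Eventually.of_forall fun y => ?_)
    rw [norm_smul, Real.norm_of_nonneg χ.nonneg]
    calc χ y * ‖row (Df y) j‖ ≤ 1 * ‖Df y‖ :=
          mul_le_mul χ.le_one (norm_row_le _ _) (norm_nonneg _) zero_le_one
      _ = _ := one_mul _
  have hrow' : ∀ j, MemLp (fun y => χ y • row (Df y) j) n volume := by
    intro j
    exact memLp_of_restrict hBm (fun y hy => by simp [(hχout y hy).1]) (hrow j)
  refine ⟨fun j y => χ y * F y j, fun j y => χ y • row (Df y) j + F y j • fderiv ℝ χ y,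
    fun j => ⟨hu j, fun C hC => ?_, fun φ hφ hφc v => ?_⟩, fun y hy j => ?_⟩
  · exact MemLp.add (f := fun y => χ y • row (Df y) j) (g := fun y => F y j • fderiv ℝ χ y)
      ((hrow' j).restrict C) (memLp_restrict_of_continuous (hv j) hC)
  · exact integral_fderiv_mul_cutoff hU hcont hs.weak hχ hχc (hsupp ▸ hball) hφ hφc v j
  · have h1 : χ y = 1 := χ.one_of_mem_closedBall (Metric.ball_subset_closedBall hy)
    have h2 : fderiv ℝ χ y = 0 := by
      have : (χ : Euc n → ℝ) =ᶠ[nhds y] fun _ => 1 :=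
        Filter.eventually_of_mem (Metric.isOpen_ball.mem_nhds hy) fun z hz =>
          χ.one_of_mem_closedBall (Metric.ball_subset_closedBall hz)
      rw [this.fderiv_eq]; simp
    simp [h1, h2]

lemma exists_cube_subset_ball (x : Euc n) {ρ : ℝ} (hρ : 0 < ρ) :
    ∃ r > 0, cube x r ⊆ Metric.ball x ρ := by
  refine ⟨ρ / (√n + 1), by positivity, (cube_subset_closedBall _ _).trans
    (Metric.closedBall_subset_ball ?_)⟩
  rw [← mul_div_assoc, div_lt_iff₀ (by positivity)]
  nlinarith [Real.sqrt_nonneg n]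

lemma qrFamily_row {K : ℝ} {V : Set (Euc n)} {Df : Euc n → (Euc n →L[ℝ] Euc n)}
    {g : Fin n → Euc n → (Euc n →L[ℝ] ℝ)} (hV : MeasurableSet V)
    (h : ∀ᵐ y ∂(volume.restrict V), ‖Df y‖ ^ n ≤ K * (Df y).det)
    (hg : ∀ y ∈ V, ∀ j, g j y = row (Df y) j) : QRFamily K V g := by
  filter_upwards [h, ae_restrict_mem hV] with y hy hyV j
  have : (fun i => g i y) = row (Df y) := funext fun i => hg y hyV i
  rw [this, rowDet_row, hg y hyV j]
  exact (pow_le_pow_left₀ (norm_nonneg _) (norm_row_le _ _) n).trans hy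

lemma hasFDerivAt_iff_row {F : Euc n → Euc n} {M : Euc n →L[ℝ] Euc n} {x : Euc n} :
    HasFDerivAt F M x ↔ ∀ j, HasFDerivAt (fun y => F y j) (row M j) x := by
  simp only [← hasFDerivWithinAt_univ]
  exact hasFDerivWithinAt_euclidean

/-- Maps in `W^{1,n}_loc` satisfying the dilatation inequality are differentiable almost
everywhere. -/
lemma ae_hasFDerivAt (hn : 2 ≤ n) {K : ℝ} (hK : 0 < K) {U : Set (Euc n)} {F : Euc n → Euc n}
    {Df : Euc n → (Euc n →L[ℝ] Euc n)} (hU : IsOpen U) (hcont : ContinuousOn F U)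
    (hs : HasSobolevDerivOn U F Df)
    (hqr : ∀ᵐ x ∂(volume.restrict U), ‖Df x‖ ^ n ≤ K * (Df x).det) :
    ∀ᵐ x ∂(volume.restrict U), HasFDerivAt F (Df x) x := by
  have hn1 : 1 ≤ n := by omega
  rw [ae_restrict_iff' hU.measurableSet, ae_iff]
  -- The claim is local, so near each point the map may be replaced by global functions with weak
  -- gradients.
  refine measure_null_of_locally_null _ fun x hx => ?_
  have hxU : x ∈ U := by
    by_contra h
    exact hx fun h' => absurd h' h
  obtain ⟨s, hs0, hsU⟩ := Metric.nhds_basis_closedBall.mem_iff.1 (hU.mem_nhds hxU)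
  have hρ : 0 < s / 2 := by positivity
  have hball : Metric.closedBall x (2 * (s / 2)) ⊆ U := by rwa [mul_div_cancel₀ _ two_ne_zero]
  obtain ⟨u, g, h, hug⟩ := exists_weakGrad_extension hU hcont hs hρ hball
  have hbU : Metric.ball x (s / 2) ⊆ U := (Metric.ball_subset_closedBall.trans
    (Metric.closedBall_subset_closedBall (by linarith))).trans hsU
  have hleb := ae_all_iff.2 fun j => ae_tendsto_lintegral_cube_sub hn1 (h j).memLp
  refine ⟨_, Filter.inter_mem self_mem_nhdsWithin
    (mem_nhdsWithin_of_mem_nhds (Metric.ball_mem_nhds x hρ)), ?_⟩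
  refine measure_mono_null (fun y hy => ?_) (ae_iff.1 hleb)
  rintro hl
  refine hy.1 fun _ => ?_
  have hyb : y ∈ Metric.ball x (s / 2) := hy.2
  obtain ⟨t, ht, hty⟩ := Metric.isOpen_iff.1 Metric.isOpen_ball y hyb
  obtain ⟨r, hr, hrt⟩ := exists_cube_subset_ball y ht
  have hsub := hrt.trans hty
  have hfam : QRFamily K (cube y r) g :=
    qrFamily_row (isOpen_cube y r).measurableSet
      (ae_mono (Measure.restrict_mono (hsub.trans hbU) le_rfl) hqr)
      fun z hz j => (hug z (hsub hz) j).2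
  refine hasFDerivAt_iff_row.2 fun j => ?_
  have h1 := hasFDerivAt_of_lebesgue hn hK h hr hfam hl j
  rw [(hug y hyb j).2] at h1
  refine h1.congr_of_eventuallyEq ?_
  filter_upwards [Metric.isOpen_ball.mem_nhds hyb] with z hz
  exact ((hug z hz j).1).symm

/-- The dilatation inequality holds at every point of differentiability. -/
lemma IsQuasiregularOn.inner_pow_le (hn : 1 ≤ n) {K : ℝ} {U : Set (Euc n)} {F : Euc n → Euc n}
    (hF : IsQuasiregularOn K U F) (hU : IsOpen U) {x : Euc n} (hx : x ∈ U)
    {M : Euc n →L[ℝ] Euc n} (hM : HasFDerivAt F M x) {v e : Euc n} (hv : ‖v‖ = 1) (he : ‖e‖ = 1)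
    (hb : 0 < inner ℝ (M v) e) : (inner ℝ (M v) e) ^ n ≤ K * M.det := by
  obtain ⟨hK1, hcont, Df, hs, hqr⟩ := hF
  have hK : 0 < K := by linarith
  obtain ⟨s, hs0, hsU⟩ := Metric.nhds_basis_closedBall.mem_iff.1 (hU.mem_nhds hx)
  have hρ : 0 < s / 2 := by positivity
  have hball : Metric.closedBall x (2 * (s / 2)) ⊆ U := by rwa [mul_div_cancel₀ _ two_ne_zero]
  obtain ⟨u, g, h, hug⟩ := exists_weakGrad_extension hU hcont hs hρ hball
  have hbU : Metric.ball x (s / 2) ⊆ U := (Metric.ball_subset_closedBall.trans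
    (Metric.closedBall_subset_closedBall (by linarith))).trans hsU
  obtain ⟨r, hr, hsub⟩ := exists_cube_subset_ball x hρ
  have hQ : MeasurableSet (cube x r) := (isOpen_cube x r).measurableSet
  have hqr' : ∀ᵐ y ∂(volume.restrict (cube x r)), ‖Df y‖ ^ n ≤ K * (Df y).det :=
    (ae_restrict_of_ae_restrict_of_subset (hsub.trans hbU) hqr).mono fun _ h => h.1
  have hfam : QRFamily K (cube x r) g :=
    qrFamily_row hQ hqr' fun z hz j => (hug z (hsub hz) j).2
  -- Pairing with a unit vector `e` turns `‖A v‖` into a quantity linear in `A` and still bounded by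
  -- `‖A‖`, as the passage to the limit requires.
  have hinner : ∀ A : Euc n →L[ℝ] Euc n, inner ℝ (A v) e = ∑ j, e j * row A j v := fun A => by
    rw [PiLp.inner_apply]
    rfl
  have hder : ∀ j, HasFDerivAt (u j) (row M j) x := by
    intro j
    refine (hasFDerivAt_iff_row.1 hM j).congr_of_eventuallyEq ?_
    filter_upwards [Metric.ball_mem_nhds x hρ] with z hz
    exact (hug z hz j).1
  rw [hinner] at hb ⊢
  rw [← rowDet_row]
  refine pow_le_of_hasFDerivAt hn hK h hr hfam hder hv he ?_ hb
  filter_upwards [hqr', ae_restrict_mem hQ] with y hy hyQ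
  have h1 : (fun i => g i y) = row (Df y) := funext fun i => (hug y (hsub hyQ) i).2
  have h2 : ∑ j, e j * g j y v = inner ℝ (Df y v) e := by
    rw [hinner]
    exact Finset.sum_congr rfl fun j _ => by rw [(hug y (hsub hyQ) j).2]
  rw [h1, h2, rowDet_row]
  refine (pow_le_pow_left₀ (abs_nonneg _) ?_ n).trans hy
  calc |inner ℝ (Df y v) e| ≤ ‖Df y v‖ * ‖e‖ := abs_real_inner_le_norm _ _
    _ ≤ ‖Df y‖ * ‖v‖ * ‖e‖ := by gcongr; exact (Df y).le_opNorm v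
    _ = _ := by rw [hv, he, mul_one, mul_one]

/-! ### The inversion of the sphere -/

lemma reflectFirst_apply (x : Euc n) (i : Fin n) :
    reflectFirst x i = if (i : ℕ) = 0 then - x i else x i := rfl

lemma reflectFirst_smul (c : ℝ) (x : Euc n) : reflectFirst (c • x) = c • reflectFirst x := by
  ext i
  simp only [reflectFirst_apply, PiLp.smul_apply, smul_eq_mul]
  split_ifs <;> ring

lemma reflectFirst_reflectFirst (x : Euc n) : reflectFirst (reflectFirst x) = x := by
  ext i
  simp only [reflectFirst_apply]
  split_ifs <;> simp

lemma norm_reflectFirst (x : Euc n) : ‖reflectFirst x‖ = ‖x‖ := by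
  rw [EuclideanSpace.norm_eq, EuclideanSpace.norm_eq]
  congr 1
  refine Finset.sum_congr rfl fun i _ => ?_
  rw [reflectFirst_apply]
  split_ifs <;> simp

lemma continuous_reflectFirst : Continuous (reflectFirst : Euc n → Euc n) := by
  refine (PiLp.continuous_toLp 2 _).comp (continuous_pi fun i => ?_)
  split_ifs <;> fun_prop

/-- The map `x ↦ R x / |x|²` of `ℝⁿ`. -/
noncomputable def invEuc (x : Euc n) : Euc n := (‖x‖ ^ 2)⁻¹ • reflectFirst x

lemma inv_infty : inv (OnePoint.infty : Sph n) = ((0 : Euc n) : Sph n) := rfl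

lemma inv_coe_zero : inv (((0 : Euc n) : Sph n)) = OnePoint.infty := by
  simp [inv]

lemma inv_coe {x : Euc n} (hx : x ≠ 0) : inv (x : Sph n) = ((invEuc x : Euc n) : Sph n) := by
  simp [inv, hx, invEuc]

lemma norm_invEuc (x : Euc n) : ‖invEuc x‖ = ‖x‖⁻¹ := by
  rw [invEuc, norm_smul, norm_reflectFirst, norm_inv, norm_pow, norm_norm]
  rcases eq_or_ne ‖x‖ 0 with h | h
  · simp [h]
  · field_simp

lemma invEuc_ne_zero {x : Euc n} (hx : x ≠ 0) : invEuc x ≠ 0 := by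
  rw [← norm_ne_zero_iff, norm_invEuc]
  exact inv_ne_zero (norm_ne_zero_iff.2 hx)

lemma invEuc_invEuc {x : Euc n} (hx : x ≠ 0) : invEuc (invEuc x) = x := by
  have h : ‖x‖ ≠ 0 := norm_ne_zero_iff.2 hx
  rw [invEuc, norm_invEuc, invEuc, reflectFirst_smul, reflectFirst_reflectFirst, smul_smul]
  rw [inv_pow, inv_inv, mul_inv_cancel₀ (pow_ne_zero _ h), one_smul]

lemma inv_inv_apply (p : Sph n) : inv (inv p) = p := by
  induction p using OnePoint.rec with
  | infty => rw [inv_infty, inv_coe_zero]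
  | coe x =>
    rcases eq_or_ne x 0 with rfl | hx
    · rw [inv_coe_zero, inv_infty]
    · rw [inv_coe hx, inv_coe (invEuc_ne_zero hx), invEuc_invEuc hx]

lemma continuous_inv_sph : Continuous (inv : Sph n → Sph n) := by
  rw [continuous_iff_continuousAt]
  intro p
  induction p using OnePoint.rec with
  | infty =>
    rw [OnePoint.continuousAt_infty', inv_infty, Filter.coclosedCompact_eq_cocompact]
    have h1 : Filter.Tendsto (invEuc : Euc n → Euc n) (Filter.cocompact _) (nhds 0) := by
      rw [tendsto_zero_iff_norm_tendsto_zero]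
      simp only [norm_invEuc]
      exact tendsto_inv_atTop_zero.comp tendsto_norm_cocompact_atTop
    have h2 := (OnePoint.continuous_coe.tendsto (0 : Euc n)).comp h1
    refine h2.congr' ?_
    have h3 : ∀ᶠ x : Euc n in Filter.cocompact _, x ≠ 0 :=
      (isCompact_singleton (x := (0 : Euc n))).compl_mem_cocompact
    filter_upwards [h3] with x hx
    exact (inv_coe hx).symm
  | coe x =>
    rw [OnePoint.continuousAt_coe]
    rcases eq_or_ne x 0 with rfl | hx
    · rw [ContinuousAt, Function.comp_apply, inv_coe_zero, Filter.Tendsto,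
        OnePoint.le_nhds_infty]
      intro s _ hs
      obtain ⟨R, hR⟩ := hs.isBounded.exists_norm_le
      rw [Filter.mem_map]
      filter_upwards [Metric.ball_mem_nhds (0 : Euc n) (show 0 < (|R| + 1)⁻¹ by positivity)]
        with y hy
      rcases eq_or_ne y 0 with rfl | hy0
      · simp [inv_coe_zero]
      · refine Or.inl ⟨invEuc y, fun hz => ?_, (inv_coe hy0).symm⟩
        have h1 := hR _ hz
        rw [norm_invEuc] at h1
        rw [mem_ball_zero_iff] at hy
        have h2 : |R| + 1 < ‖y‖⁻¹ := by
          rw [lt_inv_comm₀ (by positivity) (norm_pos_iff.2 hy0)]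
          exact hy
        linarith [le_abs_self R]
    · have h1 : ContinuousAt (invEuc : Euc n → Euc n) x := by
        have hc : ContinuousAt (fun y : Euc n => ‖y‖ ^ 2) x := by fun_prop
        exact (hc.inv₀ (pow_ne_zero _ (norm_ne_zero_iff.2 hx))).smul
          continuous_reflectFirst.continuousAt
      have h2 : ContinuousAt (fun y : Euc n => ((invEuc y : Euc n) : Sph n)) x :=
        OnePoint.continuous_coe.continuousAt.comp h1
      refine h2.congr ?_
      filter_upwards [isOpen_ne.mem_nhds hx] with y hy
      exact (inv_coe hy).symm

/-! ### Charts -/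

lemma continuous_chart {α : Sph n → Sph n} (hα : α ∈ ({id, inv} : Set (Sph n → Sph n))) :
    Continuous α := by
  rcases hα with rfl | rfl
  · exact continuous_id
  · exact continuous_inv_sph

lemma chart_chart {α : Sph n → Sph n} (hα : α ∈ ({id, inv} : Set (Sph n → Sph n))) (p : Sph n) :
    α (α p) = p := by
  rcases hα with rfl | rfl
  · rfl
  · exact inv_inv_apply p

lemma isMobius_chart {α : Sph n → Sph n} (hα : α ∈ ({id, inv} : Set (Sph n → Sph n))) :
    IsMobius α := by
  rcases hα with rfl | rfl
  · have h := IsMobius.similarity (n := n) 1 one_pos (LinearIsometryEquiv.refl ℝ (Euc n))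
      (by
        have : ((LinearIsometryEquiv.refl ℝ (Euc n)).toLinearEquiv : Euc n →ₗ[ℝ] Euc n) =
          LinearMap.id := rfl
        rw [this, LinearMap.det_id]) 0
    have e : (fun x : Euc n => (1 : ℝ) • LinearIsometryEquiv.refl ℝ (Euc n) x + 0) = id := by
      ext x; simp
    rwa [e, OnePoint.map_id] at h
  · exact IsMobius.inversion

lemma isOpen_finiteDomain {g : Sph n → Sph n} (hg : Continuous g) : IsOpen (finiteDomain g) :=
  (isOpen_compl_singleton (x := (OnePoint.infty : Sph n))).preimage
    (hg.comp OnePoint.continuous_coe)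

lemma coe_finitePart {g : Sph n → Sph n} {x : Euc n} (hx : x ∈ finiteDomain g) :
    ((finitePart g x : Euc n) : Sph n) = g x := by
  obtain ⟨y, hy⟩ := OnePoint.ne_infty_iff_exists.1 hx
  rw [finitePart, ← hy]
  rfl

lemma toEuc_coe (y : Euc n) : toEuc (y : Sph n) = y := rfl

/-! ### Iteration at a fixed point and the choice of the Möbius map. -/

/-- The derivatives of the iterates at a fixed point. -/
lemma hasFDerivAt_iterate {H : Sph n → Sph n} (hH : Continuous H) {x : Euc n}
    (hx : H x = (x : Sph n)) {N : Euc n →L[ℝ] Euc n} (hN : HasFDerivAt (finitePart H) N x) (m : ℕ) :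
    H^[m] x = (x : Sph n) ∧ HasFDerivAt (finitePart H^[m]) (N ^ m) x := by
  have hxU : x ∈ finiteDomain H := by
    change H x ≠ _
    rw [hx]; exact OnePoint.coe_ne_infty x
  have hfx : finitePart H x = x := by rw [finitePart, hx, toEuc_coe]
  induction m with
  | zero =>
    refine ⟨rfl, ?_⟩
    have : finitePart (H^[0]) = (id : Euc n → Euc n) := rfl
    rw [this]
    exact hasFDerivAt_id x
  | succ m ih =>
    refine ⟨by rw [Function.iterate_succ_apply, hx, ih.1], ?_⟩
    have h1 : HasFDerivAt (finitePart H^[m]) (N ^ m) (finitePart H x) := by rw [hfx]; exact ih.2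
    have h2 := h1.comp x hN
    rw [pow_succ]
    -- Finite parts compose correctly only where `H` is finite, which is an open neighbourhood of
    -- `x`; elsewhere `finitePart` takes a default value.
    refine h2.congr_of_eventuallyEq ?_
    filter_upwards [(isOpen_finiteDomain hH).mem_nhds hxU] with y hy
    rw [Function.comp_apply, finitePart, Function.iterate_succ_apply, ← coe_finitePart hy]
    rfl

lemma iterate_mem_generatedSemigroup {X : Type} {T : Set (X → X)} {g : X → X}
    (hg : g ∈ generatedSemigroup T) {m : ℕ} (hm : 1 ≤ m) : g^[m] ∈ generatedSemigroup T := by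
  induction m, hm using Nat.le_induction with
  | base => exact hg
  | succ m _ ih => exact Generated.comp _ _ ih hg

/-- A quasiregular map which is not `1`-quasiregular has, in suitable charts, a nondegenerate
derivative violating the conformality inequality. -/
lemma exists_nonconformal_point (hn : 2 ≤ n) {K : ℝ} {f : Sph n → Sph n}
    (hf : IsQuasiregular K f) (hf1 : ¬ IsQuasiregular 1 f) :
    ∃ α ∈ ({id, inv} : Set (Sph n → Sph n)), ∃ β ∈ ({id, inv} : Set (Sph n → Sph n)),
      ∃ x ∈ finiteDomain (β ∘ f ∘ α), ∃ L : Euc n →L[ℝ] Euc n,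
        HasFDerivAt (finitePart (β ∘ f ∘ α)) L x ∧ 0 < L.det ∧ L.det < ‖L‖ ^ n := by
  have h1 : ¬ ∀ α ∈ ({id, inv} : Set (Sph n → Sph n)), ∀ β ∈ ({id, inv} : Set (Sph n → Sph n)),
      IsQuasiregularOn 1 (finiteDomain (β ∘ f ∘ α)) (finitePart (β ∘ f ∘ α)) :=
    fun h => hf1 ⟨hf.1, h⟩
  push Not at h1
  obtain ⟨α, hα, β, hβ, hnot⟩ := h1
  refine ⟨α, hα, β, hβ, ?_⟩
  obtain ⟨hK, hcont, Df, hs, hqr⟩ := hf.2 α hα β hβ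
  have hU : IsOpen (finiteDomain (β ∘ f ∘ α)) :=
    isOpen_finiteDomain ((continuous_chart hβ).comp (hf.1.comp (continuous_chart hα)))
  have hK0 : 0 < K := by linarith
  have hder := ae_hasFDerivAt hn hK0 hU hcont hs (hqr.mono fun _ h => h.1)
  -- The inequalities with constant `1` fail on a set that is not null, which therefore meets the
  -- full-measure set where `Df` is the derivative and satisfies the bounds with `K`.
  have hfreq : ∃ᶠ x in ae (volume.restrict (finiteDomain (β ∘ f ∘ α))),
      ¬ (‖Df x‖ ^ n ≤ 1 * (Df x).det ∧
        ∀ h : Euc n, ‖h‖ = 1 → (Df x).det ≤ 1 * ‖Df x h‖ ^ n) :=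
    Filter.not_eventually.1 fun h => hnot ⟨le_rfl, hcont, Df, hs, h⟩
  obtain ⟨x, hx, ⟨hx1, hx2⟩, hx3⟩ := (hfreq.and_eventually
    ((hder.and hqr).and (ae_restrict_mem hU.measurableSet))).exists
  have hlt : (Df x).det < ‖Df x‖ ^ n := by
    by_contra! hle
    refine hx ⟨by rwa [one_mul], fun h hh => ?_⟩
    rw [one_mul]
    exact det_le_norm_apply_pow (by omega) (Df x) hle h hh
  refine ⟨x, hx3, Df x, hx1, ?_, hlt⟩
  -- A determinant `≤ 0` would, by the outer bound with `K`, force both `‖Df x‖ ^ n` and the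
  -- determinant to be zero, against the strict inequality.
  by_contra! hle
  have h2 := hx2.1
  have h3 : 0 ≤ ‖Df x‖ ^ n := by positivity
  nlinarith

/-- A map which, in a chart, fixes a point where its derivative `N` has an eigenvalue `c > 0` with
`0 < det N < cⁿ` is not uniformly quasiregular. -/
lemma not_isUqr_of_fixedPoint (hn : 1 ≤ n) {G H : Sph n → Sph n} {α : Sph n → Sph n}
    (hα : α ∈ ({id, inv} : Set (Sph n → Sph n))) (hH : Continuous H)
    (hsemi : Function.Semiconj α H G) {x : Euc n} (hx : H x = (x : Sph n))
    {N : Euc n →L[ℝ] Euc n} (hN : HasFDerivAt (finitePart H) N x) {c : ℝ} {v : Euc n}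
    (hv : ‖v‖ = 1) (hc : 0 < c) (hNv : N v = c • v) (hdet0 : 0 < N.det) (hdet : N.det < c ^ n) :
    ¬ IsUqr G := by
  rintro ⟨K', hG⟩
  have hpow : ∀ m : ℕ, (N ^ m) v = c ^ m • v := by
    intro m
    induction m with
    | zero => simp
    | succ m ih =>
      rw [pow_succ, mul_apply_eq_comp, hNv, map_smul, ih, smul_smul, pow_succ,
        mul_comm]
  have hdetpow : ∀ m : ℕ, (N ^ m).det = N.det ^ m := by
    intro m
    simp only [ContinuousLinearMap.det]
    rw [← map_pow]
    congr 1
    induction m with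
    | zero => rfl
    | succ m ih => rw [pow_succ, pow_succ, ← ih]; rfl
  have hbound : ∀ m : ℕ, 1 ≤ m → (c ^ n) ^ m ≤ K' * N.det ^ m := by
    intro m hm
    obtain ⟨hfix, hder⟩ := hasFDerivAt_iterate hH hx hN m
    -- Because `α` is an involution, the iterates of `H` are those of `G` read in the same chart `α`
    -- at source and target, and the quasiregularity of `G^[m]` covers this pair of charts.
    have hconj : α ∘ G^[m] ∘ α = H^[m] := by
      ext1 p
      have := hsemi.iterate_right m
      rw [Function.comp_apply, Function.comp_apply, ← this p, chart_chart hα]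
    have hq := (hG m hm).2 α hα α hα
    rw [hconj] at hq
    have hmem : x ∈ finiteDomain H^[m] := by
      change H^[m] x ≠ _
      rw [hfix]; exact OnePoint.coe_ne_infty x
    have hinner : inner ℝ ((N ^ m) v) v = c ^ m := by
      rw [hpow, real_inner_smul_left, real_inner_self_eq_norm_sq, hv, one_pow, mul_one]
    have := hq.inner_pow_le hn (isOpen_finiteDomain (hH.iterate m)) hmem hder hv hv
      (by rw [hinner]; positivity)
    rwa [hinner, hdetpow, ← pow_mul, mul_comm m n, pow_mul] at this
  -- The bound at the fixed point says that all powers of this ratio stay below `K'`, which is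
  -- impossible for a ratio exceeding `1`.
  have hq1 : 1 < c ^ n / N.det := (one_lt_div hdet0).2 hdet
  obtain ⟨m, hm⟩ := pow_unbounded_of_one_lt K' hq1
  have h1 := hbound (m + 1) (by omega)
  rw [← div_le_iff₀ (by positivity), ← div_pow] at h1
  have h2 : (c ^ n / N.det) ^ m ≤ (c ^ n / N.det) ^ (m + 1) :=
    pow_le_pow_right₀ hq1.le (by omega)
  linarith

/-- A non-`1`-quasiregular map can be composed with a Möbius map so as not to be uqr. -/
lemma exists_isMobius_not_isUqr (hn : 2 ≤ n) {K : ℝ} {f : Sph n → Sph n}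
    (hf : IsQuasiregular K f) (hf1 : ¬ IsQuasiregular 1 f) :
    ∃ A : Sph n → Sph n, IsMobius A ∧ ¬ IsUqr (A ∘ f) := by
  obtain ⟨α, hα, β, hβ, x, hx, L, hL, hdet0, hdet⟩ := exists_nonconformal_point hn hf hf1
  have hn1 : 1 ≤ n := by omega
  have hLpos : 0 < ‖L‖ := by
    by_contra! h
    have : ‖L‖ = 0 := le_antisymm h (norm_nonneg _)
    rw [this, zero_pow (by omega)] at hdet
    linarith
  obtain ⟨v, hv, hLv⟩ := exists_norm_eq_opNorm hn1 L
  -- Rotating the longest image vector back onto the direction of `v` makes the maximal stretching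
  -- an eigenvalue, so that it compounds under iteration.
  obtain ⟨O, hOdet, hO⟩ := exists_rotation hn (L v) (‖L‖ • v)
    (by rw [norm_smul, norm_norm, hv, mul_one, hLv])
  set F := finitePart (β ∘ f ∘ α)
  -- The translation part is chosen so that `S (F x) = x`.
  let S : Euc n → Euc n := fun y => (1 : ℝ) • O y + (x - O (F x))
  have hS : IsMobius (OnePoint.map S) := IsMobius.similarity 1 one_pos O hOdet _
  have hScont : Continuous (OnePoint.map S) := by
    refine OnePoint.continuous_map (by fun_prop) ?_
    rw [Filter.coclosedCompact_eq_cocompact]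
    have h1 := (O.toHomeomorph.trans
      (Homeomorph.addRight (x - O (F x)))).isClosedEmbedding.tendsto_cocompact
    exact h1.congr fun y => by simp [S]
  set N : Euc n →L[ℝ] Euc n := (O : Euc n →L[ℝ] Euc n).comp L
  set H := OnePoint.map S ∘ β ∘ f ∘ α
  have hβfα : Continuous (β ∘ f ∘ α) :=
    (continuous_chart hβ).comp (hf.1.comp (continuous_chart hα))
  have hHF : ∀ y ∈ finiteDomain (β ∘ f ∘ α), H y = ((S (F y) : Euc n) : Sph n) := by
    intro y hy
    change OnePoint.map S ((β ∘ f ∘ α) y) = _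
    rw [← coe_finitePart hy]
    rfl
  have hHx : H x = (x : Sph n) := by
    rw [hHF x hx]
    simp [S]
  have hN : HasFDerivAt (finitePart H) N x := by
    have h1 : HasFDerivAt (fun y => S (F y)) N x := by
      have h2 := ((O : Euc n →L[ℝ] Euc n).hasFDerivAt.comp x hL).add_const (x - O (F x))
      refine h2.congr_of_eventuallyEq (Filter.Eventually.of_forall fun y => ?_)
      simp [S]
    refine h1.congr_of_eventuallyEq ?_
    filter_upwards [(isOpen_finiteDomain hβfα).mem_nhds hx] with y hy
    rw [finitePart, hHF y hy, toEuc_coe]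
  have hNdet : N.det = L.det := by
    have h1 : (N : Euc n →ₗ[ℝ] Euc n) =
      (O.toLinearEquiv : Euc n →ₗ[ℝ] Euc n) ∘ₗ (L : Euc n →ₗ[ℝ] Euc n) := rfl
    rw [ContinuousLinearMap.det, h1, LinearMap.det_comp, hOdet, one_mul]
  -- With this choice `α` intertwines `H` with the composition of the Möbius map and `f` by
  -- definition, so the fixed point of `H` is the chart picture of one for the composition.
  refine ⟨α ∘ OnePoint.map S ∘ β, (isMobius_chart hα).comp _ _ (hS.comp _ _ (isMobius_chart hβ)), ?_⟩
  exact not_isUqr_of_fixedPoint hn1 hα (hScont.comp hβfα) (fun p => rfl) hHx hN hv hLpos hO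
    (by rwa [hNdet]) (by rwa [hNdet])

end QRSemigroup

theorem proposition5p1 (n : ℕ) (hn : 2 ≤ n) (K : ℝ) (hK : 1 < K)
    (f : QRSemigroup.Sph n → QRSemigroup.Sph n)
    (hf : QRSemigroup.IsUniformlyQuasiregular K f)
    (hf1 : ¬ QRSemigroup.IsQuasiregular 1 f)
    (x₀ : QRSemigroup.Sph n)
    (L : QRSemigroup.Euc n →L[ℝ] QRSemigroup.Euc n)
    (hL : QRSemigroup.HasDerivAtPoint f L x₀)
    (hLc : ¬ QRSemigroup.IsConformalLinear L) :
    ∃ A : QRSemigroup.Sph n → QRSemigroup.Sph n, QRSemigroup.IsMobius A ∧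
      ¬ QRSemigroup.IsUqr (A ∘ f) ∧
      (¬ ∃ K' : ℝ, ∀ g ∈ QRSemigroup.generatedSemigroup {f, A},
        QRSemigroup.IsQuasiregular K' g) ∧
      ¬ QRSemigroup.IsQuasiregularSemigroup (QRSemigroup.generatedSemigroup {f, A}) := by
  obtain ⟨A, hA, hAf⟩ := QRSemigroup.exists_isMobius_not_isUqr hn (hf 1 le_rfl) hf1
  have hmem : A ∘ f ∈ QRSemigroup.generatedSemigroup {f, A} :=
    QRSemigroup.Generated.comp _ _ (QRSemigroup.Generated.of _ (by simp))
      (QRSemigroup.Generated.of _ (by simp))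
  -- A common constant for the semigroup would bound the dilatation of every iterate of `A ∘ f`,
  -- making it uqr.
  have hnot : ¬ ∃ K' : ℝ, ∀ g ∈ QRSemigroup.generatedSemigroup {f, A},
      QRSemigroup.IsQuasiregular K' g := fun ⟨K', hK'⟩ =>
    hAf ⟨K', fun m hm => hK' _ (QRSemigroup.iterate_mem_generatedSemigroup hmem hm)⟩
  exact ⟨A, hA, hAf, hnot, fun h => hnot h.1⟩
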